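/- Let $n\in\mathbb N$, $b\in\mathbb{R}^n$ and let $\varphi\in C^{1,1}(\mathbb{R}^n)$ (i.e. $\varphi\in C^1$ with $\nabla\varphi$ Lipschitz), with $\{\varphi>0\}$ nonempty and with compact closure. Assume that $\varphi$ is concave in $\{\varphi>0\}$ (that is, on every convex subset of this set) or, more generally, that $$(\Delta+\partial^2_{bb})\varphi\le 0\quad\text{almost everywhere in }\{\varphi>0\},\qquad \partial^2_{bb}:=\sum_{i,j} b_ib_j\partial_{ij}.$$ Let $$(-\Delta)^{1/2}u(x)=\frac{\Gamma(\frac{n+1}{2})}{\pi^{(n+1)/2}}\int_{\mathbb{R}^n}\Big(u(x)-\frac{u(x+y)+u(x-y)}{2}\Big)\frac{dy}{|y|^{n+1}},$$ and let $u$ be a continuous viscosity solution of the obstacle problem $$\min\{(-\Delta)^{1/2}u+b\cdot\nabla u,\ u-\varphi\}=0\ \text{ in }\mathbb{R}^n,\qquad \lim_{|x|\to\infty}u(x)=0;$$ that is, $u\ge\varphi$ in $\mathbb{R}^n$, $(-\Delta)^{1/2}u+b\cdot\nabla u\ge0$ in $\mathbb{R}^n$ and $(-\Delta)^{1/2}u+b\cdot\nabla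 u\le0$ in $\{u>\varphi\}$, both in the viscosity sense. Here the inequality $\ge0$ (respectively $\le0$) holds in the viscosity sense in a set $\Omega$ if, whenever $x\in\Omega$, $r>0$ and $\psi\in C^2(\mathbb{R}^n)$ satisfy $\psi(x)=u(x)$ and $\psi\le u$ (respectively $\psi\ge u$) in $B_r(x)$, the function $v$ equal to $\psi$ in $B_r(x)$ and to $u$ outside $B_r(x)$ satisfies $(-\Delta)^{1/2}v(x)+b\cdot\nabla v(x)\ge0$ (respectively $\le0$). Then there exist constants $c,r_0>0$ such that for every free boundary point $x_0\in\partial\{u=\varphi\}$, $$\sup_{B_r(x_0)}(u-\varphi)\ \ge\ c\,r^2\qquad\text{for all }0<r<r_0.$$ -/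

import Mathlib

open Set Filter Topology MeasureTheory Metric
open scoped Laplacian

/-- The half-Laplacian of `u : ℝⁿ → ℝ` at `x`, with its standard normalisation (Fourier symbol `|ξ|`):
`(-Δ)^{1/2} u (x) = c_n ∫ (u(x) - (u(x+y) + u(x-y))/2) |y|^{-(n+1)} dy`,
`c_n = Γ((n+1)/2) / π^{(n+1)/2}`. -/
noncomputable def halfLaplacian {n : ℕ} (u : EuclideanSpace ℝ (Fin n) → ℝ)
    (x : EuclideanSpace ℝ (Fin n)) : ℝ :=
  Real.Gamma (((n : ℝ) + 1) / 2) / Real.pi ^ (((n : ℝ) + 1) / 2) *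
    ∫ y : EuclideanSpace ℝ (Fin n), (u x - (u (x + y) + u (x - y)) / 2) / ‖y‖ ^ (n + 1)

/-- The function equal to `ψ` in the ball `B_r(x)` and to `u` outside of it. -/
noncomputable def testGlue {n : ℕ} (u ψ : EuclideanSpace ℝ (Fin n) → ℝ)
    (x : EuclideanSpace ℝ (Fin n)) (r : ℝ) : EuclideanSpace ℝ (Fin n) → ℝ :=
  fun y => if dist y x < r then ψ y else u y

/-- `(-Δ)^{1/2} u + b · ∇ u ≥ 0` in `Ω` in the viscosity sense: whenever a `C²` function `ψ`
touches `u` from below at `x ∈ Ω` in a ball `B_r(x)`, the inequality holds at `x` for the function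
equal to `ψ` in `B_r(x)` and to `u` elsewhere. -/
def IsViscositySupersolution {n : ℕ} (b : EuclideanSpace ℝ (Fin n))
    (u : EuclideanSpace ℝ (Fin n) → ℝ) (Ω : Set (EuclideanSpace ℝ (Fin n))) : Prop :=
  ∀ x ∈ Ω, ∀ r : ℝ, 0 < r → ∀ ψ : EuclideanSpace ℝ (Fin n) → ℝ, ContDiff ℝ 2 ψ →
    ψ x = u x → (∀ y ∈ ball x r, ψ y ≤ u y) →
      0 ≤ halfLaplacian (testGlue u ψ x r) x + fderiv ℝ ψ x b

/-- `(-Δ)^{1/2} u + b · ∇ u ≤ 0` in `Ω` in the viscosity sense: the same with `ψ` touching from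
above. -/
def IsViscositySubsolution {n : ℕ} (b : EuclideanSpace ℝ (Fin n))
    (u : EuclideanSpace ℝ (Fin n) → ℝ) (Ω : Set (EuclideanSpace ℝ (Fin n))) : Prop :=
  ∀ x ∈ Ω, ∀ r : ℝ, 0 < r → ∀ ψ : EuclideanSpace ℝ (Fin n) → ℝ, ContDiff ℝ 2 ψ →
    ψ x = u x → (∀ y ∈ ball x r, u y ≤ ψ y) →
      halfLaplacian (testGlue u ψ x r) x + fderiv ℝ ψ x b ≤ 0

/-- `u` is a (viscosity) solution of the obstacle problem
`min {(-Δ)^{1/2} u + b · ∇ u, u - φ} = 0` in `ℝⁿ`, `u(x) → 0` as `|x| → ∞`. -/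
structure IsObstacleSolution {n : ℕ} (b : EuclideanSpace ℝ (Fin n))
    (φ u : EuclideanSpace ℝ (Fin n) → ℝ) : Prop where
  continuous : Continuous u
  above : ∀ x, φ x ≤ u x
  supersolution : IsViscositySupersolution b u univ
  subsolution : IsViscositySubsolution b u {x | φ x < u x}
  vanishing : Tendsto u (cocompact (EuclideanSpace ℝ (Fin n))) (𝓝 0)

/-- `φ ∈ C^{1,1}(ℝⁿ)`: continuously differentiable with Lipschitz derivative. -/
def IsC11 {n : ℕ} (φ : EuclideanSpace ℝ (Fin n) → ℝ) : Prop :=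
  ContDiff ℝ 1 φ ∧ ∃ K : NNReal, LipschitzWith K (fderiv ℝ φ)

/-- `φ` is concave in the (not necessarily convex) set `U`: it is concave on every convex subset. -/
def IsConcaveIn {n : ℕ} (φ : EuclideanSpace ℝ (Fin n) → ℝ)
    (U : Set (EuclideanSpace ℝ (Fin n))) : Prop :=
  ∀ S ⊆ U, Convex ℝ S → ConcaveOn ℝ S φ

/-- `(Δ + ∂²_{bb}) φ ≤ 0` in `U`, where `∂²_{bb} = ∑ b_i b_j ∂_{ij}`. A `C^{1,1}` function is twice
differentiable almost everywhere, and the inequality is required almost everywhere. -/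
def IsSuperharmonicAlong {n : ℕ} (b : EuclideanSpace ℝ (Fin n))
    (φ : EuclideanSpace ℝ (Fin n) → ℝ) (U : Set (EuclideanSpace ℝ (Fin n))) : Prop :=
  ∀ᵐ x : EuclideanSpace ℝ (Fin n), x ∈ U → (Δ φ) x + iteratedFDeriv ℝ 2 φ x ![b, b] ≤ 0

/-! Let `U` be the harmonic extension of `u` to the half-space. The functions `T_s u(x) = U(x - s b,
s)` form the orbit of `u` under the semigroup generated by `-((-Δ)^{1/2} + b·∇)`, so `(u - T_s u)/s`
is a regularisation of `μ = (-Δ)^{1/2}u + b·∇u`. Formally `μ` is a nonnegative measure carried by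
the contact set. Working with these quotients avoids any regularity theory for `u`.

The viscosity inequalities are used only through parabolic comparison with this semigroup. The
supersolution property gives `T_s u ≤ u`. The subsolution property, together with a linear bound for
`u - T_s u` on the contact set (`exists_contact_bound`, from `φ ∈ C^{1,1}`), gives `u - T_s u =
O(s²)` away from the contact set (`exists_defect_bound`). Letting `s → 0`, only mass near the
contact set survives. This mass is bounded below, since `U` decreases strictly somewhere along the
direction `(-b, 1)`.

The key algebra is the factorisation `(∂_t + ∂_b)(∂_t - ∂_b)U = (∂_tt - ∂_bb)U = -(Δ + ∂_bb)U`,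
where harmonicity gives the last equality. The extension of `μ` is `-(∂_t - ∂_b)U`, hence `(Δ +
∂_bb)U` is `μ` integrated against the `(b, 1)`-derivative of the Poisson kernel. Near the boundary
and away from the pole, this derivative is bounded below by a positive constant. Thus `(Δ +
∂_bb)U(·, t) ≥ c > 0` for small `t` off the contact set, and `c` does not degenerate on approach to
it; only the admissible range of `t` shrinks (`exists_elliptic_lower_bound`).

On the other side `(Δ + ∂_bb)φ ≤ 0` holds in the viscosity sense in `{φ > 0}` (`obstacle_touching`),
and the contact set lies in `{φ > 0}` because `u > 0`. The classical nondegeneracy argument then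
applies: around a noncontact point `x₁`, the function `U(·, t) - κ|x - x₁|² - φ` has no interior
maximum, which forces quadratic growth of `u - φ` (`exists_growth`). Free boundary points are limits
of such `x₁`. -/

/-- Euclidean space of dimension `n`. -/
abbrev Euc (n : ℕ) := EuclideanSpace ℝ (Fin n)

/-! ### Normalisation of the Poisson kernel and integrability of the Lévy measure. -/

/-- The normalisation constant of the half-Laplacian and of the Poisson kernel. -/
noncomputable def halfLapConst (n : ℕ) : ℝ :=
  Real.Gamma (((n : ℝ) + 1) / 2) / Real.pi ^ (((n : ℝ) + 1) / 2)

/-- The Poisson kernel of the half-space `ℝⁿ × (0, ∞)`. -/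
noncomputable def halfSpaceKernel {n : ℕ} (q : Euc n × ℝ) : ℝ :=
  halfLapConst n * q.2 * (‖q.1‖ ^ 2 + q.2 ^ 2) ^ (-(((n : ℝ) + 1) / 2))

/-- The Poisson kernel at height one. -/
noncomputable def poissonDensity {n : ℕ} (y : Euc n) : ℝ := halfSpaceKernel (y, 1)

lemma halfLapConst_pos (n : ℕ) : 0 < halfLapConst n := by
  unfold halfLapConst
  have : 0 < ((n : ℝ) + 1) / 2 := by positivity
  exact div_pos (Real.Gamma_pos_of_pos this) (by positivity)

lemma poissonDensity_eq {n : ℕ} (y : Euc n) :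
    poissonDensity y = halfLapConst n * (1 + ‖y‖ ^ 2) ^ (-(((n : ℝ) + 1) / 2)) := by
  simp [poissonDensity, halfSpaceKernel, add_comm]

lemma poissonDensity_pos {n : ℕ} (y : Euc n) : 0 < poissonDensity y := by
  rw [poissonDensity_eq]
  have := halfLapConst_pos n
  positivity

lemma poissonDensity_neg {n : ℕ} (y : Euc n) : poissonDensity (-y) = poissonDensity y := by
  simp [poissonDensity_eq]

lemma continuous_poissonDensity {n : ℕ} : Continuous (poissonDensity (n := n)) := by
  have : (poissonDensity (n := n)) =
      fun y => halfLapConst n * (1 + ‖y‖ ^ 2) ^ (-(((n : ℝ) + 1) / 2)) :=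
    funext poissonDensity_eq
  rw [this]
  refine continuous_const.mul (Continuous.rpow_const (by fun_prop) fun y => Or.inl ?_)
  positivity

/-- The Bochner integral of a nonintegrable function is `0`, whereas the Gaussian formula gives a
positive value. -/
lemma integrable_gaussian_norm {n : ℕ} {s : ℝ} (hs : 0 < s) :
    Integrable (fun y : Euc n => Real.exp (-s * ‖y‖ ^ 2)) := by
  by_contra h
  have h1 := GaussianFourier.integral_rexp_neg_mul_sq_norm (V := Euc n) hs
  rw [integral_undef h] at h1
  have : 0 < (Real.pi / s) ^ ((Module.finrank ℝ (Euc n) : ℝ) / 2) := by positivity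
  linarith

lemma poisson_fubini_integrand {n : ℕ} {s : ℝ} (hs : 0 < s) :
    ∫ y : Euc n, s ^ (((n : ℝ) + 1) / 2 - 1) * Real.exp (-((1 + ‖y‖ ^ 2) * s)) =
      Real.pi ^ ((n : ℝ) / 2) * (s ^ ((1 / 2 : ℝ) - 1) * Real.exp (-(1 * s))) := by
  have h1 := GaussianFourier.integral_rexp_neg_mul_sq_norm (V := Euc n) hs
  have h2 : ∀ y : Euc n, s ^ (((n : ℝ) + 1) / 2 - 1) * Real.exp (-((1 + ‖y‖ ^ 2) * s)) =
      s ^ (((n : ℝ) + 1) / 2 - 1) * Real.exp (-(1 * s)) * Real.exp (-s * ‖y‖ ^ 2) := by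
    intro y
    rw [mul_assoc, ← Real.exp_add]
    congr 2
    ring
  simp_rw [h2]
  rw [integral_const_mul, h1, finrank_euclideanSpace_fin, Real.div_rpow Real.pi_pos.le hs.le]
  have h3 : s ^ (((n : ℝ) + 1) / 2 - 1) = s ^ ((1 / 2 : ℝ) - 1) * s ^ ((n : ℝ) / 2) := by
    rw [← Real.rpow_add hs]
    congr 1
    ring
  rw [h3]
  have : s ^ ((n : ℝ) / 2) ≠ 0 := by positivity
  field_simp

/-- Subordination: write `Γ(a)(1+|y|²)^{-a}` as a Gamma integral of Gaussians in `y` and exchange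
the integrals. The Gaussian integral leaves `π^{n/2} Γ(1/2)`. -/
lemma integral_one_add_norm_sq_rpow (n : ℕ) :
    Real.Gamma (((n : ℝ) + 1) / 2) * ∫ y : Euc n, (1 + ‖y‖ ^ 2) ^ (-(((n : ℝ) + 1) / 2)) =
      Real.pi ^ (((n : ℝ) + 1) / 2) := by
  set a : ℝ := ((n : ℝ) + 1) / 2 with ha
  have ha0 : 0 < a := by positivity
  let f : Euc n × ℝ → ℝ := fun q => q.2 ^ (a - 1) * Real.exp (-((1 + ‖q.1‖ ^ 2) * q.2))
  have hfm : Measurable f := by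
    refine (measurable_snd.pow_const _).mul ?_
    fun_prop
  have hmem : ∀ᵐ s ∂(volume.restrict (Ioi (0 : ℝ))), s ∈ Ioi (0 : ℝ) :=
    ae_restrict_mem measurableSet_Ioi
  have hint : Integrable f ((volume : Measure (Euc n)).prod (volume.restrict (Ioi (0 : ℝ)))) := by
    rw [integrable_prod_iff' hfm.aestronglyMeasurable]
    constructor
    · filter_upwards [hmem] with s hs
      have := (integrable_gaussian_norm (n := n) hs).const_mul
        (s ^ (a - 1) * Real.exp (-(1 * s)))
      refine this.congr (Eventually.of_forall fun y => ?_)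
      simp only [f]
      rw [mul_assoc, ← Real.exp_add]
      congr 2
      ring
    · have h0 : IntegrableOn (fun s : ℝ => Real.pi ^ ((n : ℝ) / 2) *
          (s ^ ((1 / 2 : ℝ) - 1) * Real.exp (-(1 * s)))) (Ioi 0) := by
        refine Integrable.const_mul ?_ _
        have := Real.GammaIntegral_convergent (s := 1 / 2) (by norm_num)
        refine this.congr (Eventually.of_forall fun s => ?_)
        simp [mul_comm]
      refine h0.congr ?_
      filter_upwards [hmem] with s hs
      rw [← poisson_fubini_integrand hs]
      refine integral_congr_ae (Eventually.of_forall fun y => ?_)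
      have hs' : (0 : ℝ) < s := hs
      simp only [f]
      rw [Real.norm_of_nonneg (by positivity)]
  have hswap := integral_integral_swap (f := fun y s => f (y, s)) hint
  have h1 : ∀ y : Euc n, ∫ s in Ioi (0 : ℝ), f (y, s) =
      Real.Gamma a * (1 + ‖y‖ ^ 2) ^ (-a) := by
    intro y
    have := Real.integral_rpow_mul_exp_neg_mul_Ioi ha0 (r := 1 + ‖y‖ ^ 2) (by positivity)
    simp only [f]
    rw [this, one_div, Real.inv_rpow (by positivity), ← Real.rpow_neg (by positivity), mul_comm]
  have h2 : ∫ s in Ioi (0 : ℝ), (∫ y : Euc n, f (y, s)) =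
      Real.pi ^ ((n : ℝ) / 2) * Real.pi ^ (1 / 2 : ℝ) := by
    rw [setIntegral_congr_fun measurableSet_Ioi (fun s hs => poisson_fubini_integrand hs),
      integral_const_mul, Real.integral_rpow_mul_exp_neg_mul_Ioi (by norm_num) one_pos]
    rw [Real.Gamma_one_half_eq, Real.sqrt_eq_rpow]
    simp
  simp_rw [h1] at hswap
  rw [integral_const_mul, h2, ← Real.rpow_add Real.pi_pos] at hswap
  rw [hswap]
  congr 1
  rw [ha]
  ring

lemma integral_poissonDensity (n : ℕ) : ∫ y : Euc n, poissonDensity y = 1 := by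
  simp_rw [poissonDensity_eq]
  rw [integral_const_mul, halfLapConst, div_mul_eq_mul_div, integral_one_add_norm_sq_rpow,
    div_self]
  positivity

lemma integrable_poissonDensity (n : ℕ) : Integrable (poissonDensity (n := n)) := by
  by_contra h
  have := integral_poissonDensity n
  rw [integral_undef h] at this
  norm_num at this

/-- The Lévy measure `|z|^{-(n+1)} dz` integrates `min(1, |z|²)`. -/
lemma integrable_min_one_sq_div {n : ℕ} (hn : 0 < n) :
    Integrable (fun z : Euc n => min 1 (‖z‖ ^ 2) / ‖z‖ ^ (n + 1)) := by
  have : Nonempty (Fin n) := ⟨⟨0, hn⟩⟩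
  have : Nontrivial (Euc n) := inferInstance
  have h := integrable_fun_norm_addHaar (E := Euc n) (F := ℝ) volume
    (f := fun r => min 1 (r ^ 2) / r ^ (n + 1))
  refine h.2 ?_
  rw [finrank_euclideanSpace_fin]
  -- In polar coordinates the density becomes `min(1, r²) r^{-2}`: equal to `1` on `(0, 1]` and to
  -- `r^{-2}` beyond.
  have key : ∀ y : ℝ, 0 < y → y ^ (n - 1) • (min 1 (y ^ 2) / y ^ (n + 1)) =
      min 1 (y ^ 2) * y ^ (-2 : ℝ) := by
    intro y hy
    obtain ⟨m, rfl⟩ : ∃ m, n = m + 1 := ⟨n - 1, by omega⟩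
    rw [Real.rpow_neg hy.le, smul_eq_mul]
    norm_num
    field_simp
    ring
  have : Ioi (0 : ℝ) = Ioc 0 1 ∪ Ioi 1 := by
    rw [Ioc_union_Ioi_eq_Ioi]; norm_num
  rw [integrableOn_congr_fun (fun y (hy : y ∈ Ioi (0 : ℝ)) => key y hy) measurableSet_Ioi, this]
  refine IntegrableOn.union ?_ ?_
  · have : IntegrableOn (fun _ : ℝ => (1 : ℝ)) (Ioc 0 1) := by
      simp
    refine this.congr_fun (fun y hy => ?_) measurableSet_Ioc
    have h1 : y ^ 2 ≤ 1 := by nlinarith [hy.1, hy.2]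
    have h0 : y ≠ 0 := hy.1.ne'
    simp only [min_eq_right h1]
    rw [Real.rpow_neg hy.1.le]
    norm_num
    field_simp
  · have := integrableOn_Ioi_rpow_of_lt (a := -2) (by norm_num) (c := 1) one_pos
    refine this.congr_fun (fun y hy => ?_) measurableSet_Ioi
    have hy1 : (1 : ℝ) < y := hy
    have h1 : 1 ≤ y ^ 2 := by nlinarith
    simp only [min_eq_left h1, one_mul]

/-! ### Homogeneity, decay, derivatives and harmonicity of the Poisson kernel. -/

section Kernel

variable {n : ℕ}

lemma prod_norm_sq_pos {q : Euc n × ℝ} (hq : q ≠ 0) : 0 < ‖q.1‖ ^ 2 + q.2 ^ 2 := by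
  by_contra h
  have h1 : ‖q.1‖ ^ 2 = 0 := by nlinarith [sq_nonneg ‖q.1‖, sq_nonneg q.2]
  have h2 : q.2 ^ 2 = 0 := by nlinarith [sq_nonneg ‖q.1‖, sq_nonneg q.2]
  apply hq
  ext1
  · simpa using h1
  · simpa using h2

lemma contDiffAt_rpow_prod_norm_sq {q : Euc n × ℝ} (hq : q ≠ 0) (a : ℝ) {k : ℕ∞} :
    ContDiffAt ℝ k (fun q : Euc n × ℝ => (‖q.1‖ ^ 2 + q.2 ^ 2) ^ a) q := by
  refine ContDiffAt.rpow_const_of_ne ?_ (prod_norm_sq_pos hq).ne'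
  exact (ContDiff.add (contDiff_fst.norm_sq ℝ) (contDiff_snd.pow 2)).contDiffAt

lemma contDiffAt_halfSpaceKernel {q : Euc n × ℝ} (hq : q ≠ 0) {k : ℕ∞} :
    ContDiffAt ℝ k (halfSpaceKernel (n := n)) q := by
  unfold halfSpaceKernel
  exact (contDiffAt_const.mul contDiffAt_snd).mul (contDiffAt_rpow_prod_norm_sq hq _)

/-- `G` is positively homogeneous of degree `-d` away from the origin. -/
def IsNegHomogeneous {V F : Type*} [NormedAddCommGroup V] [NormedSpace ℝ V]
    [NormedAddCommGroup F] [NormedSpace ℝ F] (d : ℕ) (G : V → F) : Prop :=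
  ∀ s : ℝ, 0 < s → ∀ q : V, q ≠ 0 → G (s • q) = (s ^ d)⁻¹ • G q

/-- Differentiating the scaling identity in `q` produces a factor `s` on the left, which raises the
order of decay by one. -/
lemma IsNegHomogeneous.fderiv {V F : Type*} [NormedAddCommGroup V] [NormedSpace ℝ V]
    [NormedAddCommGroup F] [NormedSpace ℝ F] {d : ℕ} {G : V → F}
    (hG : IsNegHomogeneous d G) (hd : ∀ q, q ≠ 0 → DifferentiableAt ℝ G q) :
    IsNegHomogeneous (d + 1) (fderiv ℝ G) := by
  intro s hs q hq
  have h1 : (fun p => G (s • p)) =ᶠ[𝓝 q] fun p => (s ^ d)⁻¹ • G p := by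
    filter_upwards [isOpen_ne.mem_nhds hq] with p hp using hG s hs p hp
  have h2 := h1.fderiv_eq (𝕜 := ℝ)
  rw [fderiv_comp_smul, fderiv_fun_const_smul (hd q hq)] at h2
  rw [pow_succ, mul_inv, mul_comm, mul_smul, ← h2, smul_smul, inv_mul_cancel₀ hs.ne', one_smul]

lemma IsNegHomogeneous.exists_bound {V F : Type*} [NormedAddCommGroup V] [NormedSpace ℝ V]
    [FiniteDimensional ℝ V]
    [NormedAddCommGroup F] [NormedSpace ℝ F] {d : ℕ} {G : V → F}
    (hG : IsNegHomogeneous d G) (hd : ∀ q, q ≠ 0 → ContinuousAt G q) :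
    ∃ C, 0 ≤ C ∧ ∀ q, q ≠ 0 → ‖G q‖ ≤ C * (‖q‖ ^ d)⁻¹ := by
  have hc : ContinuousOn G (sphere 0 1) := fun q hq =>
    (hd q (ne_of_mem_sphere hq one_ne_zero)).continuousWithinAt
  obtain ⟨C, hC⟩ := (isCompact_sphere (0 : V) 1).exists_bound_of_continuousOn hc
  refine ⟨max C 0, le_max_right _ _, fun q hq => ?_⟩
  have hq0 : 0 < ‖q‖ := norm_pos_iff.2 hq
  have h1 := hG ‖q‖ hq0 (‖q‖⁻¹ • q) (by simp [hq])
  rw [smul_smul, mul_inv_cancel₀ hq0.ne', one_smul] at h1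
  rw [h1, norm_smul, norm_inv, norm_pow, norm_norm, mul_comm]
  gcongr
  refine (hC _ ?_).trans (le_max_left _ _)
  simp [norm_smul, hq0.ne']

/-- Horizontal decay of order `n + 1`, locally uniform in the open half-space. -/
def PoissonDecay {F : Type*} [NormedAddCommGroup F] (G : Euc n × ℝ → F) : Prop :=
  ∀ q₀ : Euc n × ℝ, 0 < q₀.2 → ∃ ε > 0, ∃ C, ∀ q ∈ ball q₀ ε, 0 < q.2 ∧ ∀ y : Euc n,
    ‖G (q - (y, 0))‖ ≤ C * (1 + ‖y‖) ^ (-((n : ℝ) + 1))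

/-- At heights at least `q₀.2 / 2` the distance to every boundary point is bounded below, so it
controls `1 + |y|` uniformly near `q₀`. -/
lemma one_add_norm_le_mul_norm_sub {q₀ q : Euc n × ℝ} (h0 : 0 < q₀.2)
    (hq : q ∈ ball q₀ (q₀.2 / 2)) (y : Euc n) :
    1 + ‖y‖ ≤ (1 + (1 + ‖q₀‖ + q₀.2) / (q₀.2 / 2)) * ‖q - (y, 0)‖ := by
  rw [mem_ball, dist_eq_norm] at hq
  have h2 : |q.2 - q₀.2| < q₀.2 / 2 := (norm_snd_le (q - q₀)).trans_lt hq
  have h3 : q₀.2 / 2 ≤ ‖q - (y, 0)‖ := by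
    have : |q.2 - 0| ≤ ‖q - (y, 0)‖ := norm_snd_le (q - (y, 0))
    rw [abs_lt] at h2
    rw [sub_zero] at this
    linarith [le_abs_self q.2]
  have h4 : ‖q.1‖ ≤ ‖q₀‖ + q₀.2 := by
    have := norm_fst_le q
    have := norm_sub_norm_le q q₀
    linarith
  have h5 : ‖y‖ ≤ ‖q - (y, 0)‖ + ‖q.1‖ := by
    have h6 : ‖q.1 - y‖ ≤ ‖q - (y, 0)‖ := norm_fst_le (q - (y, 0))
    have h7 := norm_sub_norm_le y q.1
    rw [norm_sub_rev] at h7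
    linarith
  have h8 : 1 + ‖q₀‖ + q₀.2 ≤ (1 + ‖q₀‖ + q₀.2) / (q₀.2 / 2) * ‖q - (y, 0)‖ := by
    rw [div_mul_eq_mul_div, le_div_iff₀ (by positivity)]
    gcongr
  linarith

lemma snd_pos_of_mem_ball {q₀ q : Euc n × ℝ} (hq : q ∈ ball q₀ (q₀.2 / 2)) : 0 < q.2 := by
  rw [mem_ball, dist_eq_norm] at hq
  have h2 : |q.2 - q₀.2| < q₀.2 / 2 := (norm_snd_le (q - q₀)).trans_lt hq
  have := abs_nonneg (q.2 - q₀.2)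
  rw [abs_lt] at h2
  linarith

lemma IsNegHomogeneous.poissonDecay {F : Type*} [NormedAddCommGroup F] [NormedSpace ℝ F]
    {d : ℕ} {G : Euc n × ℝ → F} (hG : IsNegHomogeneous d G)
    (hc : ∀ q, q ≠ 0 → ContinuousAt G q) (hd : n + 1 ≤ d) : PoissonDecay G := by
  obtain ⟨C, hC0, hC⟩ := hG.exists_bound hc
  intro q₀ h0
  set A : ℝ := 1 + (1 + ‖q₀‖ + q₀.2) / (q₀.2 / 2)
  have hA : 0 < A := by positivity
  refine ⟨q₀.2 / 2, by positivity, C * A ^ d, fun q hq => ⟨snd_pos_of_mem_ball hq, fun y => ?_⟩⟩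
  have h1 := one_add_norm_le_mul_norm_sub h0 hq y
  have hy : 1 ≤ 1 + ‖y‖ := by linarith [norm_nonneg y]
  have hpos : 0 < ‖q - (y, 0)‖ := by
    by_contra h
    have : ‖q - (y, 0)‖ = 0 := le_antisymm (not_lt.1 h) (norm_nonneg _)
    rw [this] at h1
    linarith
  refine (hC _ (norm_pos_iff.1 hpos)).trans ?_
  rw [mul_assoc]
  gcongr
  have h2 : (1 + ‖y‖) ^ (-((n : ℝ) + 1)) = ((1 + ‖y‖) ^ (n + 1))⁻¹ := by
    rw [Real.rpow_neg (by positivity)]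
    norm_cast
  rw [h2, ← div_eq_mul_inv, inv_eq_one_div, div_le_div_iff₀ (by positivity) (by positivity),
    one_mul]
  calc (1 + ‖y‖) ^ (n + 1) ≤ (1 + ‖y‖) ^ d := pow_le_pow_right₀ hy hd
    _ ≤ (A * ‖q - (y, 0)‖) ^ d := by gcongr
    _ = _ := by rw [mul_pow]

lemma isNegHomogeneous_rpow_prod_norm_sq :
    IsNegHomogeneous (n + 1) (fun q : Euc n × ℝ =>
      (‖q.1‖ ^ 2 + q.2 ^ 2) ^ (-(((n : ℝ) + 1) / 2))) := by
  intro s hs q hq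
  have h1 : ‖(s • q).1‖ ^ 2 + (s • q).2 ^ 2 = s ^ 2 * (‖q.1‖ ^ 2 + q.2 ^ 2) := by
    simp [norm_smul, abs_of_pos hs]
    ring
  simp only [h1]
  rw [Real.mul_rpow (by positivity) (by positivity), smul_eq_mul]
  congr 1
  rw [← Real.rpow_natCast, ← Real.rpow_mul hs.le, ← Real.rpow_natCast, ← Real.rpow_neg hs.le]
  congr 1
  push_cast
  ring

lemma isNegHomogeneous_halfSpaceKernel : IsNegHomogeneous n (halfSpaceKernel (n := n)) := by
  intro s hs q hq
  have := isNegHomogeneous_rpow_prod_norm_sq s hs q hq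
  unfold halfSpaceKernel
  simp only [] at this
  rw [this]
  simp only [Prod.smul_snd, smul_eq_mul, pow_succ]
  field_simp

/-- The kernel has homogeneity degree only `-n`, one short of `IsNegHomogeneous.poissonDecay`. Its
height factor is locally bounded and the remaining power has degree `-(n+1)`. -/
lemma poissonDecay_halfSpaceKernel : PoissonDecay (halfSpaceKernel (n := n)) := by
  intro q₀ h0
  obtain ⟨ε, hε, C, hC⟩ := isNegHomogeneous_rpow_prod_norm_sq.poissonDecay (n := n)
    (fun q hq => (contDiffAt_rpow_prod_norm_sq hq _ (k := 0)).continuousAt) le_rfl q₀ h0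
  refine ⟨ε, hε, halfLapConst n * (q₀.2 + ε) * C, fun q hq => ⟨(hC q hq).1, fun y => ?_⟩⟩
  have h1 := (hC q hq).2 y
  have h2 : q.2 ≤ q₀.2 + ε := by
    rw [mem_ball, dist_eq_norm] at hq
    have := (norm_snd_le (q - q₀)).trans_lt hq
    rw [Prod.snd_sub, Real.norm_eq_abs, abs_lt] at this
    linarith
  have h3 := (hC q hq).1
  have h4 := halfLapConst_pos n
  unfold halfSpaceKernel
  rw [norm_mul, mul_assoc _ C]
  have h5 : ‖halfLapConst n * (q - (y, 0)).2‖ ≤ halfLapConst n * (q₀.2 + ε) := by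
    rw [Prod.snd_sub, sub_zero, Real.norm_of_nonneg (by positivity)]
    gcongr
  exact mul_le_mul h5 h1 (norm_nonneg _) (by positivity)

lemma differentiableAt_halfSpaceKernel {q : Euc n × ℝ} (hq : q ≠ 0) :
    DifferentiableAt ℝ (halfSpaceKernel (n := n)) q :=
  (contDiffAt_halfSpaceKernel hq (k := 1)).differentiableAt (by norm_num)

lemma contDiffAt_fderiv_halfSpaceKernel {q : Euc n × ℝ} (hq : q ≠ 0) {k : ℕ} :
    ContDiffAt ℝ k (fderiv ℝ (halfSpaceKernel (n := n))) q :=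
  (contDiffAt_halfSpaceKernel hq (k := ((k + 1 : ℕ) : ℕ∞))).fderiv_right (m := k) (by norm_cast)

lemma contDiffAt_fderiv_fderiv_halfSpaceKernel {q : Euc n × ℝ} (hq : q ≠ 0) {k : ℕ} :
    ContDiffAt ℝ k (fderiv ℝ (fderiv ℝ (halfSpaceKernel (n := n)))) q :=
  (contDiffAt_fderiv_halfSpaceKernel hq (k := k + 1)).fderiv_right (m := k) (by norm_cast)

lemma poissonDecay_fderiv_halfSpaceKernel :
    PoissonDecay (fderiv ℝ (halfSpaceKernel (n := n))) :=
  (isNegHomogeneous_halfSpaceKernel.fderiv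
    fun _ hq => differentiableAt_halfSpaceKernel hq).poissonDecay
    (fun _ hq => (contDiffAt_fderiv_halfSpaceKernel hq (k := 0)).continuousAt) le_rfl

lemma isNegHomogeneous_fderiv_fderiv_halfSpaceKernel :
    IsNegHomogeneous (n + 1 + 1) (fderiv ℝ (fderiv ℝ (halfSpaceKernel (n := n)))) :=
  (isNegHomogeneous_halfSpaceKernel.fderiv
    fun _ hq => differentiableAt_halfSpaceKernel hq).fderiv
    fun _ hq => (contDiffAt_fderiv_halfSpaceKernel hq (k := 1)).differentiableAt (by norm_num)

lemma poissonDecay_fderiv_fderiv_halfSpaceKernel :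
    PoissonDecay (fderiv ℝ (fderiv ℝ (halfSpaceKernel (n := n)))) :=
  isNegHomogeneous_fderiv_fderiv_halfSpaceKernel.poissonDecay
    (fun _ hq => (contDiffAt_fderiv_fderiv_halfSpaceKernel hq (k := 0)).continuousAt) (by omega)

lemma prod_norm_sq_add_smul (q v : Euc n × ℝ) (s : ℝ) :
    ‖(q + s • v).1‖ ^ 2 + (q + s • v).2 ^ 2 = (‖q.1‖ ^ 2 + q.2 ^ 2) +
      2 * s * (inner ℝ q.1 v.1 + q.2 * v.2) + s ^ 2 * (‖v.1‖ ^ 2 + v.2 ^ 2) := by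
  simp only [Prod.fst_add, Prod.smul_fst, Prod.snd_add, Prod.smul_snd, smul_eq_mul]
  rw [norm_add_sq_real, inner_smul_right, norm_smul, mul_pow, Real.norm_eq_abs, sq_abs]
  ring

/-- Along the line `q + s v`, the squared Euclidean norm is this quadratic with `N = |q|²`, `B = ⟨q,
v⟩`, `M = |v|²`; both derivative formulas for the kernel come from it. -/
lemma hasDerivAt_quadratic_rpow {N B M : ℝ} (hN : 0 < N) (a : ℝ) :
    HasDerivAt (fun s : ℝ => (N + 2 * s * B + s ^ 2 * M) ^ a) (2 * B * a * N ^ (a - 1)) 0 := by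
  have h1 : HasDerivAt (fun s : ℝ => N + 2 * s * B + s ^ 2 * M) (2 * B) 0 := by
    have h2 := (((hasDerivAt_id (0 : ℝ)).const_mul 2).mul_const B).const_add N
    have h3 := ((hasDerivAt_id (0 : ℝ)).pow 2).mul_const M
    have h4 := h2.add h3
    simp only [id] at h4
    convert! h4 using 1
    simp
  have h5 := h1.rpow_const (p := a) (Or.inl (by simpa using hN.ne'))
  simpa using h5

lemma fderiv_halfSpaceKernel_apply {q : Euc n × ℝ} (hq : q ≠ 0) (v : Euc n × ℝ) :
    fderiv ℝ (halfSpaceKernel (n := n)) q v = halfLapConst n *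
      (v.2 * (‖q.1‖ ^ 2 + q.2 ^ 2) ^ (-(((n : ℝ) + 1) / 2)) -
        ((n : ℝ) + 1) * q.2 * (inner ℝ q.1 v.1 + q.2 * v.2) *
          (‖q.1‖ ^ 2 + q.2 ^ 2) ^ (-(((n : ℝ) + 1) / 2) - 1)) := by
  have h1 : HasDerivAt (fun s : ℝ => halfSpaceKernel (q + s • v))
      (fderiv ℝ (halfSpaceKernel (n := n)) q v) 0 := by
    have h2 : HasDerivAt (fun s : ℝ => q + s • v) v 0 := by
      simpa using ((hasDerivAt_id (0 : ℝ)).smul_const v).const_add q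
    have h3 : HasFDerivAt (halfSpaceKernel (n := n)) (fderiv ℝ (halfSpaceKernel (n := n)) q)
      (q + (0 : ℝ) • v) := by
      simpa using (differentiableAt_halfSpaceKernel hq).hasFDerivAt
    exact h3.comp_hasDerivAt 0 h2
  refine h1.unique ?_
  have h4 := hasDerivAt_quadratic_rpow (N := ‖q.1‖ ^ 2 + q.2 ^ 2)
    (B := inner ℝ q.1 v.1 + q.2 * v.2) (M := ‖v.1‖ ^ 2 + v.2 ^ 2) (prod_norm_sq_pos hq)
    (-(((n : ℝ) + 1) / 2))
  have h5 : HasDerivAt (fun s : ℝ => halfLapConst n * (q.2 + s * v.2)) (halfLapConst n * v.2) 0 := by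
    simpa using (((hasDerivAt_id (0 : ℝ)).mul_const v.2).const_add q.2).const_mul (halfLapConst n)
  have h6 := h5.mul h4
  have h7 : (fun s : ℝ => halfSpaceKernel (q + s • v)) = fun s : ℝ =>
      halfLapConst n * (q.2 + s * v.2) * ((‖q.1‖ ^ 2 + q.2 ^ 2) +
      2 * s * (inner ℝ q.1 v.1 + q.2 * v.2) + s ^ 2 * (‖v.1‖ ^ 2 + v.2 ^ 2)) ^
        (-(((n : ℝ) + 1) / 2)) := by
    funext s
    rw [halfSpaceKernel, prod_norm_sq_add_smul]
    simp
  rw [h7]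
  convert! h6 using 1
  simp
  ring

lemma fderiv_fderiv_halfSpaceKernel_apply {q : Euc n × ℝ} (hq : q ≠ 0) (v : Euc n × ℝ) :
    fderiv ℝ (fderiv ℝ (halfSpaceKernel (n := n))) q v v = halfLapConst n *
      (-(((n : ℝ) + 1) * (2 * v.2 * (inner ℝ q.1 v.1 + q.2 * v.2) +
          q.2 * (‖v.1‖ ^ 2 + v.2 ^ 2)) *
          (‖q.1‖ ^ 2 + q.2 ^ 2) ^ (-(((n : ℝ) + 1) / 2) - 1)) +
        ((n : ℝ) + 1) * ((n : ℝ) + 3) * q.2 * (inner ℝ q.1 v.1 + q.2 * v.2) ^ 2 *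
          (‖q.1‖ ^ 2 + q.2 ^ 2) ^ (-(((n : ℝ) + 1) / 2) - 1 - 1)) := by
  have h2 : HasDerivAt (fun s : ℝ => q + s • v) v 0 := by
    simpa using ((hasDerivAt_id (0 : ℝ)).smul_const v).const_add q
  have h1 : HasDerivAt (fun s : ℝ => fderiv ℝ (halfSpaceKernel (n := n)) (q + s • v) v)
      (fderiv ℝ (fderiv ℝ (halfSpaceKernel (n := n))) q v v) 0 := by
    have h3 : HasFDerivAt (fderiv ℝ (halfSpaceKernel (n := n)))
      (fderiv ℝ (fderiv ℝ (halfSpaceKernel (n := n))) q) (q + (0 : ℝ) • v) := by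
      simpa using ((contDiffAt_fderiv_halfSpaceKernel hq (k := 1)).differentiableAt
        (by norm_num)).hasFDerivAt
    have h4 := h3.comp_hasDerivAt 0 h2
    exact h4.clm_apply (hasDerivAt_const (0 : ℝ) v) |>.congr_deriv (by simp)
  refine h1.unique ?_
  set N := ‖q.1‖ ^ 2 + q.2 ^ 2
  set B := inner ℝ q.1 v.1 + q.2 * v.2
  set M := ‖v.1‖ ^ 2 + v.2 ^ 2
  have h4 := hasDerivAt_quadratic_rpow (N := N) (B := B) (M := M) (prod_norm_sq_pos hq)
    (-(((n : ℝ) + 1) / 2))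
  have h4' := hasDerivAt_quadratic_rpow (N := N) (B := B) (M := M) (prod_norm_sq_pos hq)
    (-(((n : ℝ) + 1) / 2) - 1)
  have h5 : HasDerivAt (fun s : ℝ => ((n : ℝ) + 1) * (q.2 + s * v.2))
      (((n : ℝ) + 1) * v.2) 0 := by
    simpa using (((hasDerivAt_id (0 : ℝ)).mul_const v.2).const_add q.2).const_mul ((n : ℝ) + 1)
  have h6 : HasDerivAt (fun s : ℝ => B + s * M) M 0 := by
    simpa using ((hasDerivAt_id (0 : ℝ)).mul_const M).const_add B
  have h7 := ((h4.const_mul v.2).sub ((h5.mul h6).mul h4')).const_mul (halfLapConst n)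
  have h8 : (fun s : ℝ => fderiv ℝ (halfSpaceKernel (n := n)) (q + s • v) v) =ᶠ[𝓝 0] fun s : ℝ =>
      halfLapConst n * (v.2 * (N + 2 * s * B + s ^ 2 * M) ^ (-(((n : ℝ) + 1) / 2)) -
        ((n : ℝ) + 1) * (q.2 + s * v.2) * (B + s * M) *
          (N + 2 * s * B + s ^ 2 * M) ^ (-(((n : ℝ) + 1) / 2) - 1)) := by
    have hev : ∀ᶠ s in 𝓝 (0 : ℝ), q + s • v ≠ 0 := by
      refine h2.continuousAt.eventually_ne ?_
      simpa using hq
    filter_upwards [hev] with s hs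
    rw [fderiv_halfSpaceKernel_apply hs, prod_norm_sq_add_smul]
    congr 4
    · simp only [B, M, Prod.fst_add, Prod.smul_fst, Prod.snd_add, Prod.smul_snd, smul_eq_mul,
        inner_add_left, inner_smul_left, RCLike.conj_to_real, real_inner_self_eq_norm_sq]
      ring
  refine HasDerivAt.congr_of_eventuallyEq ?_ h8
  convert! h7 using 1
  simp
  left
  ring

/-- The Poisson kernel is harmonic. -/
lemma halfSpaceKernel_harmonic {q : Euc n × ℝ} (hq : q ≠ 0) :
    ∑ i, fderiv ℝ (fderiv ℝ (halfSpaceKernel (n := n))) q (EuclideanSpace.basisFun (Fin n) ℝ i, 0)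
      (EuclideanSpace.basisFun (Fin n) ℝ i, 0) +
      fderiv ℝ (fderiv ℝ (halfSpaceKernel (n := n))) q (0, 1) (0, 1) = 0 := by
  have hN := prod_norm_sq_pos hq
  simp_rw [fderiv_fderiv_halfSpaceKernel_apply hq]
  -- Summing over directions leaves `-(n+1)(n+3) t` times this power plus `(n+1)(n+3) t (|x|²+t²)`
  -- times the next one; the identity makes them cancel.
  have h0 : (‖q.1‖ ^ 2 + q.2 ^ 2) ^ (-(((n : ℝ) + 1) / 2) - 1) =
      (‖q.1‖ ^ 2 + q.2 ^ 2) * (‖q.1‖ ^ 2 + q.2 ^ 2) ^ (-(((n : ℝ) + 1) / 2) - 1 - 1) := by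
    rw [Real.rpow_sub_one hN.ne' (-(((n : ℝ) + 1) / 2) - 1)]
    field_simp
  have h1 : ∑ i, (inner ℝ q.1 (EuclideanSpace.basisFun (Fin n) ℝ i)) ^ 2 = ‖q.1‖ ^ 2 := by
    rw [EuclideanSpace.norm_sq_eq]
    simp [EuclideanSpace.inner_single_right]
  rw [← Finset.mul_sum, Finset.sum_add_distrib]
  simp only [mul_zero, add_zero, zero_mul, OrthonormalBasis.norm_eq_one]
  rw [← Finset.sum_mul, ← Finset.mul_sum, h1, h0]
  simp
  ring

/-- Oblique derivatives of the Poisson kernel are bounded below near the boundary, away from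
the pole. -/
lemma exists_le_fderiv_halfSpaceKernel (b : Euc n) {d R : ℝ} (hd : 0 < d) (hR : 0 < R) :
    ∃ t₀ > 0, ∀ t : ℝ, 0 < t → t < t₀ → ∀ z : Euc n, d ≤ ‖z‖ → ‖z‖ ≤ R →
      halfLapConst n / 2 * (R ^ 2 + 1) ^ (-(((n : ℝ) + 1) / 2)) ≤
        fderiv ℝ (halfSpaceKernel (n := n)) (z, t) (b, 1) := by
  have hK : 0 < ((n : ℝ) + 1) * (R * ‖b‖ + 1) := by positivity
  -- The threshold makes `(n+1) t (⟨z, b⟩ + t)` at most half of `|z|² + t²`, so the second term of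
  -- the derivative costs at most half of the first.
  refine ⟨min 1 (d ^ 2 / 2 / (((n : ℝ) + 1) * (R * ‖b‖ + 1))), by positivity, ?_⟩
  intro t ht ht0 z hz hzR
  have ht1 : t < 1 := ht0.trans_le (min_le_left _ _)
  have ht2 := ht0.trans_le (min_le_right _ _)
  rw [lt_div_iff₀ hK] at ht2
  have hq : ((z, t) : Euc n × ℝ) ≠ 0 := by
    intro h
    exact ht.ne' (congrArg Prod.snd h)
  rw [fderiv_halfSpaceKernel_apply hq, div_mul_eq_mul_div, mul_div_assoc]
  have hN := prod_norm_sq_pos hq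
  simp only at hN ⊢
  refine mul_le_mul_of_nonneg_left ?_ (halfLapConst_pos n).le
  rw [Real.rpow_sub_one hN.ne']
  have hz2 : d ^ 2 ≤ ‖z‖ ^ 2 := by gcongr
  have hinner : inner ℝ z b ≤ R * ‖b‖ :=
    (real_inner_le_norm z b).trans (by gcongr)
  have h1 : ((n : ℝ) + 1) * t * (inner ℝ z b + t * 1) ≤ (‖z‖ ^ 2 + t ^ 2) / 2 := by
    have h2 : ((n : ℝ) + 1) * t * (inner ℝ z b + t * 1) ≤
        ((n : ℝ) + 1) * t * (R * ‖b‖ + 1) := by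
      gcongr
      linarith
    nlinarith [sq_nonneg t]
  have h3 : (R ^ 2 + 1) ^ (-(((n : ℝ) + 1) / 2)) ≤
      (‖z‖ ^ 2 + t ^ 2) ^ (-(((n : ℝ) + 1) / 2)) := by
    refine Real.rpow_le_rpow_of_nonpos hN ?_ ?_
    · have : ‖z‖ ^ 2 ≤ R ^ 2 := by gcongr
      nlinarith
    · have : 0 ≤ ((n : ℝ) + 1) / 2 := by positivity
      linarith
  set Q := (‖z‖ ^ 2 + t ^ 2) ^ (-(((n : ℝ) + 1) / 2))
  have hQ : 0 < Q := by positivity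
  have h4 : ((n : ℝ) + 1) * t * (inner ℝ z b + t * 1) * (Q / (‖z‖ ^ 2 + t ^ 2)) ≤ Q / 2 := by
    calc _ ≤ (‖z‖ ^ 2 + t ^ 2) / 2 * (Q / (‖z‖ ^ 2 + t ^ 2)) := by gcongr
      _ = Q / 2 := by field_simp
  linarith

end Kernel

/-! ### The Poisson extension: continuity, decay, smoothness, harmonicity. -/

/-- Harmonic extension to the half-space, in the form that is continuous up to the boundary. -/
noncomputable def poissonExt {n : ℕ} (f : Euc n → ℝ) (q : Euc n × ℝ) : ℝ :=
  ∫ y : Euc n, poissonDensity y * f (q.1 - q.2 • y)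

/-- Integral of a kernel on the half-space against a function on its boundary. -/
noncomputable def kernelInt {n : ℕ} {F : Type*} [NormedAddCommGroup F] [NormedSpace ℝ F]
    (G : Euc n × ℝ → F) (f : Euc n → ℝ) (q : Euc n × ℝ) : F :=
  ∫ y : Euc n, f y • G (q - (y, 0))

section Extension

variable {n : ℕ} {f g : Euc n → ℝ} {M : ℝ}

lemma integrable_poissonDensity_mul (hf : Continuous f) (hM : ∀ x, |f x| ≤ M) (q : Euc n × ℝ) :
    Integrable (fun y : Euc n => poissonDensity y * f (q.1 - q.2 • y)) := by
  refine ((integrable_poissonDensity n).mul_const M).mono' ?_ (Eventually.of_forall fun y => ?_)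
  · exact (continuous_poissonDensity.mul (hf.comp (by fun_prop))).aestronglyMeasurable
  · rw [norm_mul, Real.norm_of_nonneg (poissonDensity_pos y).le]
    exact mul_le_mul_of_nonneg_left (hM _) (poissonDensity_pos y).le

lemma continuous_poissonExt (hf : Continuous f) (hM : ∀ x, |f x| ≤ M) :
    Continuous (poissonExt f) := by
  refine continuous_of_dominated (bound := fun y => poissonDensity y * M)
    (fun q => (integrable_poissonDensity_mul hf hM q).aestronglyMeasurable)
    (fun q => Eventually.of_forall fun y => ?_) ((integrable_poissonDensity n).mul_const M)
    (Eventually.of_forall fun y => ?_)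
  · rw [norm_mul, Real.norm_of_nonneg (poissonDensity_pos y).le]
    exact mul_le_mul_of_nonneg_left (hM _) (poissonDensity_pos y).le
  · exact continuous_const.mul (hf.comp (by fun_prop))

lemma poissonExt_zero_right (f : Euc n → ℝ) (x : Euc n) : poissonExt f (x, 0) = f x := by
  simp [poissonExt, integral_mul_const, integral_poissonDensity]

lemma poissonExt_mono (hf : Continuous f) (hM : ∀ x, |f x| ≤ M) {M' : ℝ} (hg : Continuous g)
    (hM' : ∀ x, |g x| ≤ M') (hfg : ∀ x, f x ≤ g x) (q : Euc n × ℝ) :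
    poissonExt f q ≤ poissonExt g q :=
  integral_mono (integrable_poissonDensity_mul hf hM q) (integrable_poissonDensity_mul hg hM' q)
    fun y => mul_le_mul_of_nonneg_left (hfg _) (poissonDensity_pos y).le

lemma abs_poissonExt_le (hf : Continuous f) (hM : ∀ x, |f x| ≤ M) (q : Euc n × ℝ) :
    |poissonExt f q| ≤ M := by
  have hM' : 0 ≤ M := (abs_nonneg _).trans (hM 0)
  have h1 : ∀ c : ℝ, poissonExt (fun _ : Euc n => c) q = c := fun c => by
    simp [poissonExt, integral_mul_const, integral_poissonDensity]
  rw [abs_le]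
  constructor
  · rw [← h1 (-M)]
    exact poissonExt_mono continuous_const (fun _ => le_rfl) hf hM
      (fun x => neg_le_of_abs_le (hM x)) q
  · rw [← h1 M]
    exact poissonExt_mono hf hM continuous_const (fun _ => le_rfl)
      (fun x => le_of_abs_le (hM x)) q

lemma poissonExt_sub (hf : Continuous f) (hM : ∀ x, |f x| ≤ M) {M' : ℝ} (hg : Continuous g)
    (hM' : ∀ x, |g x| ≤ M') (q : Euc n × ℝ) :
    poissonExt (fun x => f x - g x) q = poissonExt f q - poissonExt g q := by
  unfold poissonExt
  rw [← integral_sub (integrable_poissonDensity_mul hf hM q)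
    (integrable_poissonDensity_mul hg hM' q)]
  simp_rw [mul_sub]

lemma poissonExt_const_mul (c : ℝ) (q : Euc n × ℝ) :
    poissonExt (fun x => c * f x) q = c * poissonExt f q := by
  unfold poissonExt
  rw [← integral_const_mul]
  congr 1
  funext y
  ring

lemma poissonExt_comp_sub (a : Euc n) (q : Euc n × ℝ) :
    poissonExt (fun x => f (x - a)) q = poissonExt f (q.1 - a, q.2) := by
  unfold poissonExt
  congr 1
  funext y
  simp only
  rw [sub_right_comm]

/-- Symmetrised form of the extension. -/
lemma poissonExt_eq_symm (hf : Continuous f) (hM : ∀ x, |f x| ≤ M) (q : Euc n × ℝ) :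
    poissonExt f q =
      ∫ y : Euc n, poissonDensity y * ((f (q.1 + q.2 • y) + f (q.1 - q.2 • y)) / 2) := by
  have h1 := integrable_poissonDensity_mul hf hM q
  have h2 := h1.comp_neg
  have h3 : ∫ y : Euc n, poissonDensity (-y) * f (q.1 - q.2 • (-y)) = poissonExt f q :=
    integral_neg_eq_self (fun y => poissonDensity y * f (q.1 - q.2 • y)) volume
  have h4 : poissonExt f q = (1 / 2) * (poissonExt f q + poissonExt f q) := by ring
  rw [h4]
  nth_rewrite 1 [← h3]
  unfold poissonExt
  rw [← integral_add h2 h1, ← integral_const_mul]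
  congr 1
  funext y
  rw [poissonDensity_neg, smul_neg, sub_neg_eq_add]
  ring

lemma exists_bound_of_tendsto_cocompact (hf : Continuous f)
    (h0 : Tendsto f (cocompact (Euc n)) (𝓝 0)) : ∃ M, ∀ x, |f x| ≤ M := by
  have h1 : ∀ᶠ x in cocompact (Euc n), |f x| < 1 := by
    have := h0.abs
    rw [abs_zero] at this
    exact this.eventually_lt_const one_pos
  obtain ⟨K, hK, hK'⟩ := mem_cocompact.1 h1
  obtain ⟨C, hC⟩ := hK.exists_bound_of_continuousOn hf.continuousOn
  refine ⟨max C 1, fun x => ?_⟩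
  by_cases hx : x ∈ K
  · exact (hC x hx).trans (le_max_left _ _)
  · exact (hK' hx).le.trans (le_max_right _ _)

/-- Extensions of functions vanishing at infinity vanish at infinity in slabs. -/
lemma poissonExt_slab_decay (hf : Continuous f) (h0 : Tendsto f (cocompact (Euc n)) (𝓝 0))
    (S : ℝ) {ε : ℝ} (hε : 0 < ε) :
    ∃ R, ∀ x : Euc n, R ≤ ‖x‖ → ∀ s ∈ Icc 0 S, |poissonExt f (x, s)| ≤ ε := by
  obtain ⟨M, hM⟩ := exists_bound_of_tendsto_cocompact hf h0
  -- Horizontal position going to infinity with the height confined to `[0, S]`.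
  let l : Filter (Euc n × ℝ) := comap (fun q => ‖q.1‖) atTop ⊓ 𝓟 {q | q.2 ∈ Icc 0 S}
  have key : Tendsto (poissonExt f) l (𝓝 (∫ y : Euc n, (0 : ℝ))) := by
    refine tendsto_integral_filter_of_dominated_convergence (fun y => poissonDensity y * M)
      (Eventually.of_forall fun q => (integrable_poissonDensity_mul hf hM q).aestronglyMeasurable)
      (Eventually.of_forall fun q => Eventually.of_forall fun y => ?_)
      ((integrable_poissonDensity n).mul_const M) (Eventually.of_forall fun y => ?_)
    · rw [norm_mul, Real.norm_of_nonneg (poissonDensity_pos y).le]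
      exact mul_le_mul_of_nonneg_left (hM _) (poissonDensity_pos y).le
    · have h1 : Tendsto (fun q : Euc n × ℝ => q.1 - q.2 • y) l (cocompact (Euc n)) := by
        rw [← cobounded_eq_cocompact, ← comap_norm_atTop, tendsto_comap_iff]
        have h2 : Tendsto (fun q : Euc n × ℝ => ‖q.1‖ - S * ‖y‖) l atTop :=
          tendsto_atTop_add_const_right _ _ (tendsto_comap.mono_left inf_le_left)
        refine tendsto_atTop_mono' _ ?_ h2
        have h3 : ∀ᶠ q in l, q.2 ∈ Icc 0 S := mem_inf_of_right (mem_principal_self _)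
        filter_upwards [h3] with q hq
        have h4 : ‖q.2 • y‖ ≤ S * ‖y‖ := by
          rw [norm_smul, Real.norm_of_nonneg hq.1]
          exact mul_le_mul_of_nonneg_right hq.2 (norm_nonneg _)
        have h5 := norm_sub_norm_le q.1 (q.2 • y)
        simp only [Function.comp]
        linarith
      simpa using (h0.comp h1).const_mul (poissonDensity y)
  rw [integral_zero] at key
  have h1 : ∀ᶠ q in l, |poissonExt f q| < ε := by
    have := key.abs
    rw [abs_zero] at this
    exact this.eventually_lt_const hε
  rw [eventually_inf_principal] at h1
  obtain ⟨t, ht, hsub⟩ := mem_comap.1 h1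
  obtain ⟨R, hR⟩ := mem_atTop_sets.1 ht
  exact ⟨R, fun x hx s hs => (hsub (a := (x, s)) (hR _ hx) hs).le⟩

/-- Along any direction that goes up, extensions of functions vanishing at infinity vanish. -/
lemma tendsto_poissonExt_atTop (hn : 0 < n) (hf : Continuous f)
    (h0 : Tendsto f (cocompact (Euc n)) (𝓝 0)) (x b : Euc n) :
    Tendsto (fun s : ℝ => poissonExt f (x - s • b, s)) atTop (𝓝 0) := by
  have : Nonempty (Fin n) := ⟨⟨0, hn⟩⟩
  obtain ⟨M, hM⟩ := exists_bound_of_tendsto_cocompact hf h0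
  have key : Tendsto (fun s : ℝ => poissonExt f (x - s • b, s)) atTop
      (𝓝 (∫ y : Euc n, (0 : ℝ))) := by
    refine tendsto_integral_filter_of_dominated_convergence (fun y => poissonDensity y * M)
      (Eventually.of_forall fun s => (integrable_poissonDensity_mul hf hM _).aestronglyMeasurable)
      (Eventually.of_forall fun q => Eventually.of_forall fun y => ?_)
      ((integrable_poissonDensity n).mul_const M) ?_
    · rw [norm_mul, Real.norm_of_nonneg (poissonDensity_pos y).le]
      exact mul_le_mul_of_nonneg_left (hM _) (poissonDensity_pos y).le
    · have hae : ∀ᵐ y : Euc n, y ≠ -b := by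
        rw [ae_iff]
        simp
      filter_upwards [hae] with y hy
      have h1 : Tendsto (fun s : ℝ => x - s • b - s • y) atTop (cocompact (Euc n)) := by
        rw [← cobounded_eq_cocompact, ← comap_norm_atTop, tendsto_comap_iff]
        have hpos : 0 < ‖b + y‖ := norm_pos_iff.2 fun h => hy (eq_neg_of_add_eq_zero_right h)
        have h2 : Tendsto (fun s : ℝ => s * ‖b + y‖ - ‖x‖) atTop atTop :=
          tendsto_atTop_add_const_right _ _ (tendsto_id.atTop_mul_const hpos)
        refine tendsto_atTop_mono' _ ?_ h2
        filter_upwards [eventually_ge_atTop 0] with s hs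
        have h4 : ‖s • (b + y)‖ = s * ‖b + y‖ := by
          rw [norm_smul, Real.norm_of_nonneg hs]
        have h5 := norm_sub_norm_le (s • (b + y)) x
        rw [norm_sub_rev, h4, smul_add, ← sub_sub] at h5
        exact h5
      simpa using (h0.comp h1).const_mul (poissonDensity y)
  simpa using key

lemma halfSpaceKernel_eq_scale {t : ℝ} (ht : 0 < t) (z : Euc n) :
    halfSpaceKernel (z, t) = (t ^ n)⁻¹ * poissonDensity (t⁻¹ • z) := by
  have := isNegHomogeneous_halfSpaceKernel t ht (t⁻¹ • z, 1)
    (fun h => one_ne_zero (congrArg Prod.snd h))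
  rw [Prod.smul_mk, smul_smul, mul_inv_cancel₀ ht.ne', one_smul] at this
  simpa only [mul_one, smul_eq_mul, poissonDensity] using this

lemma integral_comp_smul_poissonDensity {t : ℝ} (ht : 0 < t) (h : Euc n → ℝ) :
    ∫ y : Euc n, poissonDensity y * h (t • y) = ∫ z : Euc n, halfSpaceKernel (z, t) * h z := by
  have h1 := Measure.integral_comp_smul (volume : Measure (Euc n))
    (fun w => poissonDensity (t⁻¹ • w) * h w) t
  simp only [smul_smul, inv_mul_cancel₀ ht.ne', one_smul] at h1
  rw [h1, finrank_euclideanSpace_fin, abs_of_pos (by positivity), smul_eq_mul,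
    ← integral_const_mul]
  congr 1
  funext z
  rw [halfSpaceKernel_eq_scale ht]
  ring

/-- Links the two representations: the fixed density gives continuity up to `t = 0`, while the
kernel form can be differentiated under the integral for `t > 0`. -/
lemma poissonExt_eq_kernelInt {q : Euc n × ℝ} (hq : 0 < q.2) :
    poissonExt f q = kernelInt halfSpaceKernel f q := by
  unfold poissonExt
  rw [integral_comp_smul_poissonDensity hq (fun z => f (q.1 - z)), kernelInt,
    ← integral_sub_left_eq_self _ volume q.1]
  congr 1
  funext y
  rw [smul_eq_mul, mul_comm]
  rw [show (q.1 - y, q.2) = q - (y, 0) from Prod.ext rfl (sub_zero _).symm,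
    sub_sub_cancel]

lemma integrable_rpow_one_add_norm (n : ℕ) :
    Integrable (fun y : Euc n => (1 + ‖y‖) ^ (-((n : ℝ) + 1))) := by
  refine integrable_one_add_norm ?_
  simp

variable {F : Type*} [NormedAddCommGroup F] {G : Euc n × ℝ → F}

lemma continuous_kernel_sub (hG : ∀ q, q ≠ 0 → ContinuousAt G q) {q : Euc n × ℝ} (hq : 0 < q.2) :
    Continuous (fun y : Euc n => G (q - (y, 0))) := by
  rw [continuous_iff_continuousAt]
  intro y
  have h1 : q - (y, 0) ≠ 0 := fun h => hq.ne' (by simpa using congrArg Prod.snd h)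
  exact ContinuousAt.comp (f := fun y : Euc n => q - (y, (0 : ℝ))) (hG _ h1) (by fun_prop)

variable [NormedSpace ℝ F]

lemma norm_smul_kernel_le (hM : ∀ x, |f x| ≤ M) {C : ℝ} {y : Euc n} {q : Euc n × ℝ}
    (h : ‖G (q - (y, 0))‖ ≤ C * (1 + ‖y‖) ^ (-((n : ℝ) + 1))) :
    ‖f y • G (q - (y, 0))‖ ≤ M * (C * (1 + ‖y‖) ^ (-((n : ℝ) + 1))) := by
  rw [norm_smul]
  exact mul_le_mul (hM y) h (norm_nonneg _) ((abs_nonneg _).trans (hM y))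

lemma integrable_kernel (hdec : PoissonDecay G) (hG : ∀ q, q ≠ 0 → ContinuousAt G q)
    (hf : Continuous f) (hM : ∀ x, |f x| ≤ M) {q : Euc n × ℝ} (hq : 0 < q.2) :
    Integrable (fun y : Euc n => f y • G (q - (y, 0))) := by
  obtain ⟨ε, hε, C, hC⟩ := hdec q hq
  refine (((integrable_rpow_one_add_norm n).const_mul C).const_mul M).mono'
    (hf.smul (continuous_kernel_sub hG hq)).aestronglyMeasurable (Eventually.of_forall fun y => ?_)
  exact norm_smul_kernel_le hM ((hC q (mem_ball_self hε)).2 y)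

lemma continuousAt_kernelInt (hdec : PoissonDecay G) (hG : ∀ q, q ≠ 0 → ContinuousAt G q)
    (hf : Continuous f) (hM : ∀ x, |f x| ≤ M) {q : Euc n × ℝ} (hq : 0 < q.2) :
    ContinuousAt (kernelInt G f) q := by
  obtain ⟨ε, hε, C, hC⟩ := hdec q hq
  refine continuousAt_of_dominated (bound := fun y => M * (C * (1 + ‖y‖) ^ (-((n : ℝ) + 1))))
    ?_ ?_ (((integrable_rpow_one_add_norm n).const_mul C).const_mul M)
    (Eventually.of_forall fun y => ?_)
  · filter_upwards [ball_mem_nhds q hε] with p hp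
    exact (hf.smul (continuous_kernel_sub hG (hC p hp).1)).aestronglyMeasurable
  · filter_upwards [ball_mem_nhds q hε] with p hp
    exact Eventually.of_forall fun y => norm_smul_kernel_le hM ((hC p hp).2 y)
  · have h1 : q - (y, 0) ≠ 0 := fun h => hq.ne' (by simpa using congrArg Prod.snd h)
    exact continuousAt_const.smul
      (ContinuousAt.comp (f := fun p : Euc n × ℝ => p - (y, (0 : ℝ))) (hG _ h1) (by fun_prop))

/-- `PoissonDecay` of the derivative supplies one integrable majorant on a whole neighbourhood of
`q`. Applied to the kernel and then to its derivative, this yields two derivatives of the extension.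
-/
lemma hasFDerivAt_kernelInt (hdec : PoissonDecay G) (hdec' : PoissonDecay (fderiv ℝ G))
    (hG : ∀ q, q ≠ 0 → DifferentiableAt ℝ G q)
    (hG' : ∀ q, q ≠ 0 → ContinuousAt (fderiv ℝ G) q)
    (hf : Continuous f) (hM : ∀ x, |f x| ≤ M) {q : Euc n × ℝ} (hq : 0 < q.2) :
    HasFDerivAt (kernelInt G f) (kernelInt (fderiv ℝ G) f q) q := by
  obtain ⟨ε, hε, C, hC⟩ := hdec' q hq
  refine hasFDerivAt_integral_of_dominated_of_fderiv_le (ball_mem_nhds q hε)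
    (F := fun p y => f y • G (p - (y, 0))) (F' := fun p y => f y • fderiv ℝ G (p - (y, 0)))
    (bound := fun y => M * (C * (1 + ‖y‖) ^ (-((n : ℝ) + 1)))) ?_
    (integrable_kernel hdec (fun p hp => (hG p hp).continuousAt) hf hM hq)
    (hf.smul (continuous_kernel_sub hG' hq)).aestronglyMeasurable
    (Eventually.of_forall fun y p hp => norm_smul_kernel_le hM ((hC p hp).2 y))
    (((integrable_rpow_one_add_norm n).const_mul C).const_mul M)
    (Eventually.of_forall fun y p hp => ?_)
  · filter_upwards [ball_mem_nhds q hε] with p hp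
    exact (hf.smul (continuous_kernel_sub (fun p hp => (hG p hp).continuousAt)
      (hC p hp).1)).aestronglyMeasurable
  · have h1 : p - (y, 0) ≠ 0 := fun h => (hC p hp).1.ne' (by simpa using congrArg Prod.snd h)
    have h2 : HasFDerivAt (fun p : Euc n × ℝ => p - (y, (0 : ℝ)))
        (ContinuousLinearMap.id ℝ (Euc n × ℝ)) p := (hasFDerivAt_id p).sub_const _
    have h3 := (hG _ h1).hasFDerivAt.comp p h2
    rw [ContinuousLinearMap.comp_id] at h3
    exact h3.const_smul (f y)

lemma eventually_snd_pos {q : Euc n × ℝ} (hq : 0 < q.2) : ∀ᶠ p in 𝓝 q, 0 < p.2 :=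
  (isOpen_lt continuous_const continuous_snd).mem_nhds hq

lemma hasFDerivAt_poissonExt (hf : Continuous f) (hM : ∀ x, |f x| ≤ M) {q : Euc n × ℝ}
    (hq : 0 < q.2) :
    HasFDerivAt (poissonExt f) (kernelInt (fderiv ℝ halfSpaceKernel) f q) q := by
  refine (hasFDerivAt_kernelInt poissonDecay_halfSpaceKernel poissonDecay_fderiv_halfSpaceKernel
    (fun p hp => differentiableAt_halfSpaceKernel hp)
    (fun p hp => (contDiffAt_fderiv_halfSpaceKernel hp (k := 0)).continuousAt)
    hf hM hq).congr_of_eventuallyEq ?_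
  filter_upwards [eventually_snd_pos hq] with p hp using poissonExt_eq_kernelInt hp

lemma hasFDerivAt_fderiv_poissonExt (hf : Continuous f) (hM : ∀ x, |f x| ≤ M) {q : Euc n × ℝ}
    (hq : 0 < q.2) :
    HasFDerivAt (fderiv ℝ (poissonExt f))
      (kernelInt (fderiv ℝ (fderiv ℝ halfSpaceKernel)) f q) q := by
  refine (hasFDerivAt_kernelInt poissonDecay_fderiv_halfSpaceKernel
    poissonDecay_fderiv_fderiv_halfSpaceKernel
    (fun p hp => (contDiffAt_fderiv_halfSpaceKernel hp (k := 1)).differentiableAt (by norm_num))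
    (fun p hp => (contDiffAt_fderiv_fderiv_halfSpaceKernel hp (k := 0)).continuousAt)
    hf hM hq).congr_of_eventuallyEq ?_
  filter_upwards [eventually_snd_pos hq] with p hp using (hasFDerivAt_poissonExt hf hM hp).fderiv

lemma contDiffAt_poissonExt (hf : Continuous f) (hM : ∀ x, |f x| ≤ M) {q : Euc n × ℝ}
    (hq : 0 < q.2) : ContDiffAt ℝ 2 (poissonExt f) q := by
  have hopen : IsOpen {p : Euc n × ℝ | 0 < p.2} := isOpen_lt continuous_const continuous_snd
  have h0 : ∀ {F : Type _} [NormedAddCommGroup F] [NormedSpace ℝ F] (g : Euc n × ℝ → F),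
      DifferentiableOn ℝ g {p | 0 < p.2} → ContinuousOn (fderiv ℝ g) {p | 0 < p.2} →
      ContDiffOn ℝ 1 g {p | 0 < p.2} := by
    intro F _ _ g h1 h2
    rw [← zero_add (1 : WithTop ℕ∞), contDiffOn_succ_iff_fderiv_of_isOpen hopen]
    exact ⟨h1, by simp, contDiffOn_zero.2 h2⟩
  have h1 : ContDiffOn ℝ 1 (fderiv ℝ (poissonExt f)) {p | 0 < p.2} := by
    refine h0 _ (fun p hp =>
      (hasFDerivAt_fderiv_poissonExt hf hM hp).differentiableAt.differentiableWithinAt)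
      (fun p hp => ContinuousAt.continuousWithinAt ?_)
    refine (continuousAt_kernelInt poissonDecay_fderiv_fderiv_halfSpaceKernel
      (fun p hp => (contDiffAt_fderiv_fderiv_halfSpaceKernel hp (k := 0)).continuousAt)
      hf hM hp).congr ?_
    filter_upwards [eventually_snd_pos hp] with p' hp'
    exact (hasFDerivAt_fderiv_poissonExt hf hM hp').fderiv.symm
  have h2 : ContDiffOn ℝ 2 (poissonExt f) {p | 0 < p.2} := by
    rw [show (2 : WithTop ℕ∞) = 1 + 1 from one_add_one_eq_two.symm,
      contDiffOn_succ_iff_fderiv_of_isOpen hopen]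
    exact ⟨fun p hp => (hasFDerivAt_poissonExt hf hM hp).differentiableAt.differentiableWithinAt,
      by simp, h1⟩
  exact h2.contDiffAt (hopen.mem_nhds hq)

lemma fderiv_poissonExt_apply (hf : Continuous f) (hM : ∀ x, |f x| ≤ M) {q : Euc n × ℝ}
    (hq : 0 < q.2) (v : Euc n × ℝ) :
    fderiv ℝ (poissonExt f) q v =
      ∫ y : Euc n, f y * fderiv ℝ (halfSpaceKernel (n := n)) (q - (y, 0)) v := by
  rw [(hasFDerivAt_poissonExt hf hM hq).fderiv, kernelInt, ContinuousLinearMap.integral_apply]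
  · rfl
  · exact integrable_kernel poissonDecay_fderiv_halfSpaceKernel
      (fun p hp => (contDiffAt_fderiv_halfSpaceKernel hp (k := 0)).continuousAt) hf hM hq

lemma integrable_fderiv_fderiv_kernel_apply (hf : Continuous f) (hM : ∀ x, |f x| ≤ M)
    {q : Euc n × ℝ} (hq : 0 < q.2) (v : Euc n × ℝ) :
    Integrable (fun y : Euc n =>
      f y * fderiv ℝ (fderiv ℝ (halfSpaceKernel (n := n))) (q - (y, 0)) v v) := by
  have h1 := integrable_kernel poissonDecay_fderiv_fderiv_halfSpaceKernel
      (fun p hp => (contDiffAt_fderiv_fderiv_halfSpaceKernel hp (k := 0)).continuousAt) hf hM hq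
  exact (h1.apply_continuousLinearMap v).apply_continuousLinearMap v

lemma fderiv_fderiv_poissonExt_apply (hf : Continuous f) (hM : ∀ x, |f x| ≤ M) {q : Euc n × ℝ}
    (hq : 0 < q.2) (v : Euc n × ℝ) :
    fderiv ℝ (fderiv ℝ (poissonExt f)) q v v =
      ∫ y : Euc n, f y * fderiv ℝ (fderiv ℝ (halfSpaceKernel (n := n))) (q - (y, 0)) v v := by
  have h1 := integrable_kernel poissonDecay_fderiv_fderiv_halfSpaceKernel
      (fun p hp => (contDiffAt_fderiv_fderiv_halfSpaceKernel hp (k := 0)).continuousAt) hf hM hq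
  rw [(hasFDerivAt_fderiv_poissonExt hf hM hq).fderiv, kernelInt,
    ContinuousLinearMap.integral_apply h1,
    ContinuousLinearMap.integral_apply (h1.apply_continuousLinearMap v)]
  rfl

lemma poissonExt_harmonic (hf : Continuous f) (hM : ∀ x, |f x| ≤ M) {q : Euc n × ℝ}
    (hq : 0 < q.2) :
    ∑ i, fderiv ℝ (fderiv ℝ (poissonExt f)) q (EuclideanSpace.basisFun (Fin n) ℝ i, 0)
      (EuclideanSpace.basisFun (Fin n) ℝ i, 0) +
      fderiv ℝ (fderiv ℝ (poissonExt f)) q (0, 1) (0, 1) = 0 := by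
  simp_rw [fderiv_fderiv_poissonExt_apply hf hM hq]
  rw [← integral_finsetSum _ fun i _ => integrable_fderiv_fderiv_kernel_apply hf hM hq _,
    ← integral_add (integrable_finsetSum _
      fun i _ => integrable_fderiv_fderiv_kernel_apply hf hM hq _)
      (integrable_fderiv_fderiv_kernel_apply hf hM hq _)]
  refine (integral_congr_ae (Eventually.of_forall fun y => ?_)).trans (integral_zero (Euc n) ℝ)
  have h1 : q - (y, 0) ≠ 0 := fun h => hq.ne' (by simpa using congrArg Prod.snd h)
  have h2 := halfSpaceKernel_harmonic h1
  simp only [← Finset.mul_sum, ← mul_add]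
  rw [h2]
  simp

end Extension

/-! ### Second derivatives along lines and Taylor bounds. -/

section SecondDerivative

variable {V : Type*} [NormedAddCommGroup V] [NormedSpace ℝ V]

lemma ContDiffAt.eventually_differentiableAt_two {H : V → ℝ} {q : V} (h : ContDiffAt ℝ 2 H q) :
    ∀ᶠ p in 𝓝 q, DifferentiableAt ℝ H p :=
  (h.eventually (by simp)).mono fun _ hp => hp.differentiableAt (by norm_num)

lemma ContDiffAt.differentiableAt_fderiv_two {H : V → ℝ} {q : V} (h : ContDiffAt ℝ 2 H q) :
    DifferentiableAt ℝ (fderiv ℝ H) q :=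
  (h.fderiv_right (m := 1) (by norm_num)).differentiableAt (by norm_num)

lemma ContDiffAt.fderiv_fderiv_add {H k : V → ℝ} {q : V} (hH : ContDiffAt ℝ 2 H q)
    (hk : ContDiffAt ℝ 2 k q) :
    fderiv ℝ (fderiv ℝ (fun p => H p + k p)) q =
      fderiv ℝ (fderiv ℝ H) q + fderiv ℝ (fderiv ℝ k) q := by
  have h1 : fderiv ℝ (fun p => H p + k p) =ᶠ[𝓝 q] fun p => fderiv ℝ H p + fderiv ℝ k p := by
    filter_upwards [hH.eventually_differentiableAt_two, hk.eventually_differentiableAt_two]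
      with p h1 h2 using fderiv_fun_add h1 h2
  rw [h1.fderiv_eq, fderiv_fun_add hH.differentiableAt_fderiv_two hk.differentiableAt_fderiv_two]

lemma hasDerivAt_line (q v : V) (s : ℝ) : HasDerivAt (fun s : ℝ => q + s • v) v s := by
  simpa using ((hasDerivAt_id s).smul_const v).const_add q

/-- Second derivative along a line. -/
lemma ContDiffAt.eventually_deriv_line {H : V → ℝ} {q : V} (hH : ContDiffAt ℝ 2 H q) (v : V) :
    deriv (fun s : ℝ => H (q + s • v)) =ᶠ[𝓝 0] fun s => fderiv ℝ H (q + s • v) v := by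
  have h1 : Tendsto (fun s : ℝ => q + s • v) (𝓝 0) (𝓝 q) := by
    have := (hasDerivAt_line q v 0).continuousAt.tendsto
    simpa using this
  filter_upwards [h1.eventually hH.eventually_differentiableAt_two] with s hs
  exact (hs.hasFDerivAt.comp_hasDerivAt s (hasDerivAt_line q v s)).deriv

lemma ContDiffAt.hasDerivAt_fderiv_line {H : V → ℝ} {q : V} (hH : ContDiffAt ℝ 2 H q) (v w : V) :
    HasDerivAt (fun s : ℝ => fderiv ℝ H (q + s • v) w) (fderiv ℝ (fderiv ℝ H) q v w) 0 := by
  have h3 : HasFDerivAt (fderiv ℝ H) (fderiv ℝ (fderiv ℝ H) q) (q + (0 : ℝ) • v) := by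
    simpa using hH.differentiableAt_fderiv_two.hasFDerivAt
  have h4 := h3.comp_hasDerivAt 0 (hasDerivAt_line q v 0)
  exact h4.clm_apply (hasDerivAt_const (0 : ℝ) w) |>.congr_deriv (by simp)

/-- Were the second derivative along a line positive, the point would also be a local minimum on
that line, so the restriction would be locally constant and its second derivative zero. -/
lemma IsLocalMax.fderiv_fderiv_nonpos {H : V → ℝ} {q : V} (hmax : IsLocalMax H q)
    (hH : ContDiffAt ℝ 2 H q) (v : V) : fderiv ℝ (fderiv ℝ H) q v v ≤ 0 := by
  by_contra! hpos
  set φ : ℝ → ℝ := fun s => H (q + s • v)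
  have h1 : Tendsto (fun s : ℝ => q + s • v) (𝓝 0) (𝓝 q) := by
    have := (hasDerivAt_line q v 0).continuousAt.tendsto
    simpa using this
  have hφmax : IsLocalMax φ 0 := by
    filter_upwards [h1.eventually hmax] with s hs
    simpa [φ] using hs
  have hd2 : deriv (deriv φ) 0 = fderiv ℝ (fderiv ℝ H) q v v := by
    rw [(hH.eventually_deriv_line v).deriv_eq]
    exact (hH.hasDerivAt_fderiv_line v v).deriv
  have hc : ContinuousAt φ 0 := by
    have h2 : ContinuousAt H (q + (0 : ℝ) • v) := by simpa using hH.continuousAt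
    exact h2.comp (f := fun s : ℝ => q + s • v) (hasDerivAt_line q v 0).continuousAt
  have hmin := isLocalMin_of_deriv_deriv_pos (hd2 ▸ hpos) hφmax.deriv_eq_zero hc
  have hconst : φ =ᶠ[𝓝 0] fun _ => φ 0 := by
    filter_upwards [hφmax, hmin] with s h1 h2 using le_antisymm h1 h2
  have h3 : deriv (deriv φ) 0 = 0 := by
    rw [hconst.deriv.deriv_eq]
    simp
  rw [hd2] at h3
  linarith

lemma contDiff_linear_quadratic (L : V →L[ℝ] ℝ) (α β : ℝ) :
    ContDiff ℝ 2 (fun p : V => α * L p + β * L p ^ 2) := by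
  have := L.contDiff (n := 2)
  fun_prop

lemma fderiv_fderiv_linear_quadratic (L : V →L[ℝ] ℝ) (α β : ℝ) (q v : V) :
    fderiv ℝ (fderiv ℝ (fun p : V => α * L p + β * L p ^ 2)) q v v = 2 * β * L v ^ 2 := by
  have h1 : fderiv ℝ (fun p : V => α * L p + β * L p ^ 2) =
      fun p => α • L + (2 * β * L p) • L := by
    funext p
    have hL := L.hasFDerivAt (x := p)
    have h2 := (hL.const_mul α).add ((hL.pow 2).const_mul β)
    refine h2.fderiv.trans ?_
    ext w
    simp
    ring
  rw [h1]
  have h3 : HasFDerivAt (fun p => α • L + (2 * β * L p) • L) (((2 * β) • L).smulRight L) q := by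
    exact (((L.hasFDerivAt (x := q)).const_mul (2 * β)).smul_const L).const_add (α • L)
  rw [h3.fderiv]
  simp
  ring

/-- First order Taylor expansion with Lipschitz derivative. -/
lemma taylor_le_of_fderiv_lipschitz {H : V → ℝ} {x z : V} {K : ℝ}
    (hd : ∀ y, ‖y - x‖ ≤ ‖z‖ → DifferentiableAt ℝ H y)
    (hK : ∀ y, ‖y - x‖ ≤ ‖z‖ → ‖fderiv ℝ H y - fderiv ℝ H x‖ ≤ K * ‖y - x‖) (hK0 : 0 ≤ K) :
    |H (x + z) - H x - fderiv ℝ H x z| ≤ K * ‖z‖ ^ 2 := by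
  have h := (convex_closedBall x ‖z‖).norm_image_sub_le_of_norm_fderiv_le' (𝕜 := ℝ) (f := H)
    (φ := fderiv ℝ H x) (C := K * ‖z‖) (x := x) (y := x + z)
    (fun y hy => hd y (mem_closedBall_iff_norm.1 hy))
    (fun y hy => (hK y (mem_closedBall_iff_norm.1 hy)).trans
      (mul_le_mul_of_nonneg_left (mem_closedBall_iff_norm.1 hy) hK0))
    (mem_closedBall_self (norm_nonneg _)) (by simp)
  rw [add_sub_cancel_left] at h
  rw [← Real.norm_eq_abs]
  refine h.trans (le_of_eq ?_)
  ring

end SecondDerivative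

/-! ### Maximum principle in the half-space and the Poisson semigroup. -/

section MaximumPrinciple

variable {n : ℕ}

lemma exists_slab_max {F : Euc n × ℝ → ℝ} (hF : Continuous F) {S : ℝ} {p : Euc n × ℝ}
    (hp : p.2 ∈ Icc 0 S)
    (hdec : ∃ R, ∀ x : Euc n, R ≤ ‖x‖ → ∀ s ∈ Icc 0 S, F (x, s) ≤ F p) :
    ∃ q : Euc n × ℝ, q.2 ∈ Icc 0 S ∧ F p ≤ F q ∧ ∀ q' : Euc n × ℝ, q'.2 ∈ Icc 0 S → F q' ≤ F q := by
  obtain ⟨R, hR⟩ := hdec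
  have hcomp : IsCompact (closedBall (0 : Euc n) (max R ‖p.1‖) ×ˢ Icc 0 S) :=
    (isCompact_closedBall _ _).prod isCompact_Icc
  have hpmem : p ∈ closedBall (0 : Euc n) (max R ‖p.1‖) ×ˢ Icc 0 S :=
    ⟨by simp, hp⟩
  obtain ⟨q, hq, hmax⟩ := hcomp.exists_isMaxOn ⟨p, hpmem⟩ hF.continuousOn
  refine ⟨q, hq.2, hmax hpmem, fun q' hq' => ?_⟩
  by_cases h : ‖q'.1‖ ≤ max R ‖p.1‖
  · exact hmax (show q' ∈ _ from ⟨by simpa using h, hq'⟩)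
  · exact (hR q'.1 ((le_max_left _ _).trans (not_le.1 h).le) q'.2 hq').trans (hmax hpmem)

/-- Maximum principle for bounded harmonic functions in the half-space that vanish at infinity in
slabs. -/
lemma halfSpace_maximum_principle {h : Euc n × ℝ → ℝ} (hc : Continuous h) {M : ℝ}
    (hM : ∀ q, h q ≤ M) (hC2 : ∀ q : Euc n × ℝ, 0 < q.2 → ContDiffAt ℝ 2 h q)
    (hharm : ∀ q : Euc n × ℝ, 0 < q.2 →
      ∑ i, fderiv ℝ (fderiv ℝ h) q (EuclideanSpace.basisFun (Fin n) ℝ i, 0)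
        (EuclideanSpace.basisFun (Fin n) ℝ i, 0) + fderiv ℝ (fderiv ℝ h) q (0, 1) (0, 1) = 0)
    (hb : ∀ x, h (x, 0) ≤ 0)
    (hdec : ∀ S ε : ℝ, 0 < ε → ∃ R, ∀ x : Euc n, R ≤ ‖x‖ → ∀ s ∈ Icc 0 S, h (x, s) ≤ ε)
    {p : Euc n × ℝ} (hp : 0 ≤ p.2) : h p ≤ 0 := by
  by_contra! hpos
  have hp0 : 0 < p.2 := by
    rcases hp.eq_or_lt with h0 | h0
    · have := hb p.1
      rw [show (p.1, (0 : ℝ)) = p from Prod.ext rfl h0] at this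
      exact absurd this (not_le.2 hpos)
    · exact h0
  -- Penalising by at most `ε t` costs at most half of `h p` at `p`. The height `T` below is so
  -- large that `M ≤ εT/2`, which excludes a maximum on the top face.
  set ε := h p / (2 * p.2) with hε
  have hε0 : 0 < ε := by positivity
  set T := max p.2 (2 * M / ε)
  have hT0 : 0 < T := hp0.trans_le (le_max_left _ _)
  have hTM : M ≤ ε * T / 2 := by
    have : 2 * M / ε ≤ T := le_max_right _ _
    rw [div_le_iff₀ hε0] at this
    linarith
  let L : Euc n × ℝ →L[ℝ] ℝ := ContinuousLinearMap.snd ℝ (Euc n) ℝ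
  -- The linear part wins on `[0, T]`, keeping `k ≤ -εt/2`, and the small convex quadratic makes `h
  -- + k` strictly subharmonic.
  let k : Euc n × ℝ → ℝ := fun q => (-ε) * L q + (ε / (2 * T)) * L q ^ 2
  have hk : ∀ q : Euc n × ℝ, q.2 ∈ Icc 0 T → k q ≤ -(ε * q.2 / 2) := by
    intro q hq
    have h1 : ε / (2 * T) * q.2 ^ 2 ≤ ε * q.2 / 2 := by
      rw [div_mul_eq_mul_div, div_le_div_iff₀ (by positivity) (by positivity)]
      nlinarith [hq.1, hq.2, mul_nonneg hε0.le (mul_nonneg hq.1 (sub_nonneg.2 hq.2))]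
    simp only [k, L, ContinuousLinearMap.coe_snd']
    linarith
  have hkp : -(ε * p.2) ≤ k p := by
    have : 0 ≤ ε / (2 * T) * p.2 ^ 2 := by positivity
    simp only [k, L, ContinuousLinearMap.coe_snd']
    linarith
  have hkC : ContDiff ℝ 2 k := contDiff_linear_quadratic L _ _
  let F : Euc n × ℝ → ℝ := fun q => h q + k q
  have hFc : Continuous F := hc.add hkC.continuous
  have hFp : 0 < F p := by
    have : ε * p.2 = h p / 2 := by rw [hε]; field_simp
    simp only [F]
    linarith
  obtain ⟨q, hqT, hqp, hqmax⟩ := exists_slab_max hFc (S := T) (p := p)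
    ⟨hp, le_max_left _ _⟩ (by
      obtain ⟨R, hR⟩ := hdec T (F p) hFp
      refine ⟨R, fun x hx s hs => ?_⟩
      have h1 := hR x hx s hs
      have h2 := hk (x, s) hs
      have h3 : 0 ≤ ε * s := mul_nonneg hε0.le hs.1
      simp only [F] at h1 h2 ⊢
      linarith)
  have hFq : 0 < F q := hFp.trans_le hqp
  have hkq := hk q hqT
  have hq0 : 0 < q.2 := by
    rcases hqT.1.eq_or_lt with h0 | h0
    · exfalso
      have h1 := hb q.1
      rw [show (q.1, (0 : ℝ)) = q from Prod.ext rfl h0] at h1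
      rw [← h0] at hkq
      simp only [F] at hFq
      linarith
    · exact h0
  have hqlt : q.2 < T := by
    rcases hqT.2.eq_or_lt with h0 | h0
    · exfalso
      have h1 := hM q
      rw [h0] at hkq
      simp only [F] at hFq
      linarith
    · exact h0
  have hloc : IsLocalMax F q := by
    have : {q' : Euc n × ℝ | q'.2 ∈ Ioo 0 T} ∈ 𝓝 q :=
      (isOpen_Ioo.preimage continuous_snd).mem_nhds ⟨hq0, hqlt⟩
    filter_upwards [this] with q' hq' using hqmax q' (Ioo_subset_Icc_self hq')
  have hFC : ContDiffAt ℝ 2 F q := (hC2 q hq0).add hkC.contDiffAt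
  have hD : ∀ v : Euc n × ℝ, fderiv ℝ (fderiv ℝ h) q v v + 2 * (ε / (2 * T)) * L v ^ 2 ≤ 0 := by
    intro v
    have h1 := hloc.fderiv_fderiv_nonpos hFC v
    rw [(hC2 q hq0).fderiv_fderiv_add hkC.contDiffAt] at h1
    simp only [add_apply] at h1
    rwa [fderiv_fderiv_linear_quadratic] at h1
  have h1 := hharm q hq0
  have h2 : ∑ i, fderiv ℝ (fderiv ℝ h) q (EuclideanSpace.basisFun (Fin n) ℝ i, 0)
        (EuclideanSpace.basisFun (Fin n) ℝ i, 0) ≤ 0 := by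
    refine Finset.sum_nonpos fun i _ => ?_
    simpa [L] using hD (EuclideanSpace.basisFun (Fin n) ℝ i, 0)
  have h3 := hD (0, 1)
  have h4 : 0 < ε / (2 * T) := by positivity
  simp only [L, ContinuousLinearMap.coe_snd', one_pow, mul_one] at h3
  linarith

lemma fderiv_comp_add_const {V : Type*} [NormedAddCommGroup V] [NormedSpace ℝ V] {F : Type*}
    [NormedAddCommGroup F] [NormedSpace ℝ F] (H : V → F) (a : V) :
    fderiv ℝ (fun p => H (p + a)) = fun p => fderiv ℝ H (p + a) := by
  funext p
  exact fderiv_comp_add_right a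

/-- Semigroup property of harmonic extensions. -/
lemma poissonExt_semigroup {f : Euc n → ℝ} (hf : Continuous f)
    (h0 : Tendsto f (cocompact (Euc n)) (𝓝 0)) {t : ℝ} (ht : 0 ≤ t) {q : Euc n × ℝ}
    (hq : 0 ≤ q.2) :
    poissonExt (fun x => poissonExt f (x, t)) q = poissonExt f (q.1, q.2 + t) := by
  obtain ⟨M, hM⟩ := exists_bound_of_tendsto_cocompact hf h0
  have hUc := continuous_poissonExt hf hM
  have hUM := abs_poissonExt_le hf hM
  have hgc : Continuous (fun x => poissonExt f (x, t)) := hUc.comp (by fun_prop)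
  have hgM : ∀ x, |poissonExt f (x, t)| ≤ M := fun x => hUM _
  have hg0 : Tendsto (fun x => poissonExt f (x, t)) (cocompact (Euc n)) (𝓝 0) := by
    rw [Metric.tendsto_nhds]
    intro ε hε
    obtain ⟨R, hR⟩ := poissonExt_slab_decay hf h0 t (half_pos hε)
    rw [← cobounded_eq_cocompact, ← comap_norm_atTop, eventually_comap]
    filter_upwards [eventually_ge_atTop R] with r hr x hx
    rw [dist_zero_right]
    exact (hR x (hx ▸ hr) t ⟨ht, le_rfl⟩).trans_lt (half_lt_self hε)
  let A : Euc n × ℝ → ℝ := poissonExt (fun x => poissonExt f (x, t))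
  let B : Euc n × ℝ → ℝ := fun p => poissonExt f (p + (0, t))
  have hAB : B q = poissonExt f (q.1, q.2 + t) := by
    simp only [B]
    congr 1
    ext1 <;> simp
  rw [← hAB]
  have hAC : ∀ p : Euc n × ℝ, 0 < p.2 → ContDiffAt ℝ 2 A p := fun p hp =>
    contDiffAt_poissonExt hgc hgM hp
  have hpos : ∀ p : Euc n × ℝ, 0 < p.2 → 0 < (p + (0, t)).2 := fun p hp => by
    simpa using add_pos_of_pos_of_nonneg hp ht
  have hBC : ∀ p : Euc n × ℝ, 0 < p.2 → ContDiffAt ℝ 2 B p := fun p hp =>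
    ContDiffAt.comp (g := poissonExt f) (f := fun p => p + (0, t)) p
      (contDiffAt_poissonExt hf hM (hpos p hp)) (by fun_prop)
  have hBd : fderiv ℝ (fderiv ℝ B) = fun p => fderiv ℝ (fderiv ℝ (poissonExt f)) (p + (0, t)) := by
    rw [fderiv_comp_add_const, fderiv_comp_add_const]
  have hnegd : ∀ G : Euc n × ℝ → ℝ, fderiv ℝ (fderiv ℝ (fun p => -G p)) =
      fun p => -fderiv ℝ (fderiv ℝ G) p := by
    intro G
    have h1 : fderiv ℝ (fun p => -G p) = fun p => -fderiv ℝ G p := by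
      funext p
      exact fderiv_fun_neg
    rw [h1]
    funext p
    exact fderiv_fun_neg
  have hA0 := fun p hp => poissonExt_harmonic hgc hgM (q := p) hp
  have hB0 := fun p hp => poissonExt_harmonic hf hM (q := p + (0, t)) (hpos p hp)
  -- Uniqueness for the Dirichlet problem, stated as one-sided comparison so that it can be applied
  -- to `A, B` in both orders.
  have key : ∀ G₁ G₂ : Euc n × ℝ → ℝ, Continuous G₁ → Continuous G₂ → (∀ p, |G₁ p| ≤ M) →
      (∀ p, |G₂ p| ≤ M) → (∀ p : Euc n × ℝ, 0 < p.2 → ContDiffAt ℝ 2 G₁ p) →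
      (∀ p : Euc n × ℝ, 0 < p.2 → ContDiffAt ℝ 2 G₂ p) →
      (∀ p : Euc n × ℝ, 0 < p.2 →
        ∑ i, fderiv ℝ (fderiv ℝ G₁) p (EuclideanSpace.basisFun (Fin n) ℝ i, 0)
        (EuclideanSpace.basisFun (Fin n) ℝ i, 0) + fderiv ℝ (fderiv ℝ G₁) p (0, 1) (0, 1) = 0) →
      (∀ p : Euc n × ℝ, 0 < p.2 →
        ∑ i, fderiv ℝ (fderiv ℝ G₂) p (EuclideanSpace.basisFun (Fin n) ℝ i, 0)
        (EuclideanSpace.basisFun (Fin n) ℝ i, 0) + fderiv ℝ (fderiv ℝ G₂) p (0, 1) (0, 1) = 0) →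
      (∀ x, G₁ (x, 0) = G₂ (x, 0)) →
      (∀ S ε : ℝ, 0 < ε → ∃ R, ∀ x : Euc n, R ≤ ‖x‖ → ∀ s ∈ Icc 0 S, |G₁ (x, s)| ≤ ε) →
      (∀ S ε : ℝ, 0 < ε → ∃ R, ∀ x : Euc n, R ≤ ‖x‖ → ∀ s ∈ Icc 0 S, |G₂ (x, s)| ≤ ε) →
      G₁ q ≤ G₂ q := by
    intro G₁ G₂ c₁ c₂ b₁ b₂ C₁ C₂ h₁ h₂ h12 d₁ d₂
    have hD : ∀ p : Euc n × ℝ, 0 < p.2 → fderiv ℝ (fderiv ℝ (fun p => G₁ p + -G₂ p)) p =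
        fderiv ℝ (fderiv ℝ G₁) p + -fderiv ℝ (fderiv ℝ G₂) p := by
      intro p hp
      rw [(C₁ p hp).fderiv_fderiv_add (C₂ p hp).neg]
      congr 1
      exact congrFun (hnegd G₂) p
    have := halfSpace_maximum_principle (h := fun p => G₁ p + -G₂ p) (c₁.add c₂.neg)
      (M := M + M) (fun p => by
        have := le_of_abs_le (b₁ p)
        have := neg_le_of_abs_le (b₂ p)
        linarith)
      (fun p hp => (C₁ p hp).add (C₂ p hp).neg)
      (fun p hp => by
        rw [hD p hp]
        have e1 := h₁ p hp
        have e2 := h₂ p hp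
        simp only [add_apply, neg_apply,
          Finset.sum_add_distrib, Finset.sum_neg_distrib]
        linarith)
      (fun x => by rw [h12 x]; simp)
      (fun S ε hε => by
        obtain ⟨R₁, hR₁⟩ := d₁ S (ε / 2) (half_pos hε)
        obtain ⟨R₂, hR₂⟩ := d₂ S (ε / 2) (half_pos hε)
        refine ⟨max R₁ R₂, fun x hx s hs => ?_⟩
        have := le_of_abs_le (hR₁ x ((le_max_left _ _).trans hx) s hs)
        have := neg_le_of_abs_le (hR₂ x ((le_max_right _ _).trans hx) s hs)
        linarith) hq
    linarith
  have hA1 : ∀ p : Euc n × ℝ, 0 < p.2 →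
        ∑ i, fderiv ℝ (fderiv ℝ A) p (EuclideanSpace.basisFun (Fin n) ℝ i, 0)
        (EuclideanSpace.basisFun (Fin n) ℝ i, 0) + fderiv ℝ (fderiv ℝ A) p (0, 1) (0, 1) = 0 :=
    hA0
  have hB1 : ∀ p : Euc n × ℝ, 0 < p.2 →
        ∑ i, fderiv ℝ (fderiv ℝ B) p (EuclideanSpace.basisFun (Fin n) ℝ i, 0)
        (EuclideanSpace.basisFun (Fin n) ℝ i, 0) + fderiv ℝ (fderiv ℝ B) p (0, 1) (0, 1) = 0 := by
    rw [hBd]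
    exact hB0
  have hbd : ∀ x, A (x, 0) = B (x, 0) := by
    intro x
    simp [A, B, poissonExt_zero_right]
  have hAc : Continuous A := continuous_poissonExt hgc hgM
  have hBc : Continuous B := hUc.comp (by fun_prop)
  have hAM : ∀ p, |A p| ≤ M := abs_poissonExt_le hgc hgM
  have hBM : ∀ p, |B p| ≤ M := fun p => hUM _
  have hAd : ∀ S ε : ℝ, 0 < ε → ∃ R, ∀ x : Euc n, R ≤ ‖x‖ → ∀ s ∈ Icc 0 S, |A (x, s)| ≤ ε :=
    fun S ε hε => poissonExt_slab_decay hgc hg0 S hε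
  have hBdec : ∀ S ε : ℝ, 0 < ε → ∃ R, ∀ x : Euc n, R ≤ ‖x‖ → ∀ s ∈ Icc 0 S, |B (x, s)| ≤ ε := by
    intro S ε hε
    obtain ⟨R, hR⟩ := poissonExt_slab_decay hf h0 (S + t) hε
    refine ⟨R, fun x hx s hs => ?_⟩
    have := hR x hx (s + t) ⟨add_nonneg hs.1 ht, by linarith [hs.2]⟩
    simpa [B] using this
  exact le_antisymm (key A B hAc hBc hAM hBM hAC hBC hA1 hB1 hbd hAd hBdec)
    (key B A hBc hAc hBM hAM hBC hAC hB1 hA1 (fun x => (hbd x).symm) hBdec hAd)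

end MaximumPrinciple

/-! ### The half-Laplacian as generator of the Poisson semigroup. -/

section HalfLaplacian

variable {n : ℕ} {v : Euc n → ℝ} {x : Euc n} {M : ℝ}

/-- The first-order terms of the expansions at `z` and `-z` cancel. -/
lemma abs_second_difference_le {V : Type*} [NormedAddCommGroup V] [NormedSpace ℝ V] {H : V → ℝ}
    {x z : V} {K : ℝ}
    (hd : ∀ y, ‖y - x‖ ≤ ‖z‖ → DifferentiableAt ℝ H y)
    (hK : ∀ y, ‖y - x‖ ≤ ‖z‖ → ‖fderiv ℝ H y - fderiv ℝ H x‖ ≤ K * ‖y - x‖) (hK0 : 0 ≤ K) :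
    |H x - (H (x + z) + H (x - z)) / 2| ≤ K * ‖z‖ ^ 2 := by
  have h1 := taylor_le_of_fderiv_lipschitz hd hK hK0
  have h2 := taylor_le_of_fderiv_lipschitz (z := -z) (by simpa using hd) (by simpa using hK) hK0
  rw [← sub_eq_add_neg, map_neg, norm_neg] at h2
  rw [abs_le] at h1 h2 ⊢
  constructor <;> linarith [h1.1, h1.2, h2.1, h2.2]

lemma abs_second_difference_le_of_bound (hM : ∀ y, |v y| ≤ M) (z : Euc n) :
    |v x - (v (x + z) + v (x - z)) / 2| ≤ 2 * M := by
  have h1 := abs_le.1 (hM x)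
  have h2 := abs_le.1 (hM (x + z))
  have h3 := abs_le.1 (hM (x - z))
  rw [abs_le]
  constructor <;> linarith [h1.1, h1.2, h2.1, h2.2, h3.1, h3.2]

lemma exists_abs_second_difference_le (hM : ∀ y, |v y| ≤ M) (hv : ContDiffAt ℝ 2 v x) :
    ∃ C, 0 ≤ C ∧ ∀ z, |v x - (v (x + z) + v (x - z)) / 2| ≤ C * min 1 (‖z‖ ^ 2) := by
  have hM0 : 0 ≤ M := (abs_nonneg _).trans (hM 0)
  obtain ⟨K, t, ht, hK⟩ := (hv.fderiv_right (m := 1) (by norm_num)).exists_lipschitzOnWith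
  obtain ⟨ρ, hρ, hρt⟩ := Metric.mem_nhds_iff.1
    (inter_mem ht hv.eventually_differentiableAt_two)
  set C : ℝ := K + 2 * M / min 1 (ρ ^ 2)
  have hmin : 0 < min 1 (ρ ^ 2) := by positivity
  refine ⟨C, by positivity, fun z => ?_⟩
  have h2M := abs_second_difference_le_of_bound (x := x) hM z
  have hKC : 2 * M ≤ C * min 1 (ρ ^ 2) := by
    have : 2 * M / min 1 (ρ ^ 2) * min 1 (ρ ^ 2) = 2 * M := by field_simp
    simp only [C]
    rw [add_mul, this]
    have : 0 ≤ (K : ℝ) * min 1 (ρ ^ 2) := by positivity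
    linarith
  rcases lt_or_ge ‖z‖ ρ with hz | hz
  · have hmem : ∀ y, ‖y - x‖ ≤ ‖z‖ → y ∈ t ∩ {p | DifferentiableAt ℝ v p} := fun y hy =>
      hρt (mem_ball_iff_norm.2 (hy.trans_lt hz))
    have hxmem := hmem x (by simp)
    have h1 := abs_second_difference_le (H := v) (x := x) (z := z) (K := K)
      (fun y hy => (hmem y hy).2)
      (fun y hy => by
        have := hK.dist_le_mul y (hmem y hy).1 x hxmem.1
        rwa [dist_eq_norm, dist_eq_norm] at this) K.2
    rcases le_total 1 (‖z‖ ^ 2) with h | h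
    · rw [min_eq_left h, mul_one]
      refine h2M.trans (hKC.trans ?_)
      have : C * min 1 (ρ ^ 2) ≤ C * 1 := by gcongr; exact min_le_left _ _
      linarith
    · rw [min_eq_right h]
      refine h1.trans ?_
      gcongr
      have : 0 ≤ 2 * M / min 1 (ρ ^ 2) := by positivity
      simp only [C]
      linarith
  · refine h2M.trans (hKC.trans ?_)
    gcongr

lemma aestronglyMeasurable_second_difference (hm : Measurable v) :
    AEStronglyMeasurable (fun z : Euc n => v x - (v (x + z) + v (x - z)) / 2) := by
  have h1 : Measurable (fun z : Euc n => v (x + z)) := hm.comp (by fun_prop)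
  have h2 : Measurable (fun z : Euc n => v (x - z)) := hm.comp (by fun_prop)
  exact (measurable_const.sub ((h1.add h2).div_const 2)).aestronglyMeasurable

lemma integrable_halfLaplacian (hn : 0 < n) (hm : Measurable v) (hM : ∀ y, |v y| ≤ M)
    (hv : ContDiffAt ℝ 2 v x) :
    Integrable (fun z : Euc n => (v x - (v (x + z) + v (x - z)) / 2) / ‖z‖ ^ (n + 1)) := by
  obtain ⟨C, hC0, hC⟩ := exists_abs_second_difference_le hM hv
  refine ((integrable_min_one_sq_div hn).const_mul C).mono' ?_ (Eventually.of_forall fun z => ?_)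
  · simp_rw [div_eq_mul_inv]
    refine (aestronglyMeasurable_second_difference hm).mul ?_
    exact Measurable.aestronglyMeasurable (by fun_prop)
  · rw [norm_div, norm_pow, norm_norm, ← mul_div_assoc, Real.norm_eq_abs]
    gcongr
    exact hC z

/-- Ellipticity: with equal values at `x`, the two integrands are ordered pointwise. -/
lemma halfLaplacian_le_of_touching (hn : 0 < n) {w : Euc n → ℝ} {M' : ℝ}
    (hm : Measurable v) (hM : ∀ y, |v y| ≤ M) (hv : ContDiffAt ℝ 2 v x)
    (hm' : Measurable w) (hM' : ∀ y, |w y| ≤ M') (hw : ContDiffAt ℝ 2 w x)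
    (hx : v x = w x) (hle : ∀ y, w y ≤ v y) : halfLaplacian v x ≤ halfLaplacian w x := by
  unfold halfLaplacian
  refine mul_le_mul_of_nonneg_left ?_ (halfLapConst_pos n).le
  refine integral_mono (integrable_halfLaplacian hn hm hM hv)
    (integrable_halfLaplacian hn hm' hM' hw) fun z => ?_
  simp only
  rw [hx]
  gcongr <;> exact hle _

lemma halfLaplacian_comp_sub (v : Euc n → ℝ) (a x : Euc n) :
    halfLaplacian (fun y => v (y - a)) x = halfLaplacian v (x - a) := by
  unfold halfLaplacian
  congr 2
  funext y
  rw [sub_add_eq_add_sub, sub_right_comm]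

lemma rpow_half_eq_norm_pow (z : Euc n) (hz : z ≠ 0) :
    (‖z‖ ^ 2) ^ (-(((n : ℝ) + 1) / 2)) = (‖z‖ ^ (n + 1))⁻¹ := by
  have h0 : 0 < ‖z‖ := norm_pos_iff.2 hz
  rw [← Real.rpow_natCast ‖z‖ 2, ← Real.rpow_mul h0.le, ← Real.rpow_natCast,
    ← Real.rpow_neg h0.le]
  congr 1
  push_cast
  ring

/-- The half-Laplacian is the generator of the Poisson semigroup. -/
lemma tendsto_sub_poissonExt_div (hn : 0 < n) (hc : Continuous v) (hM : ∀ y, |v y| ≤ M)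
    (hv : ContDiffAt ℝ 2 v x) :
    Tendsto (fun h : ℝ => (v x - poissonExt v (x, h)) / h) (𝓝[>] 0) (𝓝 (halfLaplacian v x)) := by
  obtain ⟨C, hC0, hC⟩ := exists_abs_second_difference_le hM hv
  set δ : Euc n → ℝ := fun z => v x - (v (x + z) + v (x - z)) / 2 with hδ
  have hδm : AEStronglyMeasurable δ := aestronglyMeasurable_second_difference hc.measurable
  -- After symmetrising and rescaling, the quotient is the half-Laplacian with `|z|^{-(n+1)}`
  -- replaced by `(|z|²+h²)^{-(n+1)/2}`. The latter is dominated by the former and converges to it.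
  have h1 : ∀ h : ℝ, 0 < h → (v x - poissonExt v (x, h)) / h =
      ∫ z : Euc n, halfLapConst n * (‖z‖ ^ 2 + h ^ 2) ^ (-(((n : ℝ) + 1) / 2)) * δ z := by
    intro h hh
    have e1 : v x = ∫ y : Euc n, poissonDensity y * v x := by
      rw [integral_mul_const, integral_poissonDensity, one_mul]
    have e2 : v x - poissonExt v (x, h) = ∫ y : Euc n, poissonDensity y * δ (h • y) := by
      have hi1 : Integrable (fun y : Euc n => poissonDensity y * v x) :=
        (integrable_poissonDensity n).mul_const _
      have hi2 : Integrable (fun y : Euc n =>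
          poissonDensity y * ((v (x + h • y) + v (x - h • y)) / 2)) := by
        have ha := integrable_poissonDensity_mul hc hM (x, h)
        have hb := integrable_poissonDensity_mul hc hM (x, -h)
        refine ((hb.add ha).div_const 2).congr (Eventually.of_forall fun y => ?_)
        simp
        ring
      rw [poissonExt_eq_symm hc hM]
      nth_rewrite 1 [e1]
      simp only
      rw [← integral_sub hi1 hi2]
      congr 1
      funext y
      simp only [hδ]
      ring
    rw [e2, integral_comp_smul_poissonDensity hh, ← integral_div]
    congr 1
    funext z
    rw [halfSpaceKernel]
    field_simp
  have h2 : halfLaplacian v x =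
      ∫ z : Euc n, halfLapConst n * (‖z‖ ^ 2) ^ (-(((n : ℝ) + 1) / 2)) * δ z := by
    unfold halfLaplacian
    rw [← integral_const_mul]
    congr 1
    funext z
    by_cases hz : z = 0
    · simp [hz, hδ]
    · rw [rpow_half_eq_norm_pow z hz]
      simp only [hδ, halfLapConst]
      ring
  have hlim : Tendsto (fun h : ℝ => ∫ z : Euc n,
      halfLapConst n * (‖z‖ ^ 2 + h ^ 2) ^ (-(((n : ℝ) + 1) / 2)) * δ z) (𝓝[>] 0)
      (𝓝 (∫ z : Euc n, halfLapConst n * (‖z‖ ^ 2) ^ (-(((n : ℝ) + 1) / 2)) * δ z)) := by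
    refine tendsto_integral_filter_of_dominated_convergence
      (fun z => halfLapConst n * (C * (min 1 (‖z‖ ^ 2) / ‖z‖ ^ (n + 1)))) ?_ ?_
      (((integrable_min_one_sq_div hn).const_mul C).const_mul _) (Eventually.of_forall fun z => ?_)
    · refine Eventually.of_forall fun h => AEStronglyMeasurable.mul ?_ hδm
      exact Measurable.aestronglyMeasurable (by fun_prop)
    · filter_upwards [self_mem_nhdsWithin] with h hh
      refine Eventually.of_forall fun z => ?_
      have hc0 := halfLapConst_pos n
      have hh0 : (0 : ℝ) < h := hh
      rw [norm_mul, norm_mul, Real.norm_of_nonneg hc0.le, mul_assoc]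
      refine mul_le_mul_of_nonneg_left ?_ hc0.le
      by_cases hz : z = 0
      · simp [hz, hδ]
      · have hz0 : 0 < ‖z‖ := norm_pos_iff.2 hz
        rw [Real.norm_of_nonneg (by positivity), mul_comm]
        have e1 : (‖z‖ ^ 2 + h ^ 2) ^ (-(((n : ℝ) + 1) / 2)) ≤ (‖z‖ ^ (n + 1))⁻¹ := by
          rw [← rpow_half_eq_norm_pow z hz]
          refine Real.rpow_le_rpow_of_nonpos (by positivity) (by nlinarith) ?_
          have : 0 ≤ ((n : ℝ) + 1) / 2 := by positivity
          linarith
        calc ‖δ z‖ * (‖z‖ ^ 2 + h ^ 2) ^ (-(((n : ℝ) + 1) / 2))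
            ≤ (C * min 1 (‖z‖ ^ 2)) * (‖z‖ ^ (n + 1))⁻¹ := by
              refine mul_le_mul (hC z) e1 (by positivity) (by positivity)
          _ = _ := by ring
    · by_cases hz : z = 0
      · simp [hz, hδ]
      · have hz0 : 0 < ‖z‖ := norm_pos_iff.2 hz
        refine Tendsto.mul_const _ (Tendsto.const_mul _ ?_)
        have hcont : ContinuousAt (fun h : ℝ => (‖z‖ ^ 2 + h ^ 2) ^ (-(((n : ℝ) + 1) / 2))) 0 := by
          refine ContinuousAt.rpow_const (by fun_prop) (Or.inl ?_)
          positivity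
        have := hcont.tendsto
        simp only [ne_eq, OfNat.ofNat_ne_zero, not_false_eq_true, zero_pow, add_zero] at this
        exact this.mono_left nhdsWithin_le_nhds
  rw [h2]
  refine hlim.congr' ?_
  filter_upwards [self_mem_nhdsWithin] with h hh using (h1 h hh).symm

lemma contDiffAt_slice {H : Euc n × ℝ → ℝ} {t : ℝ} {x : Euc n} (h : ContDiffAt ℝ 2 H (x, t)) :
    ContDiffAt ℝ 2 (fun y => H (y, t)) x :=
  ContDiffAt.comp (g := H) (f := fun y => (y, t)) x h (by fun_prop)

/-- The half-Laplacian of a slice of the harmonic extension is minus the vertical derivative. -/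
lemma halfLaplacian_poissonExt (hn : 0 < n) {f : Euc n → ℝ} (hf : Continuous f)
    (h0 : Tendsto f (cocompact (Euc n)) (𝓝 0)) {t : ℝ} (ht : 0 < t) (x : Euc n) :
    halfLaplacian (fun y => poissonExt f (y, t)) x = -fderiv ℝ (poissonExt f) (x, t) (0, 1) := by
  obtain ⟨M, hM⟩ := exists_bound_of_tendsto_cocompact hf h0
  have hUC : ContDiffAt ℝ 2 (poissonExt f) (x, t) := contDiffAt_poissonExt hf hM ht
  have h1 := tendsto_sub_poissonExt_div hn (v := fun y => poissonExt f (y, t)) (x := x) (M := M)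
    ((continuous_poissonExt hf hM).comp (by fun_prop)) (fun y => abs_poissonExt_le hf hM _)
    (contDiffAt_slice hUC)
  refine tendsto_nhds_unique h1 ?_
  have h2 : HasDerivAt (fun s : ℝ => poissonExt f ((x, t) + s • ((0 : Euc n), (1 : ℝ))))
      (fderiv ℝ (poissonExt f) (x, t) (0, 1)) 0 := by
    have h3 : HasFDerivAt (poissonExt f) (fderiv ℝ (poissonExt f) (x, t))
      ((x, t) + (0 : ℝ) • ((0 : Euc n), (1 : ℝ))) := by
      simpa using (hUC.differentiableAt (by norm_num)).hasFDerivAt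
    exact h3.comp_hasDerivAt 0 (hasDerivAt_line _ _ 0)
  have h4 := h2.tendsto_slope_zero_right.neg
  refine h4.congr' ?_
  filter_upwards [self_mem_nhdsWithin] with h hh
  have hh0 : (0 : ℝ) < h := hh
  -- Extending the slice at height `t` up to height `h` gives `U` at height `t + h`, so the
  -- generator quotient is a vertical difference quotient of `U`.
  rw [poissonExt_semigroup hf h0 ht.le (q := (x, h)) hh0.le]
  simp
  rw [add_comm h t]
  field_simp
  ring

end HalfLaplacian

/-! ### Testing the equation with globally touching functions. -/

section Viscosity

variable {n : ℕ} {b x : Euc n} {u ψ : Euc n → ℝ} {M M' : ℝ}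

lemma testGlue_self (u ψ : Euc n → ℝ) (x : Euc n) {r : ℝ} (hr : 0 < r) :
    testGlue u ψ x r x = ψ x := by
  simp [testGlue, hr]

lemma testGlue_eventuallyEq (u ψ : Euc n → ℝ) (x : Euc n) {r : ℝ} (hr : 0 < r) :
    testGlue u ψ x r =ᶠ[𝓝 x] ψ := by
  filter_upwards [ball_mem_nhds x hr] with y hy
  exact if_pos hy

lemma measurable_testGlue (hu : Measurable u) (hψ : Measurable ψ) (x : Euc n) (r : ℝ) :
    Measurable (testGlue u ψ x r) :=
  Measurable.ite (measurableSet_lt (by fun_prop) measurable_const) hψ hu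

lemma abs_testGlue_le (hu : ∀ y, |u y| ≤ M) (hψ : ∀ y, |ψ y| ≤ M') (x : Euc n) (r : ℝ)
    (y : Euc n) : |testGlue u ψ x r y| ≤ max M M' := by
  unfold testGlue
  split_ifs
  · exact (hψ y).trans (le_max_right _ _)
  · exact (hu y).trans (le_max_left _ _)

/-- The glued function lies above `ψ` and agrees with it near `x`, so its half-Laplacian at `x` is
the smaller one. A test function ordered on the whole space can therefore be inserted without
gluing. -/
lemma IsViscositySupersolution.nonneg_of_touching (hn : 0 < n)
    (hsup : IsViscositySupersolution b u univ) (hu : Continuous u) (huM : ∀ y, |u y| ≤ M)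
    (hψ : ContDiff ℝ 2 ψ) (hψM : ∀ y, |ψ y| ≤ M') (hx : ψ x = u x) (hle : ∀ y, ψ y ≤ u y) :
    0 ≤ halfLaplacian ψ x + fderiv ℝ ψ x b := by
  have h1 := hsup x (mem_univ x) 1 one_pos ψ hψ hx fun y _ => hle y
  have h2 := halfLaplacian_le_of_touching hn (x := x)
    (measurable_testGlue hu.measurable hψ.continuous.measurable x 1) (abs_testGlue_le huM hψM x 1)
    (hψ.contDiffAt.congr_of_eventuallyEq (testGlue_eventuallyEq u ψ x one_pos))
    hψ.continuous.measurable hψM hψ.contDiffAt (testGlue_self u ψ x one_pos) (fun y => by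
      unfold testGlue
      split_ifs
      · exact le_rfl
      · exact hle y)
  linarith

lemma IsViscositySubsolution.nonpos_of_touching (hn : 0 < n) {Ω : Set (Euc n)}
    (hsub : IsViscositySubsolution b u Ω) (hu : Continuous u) (huM : ∀ y, |u y| ≤ M)
    (hψ : ContDiff ℝ 2 ψ) (hψM : ∀ y, |ψ y| ≤ M') (hxΩ : x ∈ Ω) (hx : ψ x = u x)
    (hle : ∀ y, u y ≤ ψ y) :
    halfLaplacian ψ x + fderiv ℝ ψ x b ≤ 0 := by
  have h1 := hsub x hxΩ 1 one_pos ψ hψ hx fun y _ => hle y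
  have h2 := halfLaplacian_le_of_touching hn (x := x)
    hψ.continuous.measurable hψM hψ.contDiffAt
    (measurable_testGlue hu.measurable hψ.continuous.measurable x 1) (abs_testGlue_le huM hψM x 1)
    (hψ.contDiffAt.congr_of_eventuallyEq (testGlue_eventuallyEq u ψ x one_pos))
    (testGlue_self u ψ x one_pos).symm (fun y => by
      unfold testGlue
      split_ifs
      · exact le_rfl
      · exact hle y)
  linarith

end Viscosity

/-! ### The drift semigroup and parabolic comparison with viscosity solutions. -/

/-- The semigroup generated by `-((-Δ)^{1/2} + b · ∇)`: harmonic extension followed by a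
translation along the drift. -/
noncomputable def driftExt {n : ℕ} (b : Euc n) (f : Euc n → ℝ) (q : Euc n × ℝ) : ℝ :=
  poissonExt f (q.1 - q.2 • b, q.2)

section DriftExt

variable {n : ℕ} {b : Euc n} {f : Euc n → ℝ} {M : ℝ}

lemma continuous_driftExt (hf : Continuous f) (hM : ∀ x, |f x| ≤ M) :
    Continuous (driftExt b f) :=
  (continuous_poissonExt hf hM).comp (by fun_prop)

lemma driftExt_zero_right (x : Euc n) : driftExt b f (x, 0) = f x := by
  simp [driftExt, poissonExt_zero_right]

lemma driftExt_slab_decay (hf : Continuous f) (h0 : Tendsto f (cocompact (Euc n)) (𝓝 0))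
    (S : ℝ) {ε : ℝ} (hε : 0 < ε) :
    ∃ R, ∀ x : Euc n, R ≤ ‖x‖ → ∀ s ∈ Icc 0 S, |driftExt b f (x, s)| ≤ ε := by
  obtain ⟨R, hR⟩ := poissonExt_slab_decay hf h0 S hε
  refine ⟨R + S * ‖b‖, fun x hx s hs => hR _ ?_ s hs⟩
  have h1 := norm_sub_norm_le x (s • b)
  have h2 : ‖s • b‖ ≤ S * ‖b‖ := by
    rw [norm_smul, Real.norm_of_nonneg hs.1]
    exact mul_le_mul_of_nonneg_right hs.2 (norm_nonneg _)
  simp only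
  linarith

lemma exists_bound_outside_of_tendsto (h0 : Tendsto f (cocompact (Euc n)) (𝓝 0)) {ε : ℝ}
    (hε : 0 < ε) : ∃ R, ∀ x : Euc n, R ≤ ‖x‖ → |f x| ≤ ε := by
  rw [← cobounded_eq_cocompact, ← comap_norm_atTop] at h0
  have h1 := h0.abs
  rw [abs_zero] at h1
  have h2 := h1.eventually_lt_const hε
  rw [eventually_comap] at h2
  obtain ⟨R, hR⟩ := eventually_atTop.1 h2
  exact ⟨R, fun x hx => (hR _ hx x rfl).le⟩

lemma hasFDerivAt_poissonExt' (hf : Continuous f) (hM : ∀ x, |f x| ≤ M) {q : Euc n × ℝ}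
    (hq : 0 < q.2) : HasFDerivAt (poissonExt f) (fderiv ℝ (poissonExt f) q) q :=
  (hasFDerivAt_poissonExt hf hM hq).differentiableAt.hasFDerivAt

lemma hasDerivAt_driftExt (hf : Continuous f) (hM : ∀ x, |f x| ≤ M) (x : Euc n) {s : ℝ}
    (hs : 0 < s) :
    HasDerivAt (fun σ : ℝ => driftExt b f (x, σ))
      (fderiv ℝ (poissonExt f) (x - s • b, s) (-b, 1)) s := by
  have h1 : HasDerivAt (fun σ : ℝ => (x - σ • b, σ)) (-b, (1 : ℝ)) s := by
    have := hasDerivAt_line (x, (0 : ℝ)) (-b, (1 : ℝ)) s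
    convert! this using 1
    funext σ
    ext1 <;> simp [sub_eq_add_neg]
  exact HasFDerivAt.comp_hasDerivAt (f := fun σ : ℝ => (x - σ • b, σ)) s
    (hasFDerivAt_poissonExt' hf hM (q := (x - s • b, s)) hs) h1

lemma contDiff_driftExt_slice (hf : Continuous f) (hM : ∀ x, |f x| ≤ M) {s : ℝ} (hs : 0 < s) :
    ContDiff ℝ 2 (fun y => driftExt b f (y, s)) := by
  rw [contDiff_iff_contDiffAt]
  intro x
  exact ContDiffAt.comp (g := poissonExt f) (f := fun y => (y - s • b, s)) x
    (contDiffAt_poissonExt hf hM hs) (by fun_prop)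

lemma fderiv_driftExt_slice (hf : Continuous f) (hM : ∀ x, |f x| ≤ M) (x : Euc n) {s : ℝ}
    (hs : 0 < s) (v : Euc n) :
    fderiv ℝ (fun y => driftExt b f (y, s)) x v =
      fderiv ℝ (poissonExt f) (x - s • b, s) (v, 0) := by
  have h1 : HasFDerivAt (fun y : Euc n => (y - s • b, s))
      ((ContinuousLinearMap.id ℝ (Euc n)).prod 0) x :=
    ((hasFDerivAt_id x).sub_const _).prodMk (hasFDerivAt_const s x)
  have h2 := HasFDerivAt.comp (f := fun y : Euc n => (y - s • b, s)) x
    (hasFDerivAt_poissonExt' hf hM (q := (x - s • b, s)) hs) h1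
  have h3 : fderiv ℝ (fun y => driftExt b f (y, s)) x = _ := h2.fderiv
  rw [h3]
  simp

lemma halfLaplacian_driftExt (hn : 0 < n) (hf : Continuous f)
    (h0 : Tendsto f (cocompact (Euc n)) (𝓝 0)) {s : ℝ} (hs : 0 < s) (x : Euc n) :
    halfLaplacian (fun y => driftExt b f (y, s)) x =
      -fderiv ℝ (poissonExt f) (x - s • b, s) (0, 1) := by
  rw [← halfLaplacian_poissonExt hn hf h0 hs]
  exact halfLaplacian_comp_sub (fun y => poissonExt f (y, s)) (s • b) x

/-- This is the evolution equation: by `hasDerivAt_driftExt` the right-hand side is minus the time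
derivative of `T_s f` at `x`. -/
lemma halfLaplacian_add_fderiv_driftExt (hn : 0 < n) (hf : Continuous f)
    (h0 : Tendsto f (cocompact (Euc n)) (𝓝 0)) {s : ℝ} (hs : 0 < s) (x : Euc n) :
    halfLaplacian (fun y => driftExt b f (y, s)) x + fderiv ℝ (fun y => driftExt b f (y, s)) x b =
      -fderiv ℝ (poissonExt f) (x - s • b, s) (-b, 1) := by
  obtain ⟨M, hM⟩ := exists_bound_of_tendsto_cocompact hf h0
  rw [halfLaplacian_driftExt hn hf h0 hs, fderiv_driftExt_slice hf hM x hs, ← map_neg, ← map_neg,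
    ← map_add]
  congr 1
  ext1 <;> simp

lemma halfLaplacian_add_const (v : Euc n → ℝ) (c : ℝ) (x : Euc n) :
    halfLaplacian (fun y => v y + c) x = halfLaplacian v x := by
  unfold halfLaplacian
  congr 2
  funext y
  ring

/-- A space-time maximum may sit at the final time, where only left difference quotients are
available. -/
lemma nonneg_of_hasDerivAt_of_left_max {g : ℝ → ℝ} {d s : ℝ} (hs : 0 < s)
    (hg : HasDerivAt g d s) (hmax : ∀ σ ∈ Icc 0 s, g σ ≤ g s) : 0 ≤ d := by
  refine ge_of_tendsto hg.tendsto_slope_zero_left ?_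
  have h1 : ∀ᶠ h : ℝ in 𝓝[<] 0, -s < h :=
    nhdsWithin_le_nhds (Ioi_mem_nhds (neg_lt_zero.2 hs))
  filter_upwards [self_mem_nhdsWithin, h1] with h hh hsh
  have hh0 : h < 0 := hh
  have h2 := hmax (s + h) ⟨by linarith, by linarith⟩
  rw [smul_eq_mul]
  exact mul_nonneg_of_nonpos_of_nonpos (inv_nonpos.2 hh0.le) (by linarith)

/-- Supersolutions are excessive for the semigroup. -/
lemma IsViscositySupersolution.driftExt_le (hn : 0 < n)
    (hsup : IsViscositySupersolution b f univ) (hf : Continuous f)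
    (h0 : Tendsto f (cocompact (Euc n)) (𝓝 0)) {p : Euc n × ℝ} (hp : 0 ≤ p.2) :
    driftExt b f p ≤ f p.1 := by
  obtain ⟨M, hM⟩ := exists_bound_of_tendsto_cocompact hf h0
  by_contra! hlt
  have hp0 : 0 < p.2 := by
    rcases hp.eq_or_lt with h | h
    · have := driftExt_zero_right (b := b) (f := f) p.1
      rw [show (p.1, (0 : ℝ)) = p from Prod.ext rfl h] at this
      linarith
    · exact h
  -- Subtracting `ε s` keeps half of the excess at `p` and makes the final inequality strict.
  set ε := (driftExt b f p - f p.1) / (2 * p.2) with hε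
  have hd0 : 0 < driftExt b f p - f p.1 := by linarith
  have hε0 : 0 < ε := by positivity
  let F : Euc n × ℝ → ℝ := fun q => driftExt b f q - f q.1 - ε * q.2
  have hFc : Continuous F := by
    have := continuous_driftExt (b := b) hf hM
    fun_prop
  have hFp : 0 < F p := by
    have : ε * p.2 = (driftExt b f p - f p.1) / 2 := by rw [hε]; field_simp
    simp only [F]
    linarith
  obtain ⟨q, hqT, hqp, hqmax⟩ := exists_slab_max hFc (S := p.2) (p := p) ⟨hp, le_rfl⟩ (by
    obtain ⟨R₁, hR₁⟩ := driftExt_slab_decay (b := b) hf h0 p.2 (half_pos hFp)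
    obtain ⟨R₂, hR₂⟩ := exists_bound_outside_of_tendsto h0 (half_pos hFp)
    refine ⟨max R₁ R₂, fun x hx s hs => ?_⟩
    have h1 := le_of_abs_le (hR₁ x ((le_max_left _ _).trans hx) s hs)
    have h2 := neg_le_of_abs_le (hR₂ x ((le_max_right _ _).trans hx))
    have h3 : 0 ≤ ε * s := mul_nonneg hε0.le hs.1
    change driftExt b f (x, s) - f x - ε * s ≤ F p
    linarith)
  obtain ⟨x, s⟩ := q
  simp only at hqT
  have hFq : 0 < F (x, s) := hFp.trans_le hqp
  have hs0 : 0 < s := by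
    rcases hqT.1.eq_or_lt with h | h
    · exfalso
      simp only [F, ← h, driftExt_zero_right] at hFq
      simp at hFq
    · exact h
  set c := -(F (x, s) + ε * s)
  have hψ : ContDiff ℝ 2 (fun y => driftExt b f (y, s) + c) :=
    (contDiff_driftExt_slice hf hM hs0).add contDiff_const
  have key := hsup.nonneg_of_touching hn (x := x) hf hM (M' := M + |c|) hψ
    (fun y => (abs_add_le _ _).trans (by gcongr; exact abs_poissonExt_le hf hM _))
    (by simp only [c, F]; ring)
    (fun y => by
      have h1 := hqmax (y, s) hqT
      have h2 : driftExt b f (y, s) - f y - ε * s ≤ F (x, s) := h1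
      simp only [c]
      linarith)
  rw [halfLaplacian_add_const, fderiv_add_const,
    halfLaplacian_add_fderiv_driftExt hn hf h0 hs0] at key
  have hder := ((hasDerivAt_driftExt (b := b) hf hM x hs0).sub
    ((hasDerivAt_id s).const_mul ε))
  have hge := nonneg_of_hasDerivAt_of_left_max hs0 hder (fun σ hσ => by
    have h1 := hqmax (x, σ) ⟨hσ.1, hσ.2.trans hqT.2⟩
    simp only [F] at h1
    simp only [Pi.sub_apply, id]
    linarith)
  linarith

/-- Barrier for subsolutions: `f` exceeds its evolution by at most `A s χ + C s²`. -/
lemma IsViscositySubsolution.le_driftExt_add (hn : 0 < n) {Ω : Set (Euc n)}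
    (hsub : IsViscositySubsolution b f Ω) (hf : Continuous f)
    (h0 : Tendsto f (cocompact (Euc n)) (𝓝 0)) {χ : Euc n → ℝ} {A C L Mχ : ℝ}
    (hχ : ContDiff ℝ 2 χ) (hχM : ∀ y, |χ y| ≤ Mχ) (hχ0 : ∀ y, 0 ≤ χ y)
    (hL : ∀ y, -L ≤ halfLaplacian χ y + fderiv ℝ χ y b) (hA : 0 ≤ A) (hC0 : 0 ≤ C)
    (hC : A * L < 2 * C) {S : ℝ}
    (hbd : ∀ x ∉ Ω, ∀ s ∈ Icc 0 S, f x - driftExt b f (x, s) ≤ A * s * χ x)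
    {p : Euc n × ℝ} (hp : p.2 ∈ Icc 0 S) :
    f p.1 - driftExt b f p ≤ A * p.2 * χ p.1 + C * p.2 ^ 2 := by
  obtain ⟨M, hM⟩ := exists_bound_of_tendsto_cocompact hf h0
  by_contra! hlt
  let F : Euc n × ℝ → ℝ := fun q => f q.1 - driftExt b f q - A * q.2 * χ q.1 - C * q.2 ^ 2
  have hFc : Continuous F := by
    have := continuous_driftExt (b := b) hf hM
    have := hχ.continuous
    fun_prop
  have hFp : 0 < F p := by
    simp only [F]
    linarith
  obtain ⟨q, hqT, hqp, hqmax⟩ := exists_slab_max hFc (S := S) (p := p) hp (by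
    obtain ⟨R₁, hR₁⟩ := driftExt_slab_decay (b := b) hf h0 S (half_pos hFp)
    obtain ⟨R₂, hR₂⟩ := exists_bound_outside_of_tendsto h0 (half_pos hFp)
    refine ⟨max R₁ R₂, fun x hx s hs => ?_⟩
    have h1 := neg_le_of_abs_le (hR₁ x ((le_max_left _ _).trans hx) s hs)
    have h2 := le_of_abs_le (hR₂ x ((le_max_right _ _).trans hx))
    have h3 : 0 ≤ A * s * χ x := mul_nonneg (mul_nonneg hA hs.1) (hχ0 x)
    have h4 : 0 ≤ C * s ^ 2 := by positivity
    change f x - driftExt b f (x, s) - A * s * χ x - C * s ^ 2 ≤ F p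
    linarith)
  obtain ⟨x, s⟩ := q
  simp only at hqT
  have hFq : 0 < F (x, s) := hFp.trans_le hqp
  have hs0 : 0 < s := by
    rcases hqT.1.eq_or_lt with h | h
    · exfalso
      simp only [F, ← h, driftExt_zero_right] at hFq
      simp at hFq
    · exact h
  -- Off `Ω` the assumed linear bound already gives `F ≤ 0`, so the maximum lies where the
  -- subsolution inequality can be used.
  have hxΩ : x ∈ Ω := by
    by_contra hx
    have h1 := hbd x hx s hqT
    have h4 : 0 ≤ C * s ^ 2 := by positivity
    simp only [F] at hFq
    linarith
  set c := F (x, s) + C * s ^ 2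
  have hψ1 := contDiff_driftExt_slice (b := b) hf hM hs0
  have hψ2 : ContDiff ℝ 2 (fun y => A * s * χ y) := contDiff_const.mul hχ
  have hD1 : ∀ y, |driftExt b f (y, s)| ≤ M := fun y => abs_poissonExt_le hf hM _
  have hD2 : ∀ y, |A * s * χ y| ≤ A * s * Mχ := fun y => by
    rw [abs_mul, abs_of_nonneg (mul_nonneg hA hs0.le)]
    exact mul_le_mul_of_nonneg_left (hχM y) (mul_nonneg hA hs0.le)
  have hψ : ContDiff ℝ 2 (fun y => driftExt b f (y, s) + A * s * χ y + c) :=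
    (hψ1.add hψ2).add contDiff_const
  have key := hsub.nonpos_of_touching hn (x := x) hf hM (M' := M + A * s * Mχ + |c|) hψ
    (fun y => (abs_add_le _ _).trans (by
      gcongr
      exact (abs_add_le _ _).trans (add_le_add (hD1 y) (hD2 y)))) hxΩ
    (by simp only [c, F]; ring)
    (fun y => by
      have h1 := hqmax (y, s) hqT
      have h2 : f y - driftExt b f (y, s) - A * s * χ y - C * s ^ 2 ≤ F (x, s) := h1
      simp only [c]
      linarith)
  have hlap : halfLaplacian (fun y => driftExt b f (y, s) + A * s * χ y) x =
      halfLaplacian (fun y => driftExt b f (y, s)) x + A * s * halfLaplacian χ x := by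
    have i1 := integrable_halfLaplacian hn hψ1.continuous.measurable hD1 hψ1.contDiffAt (x := x)
    have i2 := integrable_halfLaplacian hn hχ.continuous.measurable hχM hχ.contDiffAt (x := x)
    unfold halfLaplacian
    rw [mul_left_comm, ← mul_add, ← integral_const_mul (A * s), ← integral_add i1 (i2.const_mul _)]
    congr 2
    funext z
    ring
  have hfd : fderiv ℝ (fun y => driftExt b f (y, s) + A * s * χ y) x b =
      fderiv ℝ (fun y => driftExt b f (y, s)) x b + A * s * fderiv ℝ χ x b := by
    rw [fderiv_fun_add (hψ1.differentiable (by norm_num) x)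
      (hψ2.differentiable (by norm_num) x),
      fderiv_const_mul (hχ.differentiable (by norm_num) x)]
    simp
  rw [halfLaplacian_add_const, fderiv_add_const, hlap, hfd] at key
  have hflow := halfLaplacian_add_fderiv_driftExt (b := b) hn hf h0 hs0 x
  have hder := (((hasDerivAt_driftExt (b := b) hf hM x hs0).const_sub (f x)).sub
    ((hasDerivAt_id s).const_mul (A * χ x))).sub (((hasDerivAt_id s).pow 2).const_mul C)
  have hge := nonneg_of_hasDerivAt_of_left_max hs0 hder (fun σ hσ => by
    have h1 := hqmax (x, σ) ⟨hσ.1, hσ.2.trans hqT.2⟩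
    simp only [F] at h1
    simp only [Pi.sub_apply, Pi.pow_apply, id]
    linarith)
  simp only [id, mul_one, Nat.cast_ofNat] at hge
  -- With `D` the time derivative of `T_s f` at `x`, maximality in time gives `Aχ + 2Cs ≤ -D` and
  -- the equation gives `-D ≤ AsL`. Together they contradict `AL < 2C`.
  have hLx := mul_le_mul_of_nonneg_left (hL x) (mul_nonneg hA hs0.le)
  have hAχ : 0 ≤ A * χ x := mul_nonneg hA (hχ0 x)
  have hfin := mul_lt_mul_of_pos_right hC hs0
  norm_num at hge
  linarith

end DriftExt

/-! ### Cutoff functions for the barrier. -/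

section Cutoff

variable {n : ℕ}

/-- A smooth cutoff function between a compact set and a neighbourhood of it. -/
lemma exists_cutoff {K : Set (Euc n)} (hK : IsCompact K) {d : ℝ} (hd : 0 < d) :
    ∃ χ : Euc n → ℝ, ContDiff ℝ 2 χ ∧ HasCompactSupport χ ∧ (∀ x, χ x ∈ Icc (0 : ℝ) 1) ∧
      (∀ x ∈ K, χ x = 1) ∧ ∀ x ∉ thickening d K, χ x = 0 := by
  obtain ⟨χ, hχ, hrange, hsupp, hone⟩ := exists_contMDiff_support_eq_eq_one_iff (n := 2)
    (modelWithCornersSelf ℝ (Euc n)) (isOpen_thickening (δ := d) (E := K)) hK.isClosed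
    (self_subset_thickening hd K)
  refine ⟨χ, contMDiff_iff_contDiff.1 hχ, ?_, fun x => hrange (mem_range_self x),
    fun x hx => (hone x).1 hx, fun x hx => ?_⟩
  · refine HasCompactSupport.of_support_subset_isCompact (hK.cthickening (r := d)) ?_
    rw [hsupp]
    exact thickening_subset_cthickening _ _
  · rw [← hsupp] at hx
    exact Function.notMem_support.1 hx

/-- `(-Δ)^{1/2} + b · ∇` maps test functions to bounded functions. -/
lemma exists_bound_halfLaplacian_add_fderiv (hn : 0 < n) (b : Euc n) {χ : Euc n → ℝ}
    (hχ : ContDiff ℝ 2 χ) (hs : HasCompactSupport χ) (h01 : ∀ x, χ x ∈ Icc (0 : ℝ) 1) :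
    ∃ L, 0 ≤ L ∧ ∀ y, -L ≤ halfLaplacian χ y + fderiv ℝ χ y b := by
  obtain ⟨K₁, hK₁⟩ := ContDiff.lipschitzWith_of_hasCompactSupport hs hχ (by norm_num)
  obtain ⟨K₂, hK₂⟩ := ContDiff.lipschitzWith_of_hasCompactSupport (hs.fderiv ℝ)
    (hχ.fderiv_right (m := 1) (by norm_num)) (by norm_num)
  have hM : ∀ y, |χ y| ≤ 1 := fun y => abs_le.2 ⟨by linarith [(h01 y).1], (h01 y).2⟩
  set C : ℝ := K₂ + 2
  have hC : ∀ y z : Euc n, |χ y - (χ (y + z) + χ (y - z)) / 2| ≤ C * min 1 (‖z‖ ^ 2) := by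
    intro y z
    have h1 := abs_second_difference_le (H := χ) (x := y) (z := z) (K := K₂)
      (fun w _ => hχ.differentiable (by norm_num) w)
      (fun w _ => by
        have := hK₂.dist_le_mul w y
        rwa [dist_eq_norm, dist_eq_norm] at this) K₂.2
    have h2 := abs_second_difference_le_of_bound (x := y) hM z
    have h3 : 0 ≤ (K₂ : ℝ) := K₂.2
    rcases le_total 1 (‖z‖ ^ 2) with h | h
    · rw [min_eq_left h]
      simp only [C]
      linarith
    · rw [min_eq_right h]
      simp only [C]
      nlinarith [sq_nonneg ‖z‖]
  set I := ∫ z : Euc n, C * (min 1 (‖z‖ ^ 2) / ‖z‖ ^ (n + 1))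
  have hI0 : 0 ≤ I := integral_nonneg fun z => by positivity
  have hc0 := halfLapConst_pos n
  refine ⟨halfLapConst n * I + K₁ * ‖b‖, by positivity, fun y => ?_⟩
  have e1 : -(halfLapConst n * I) ≤ halfLaplacian χ y := by
    rw [← mul_neg]
    refine mul_le_mul_of_nonneg_left ?_ hc0.le
    rw [← integral_neg]
    refine integral_mono ((integrable_min_one_sq_div hn).const_mul C).neg
      (integrable_halfLaplacian hn hχ.continuous.measurable hM hχ.contDiffAt) fun z => ?_
    simp only
    rw [← mul_div_assoc, ← neg_div]
    gcongr
    exact neg_le_of_abs_le (hC y z)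
  have e2 : -(K₁ * ‖b‖) ≤ fderiv ℝ χ y b := by
    have h1 := (fderiv ℝ χ y).le_of_opNorm_le (norm_fderiv_le_of_lipschitz ℝ hK₁) b
    rw [Real.norm_eq_abs] at h1
    exact neg_le_of_abs_le h1
  linarith

end Cutoff

/-! ### Positivity, the contact set, and size of the defect `u - T_s u`. -/

section Obstacle

variable {n : ℕ} {b : Euc n} {φ u : Euc n → ℝ}

lemma IsObstacleSolution.driftExt_le (hn : 0 < n) (hu : IsObstacleSolution b φ u)
    {p : Euc n × ℝ} (hp : 0 ≤ p.2) : driftExt b u p ≤ u p.1 :=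
  hu.supersolution.driftExt_le hn hu.continuous hu.vanishing hp

/-- `T_s u ≤ u` for every `s`, and `T_s u → 0` as `s → ∞`. -/
lemma IsObstacleSolution.nonneg (hn : 0 < n) (hu : IsObstacleSolution b φ u) (x : Euc n) :
    0 ≤ u x := by
  refine le_of_tendsto (tendsto_poissonExt_atTop hn hu.continuous hu.vanishing x b) ?_
  filter_upwards [eventually_ge_atTop 0] with s hs
  exact hu.driftExt_le hn (p := (x, s)) hs

/-- `T_1 u(x)` averages the nonnegative function `u` against a strictly positive density, and `u ≥ φ
> 0` somewhere. This confines the contact set to `{φ > 0}`. -/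
lemma IsObstacleSolution.pos (hn : 0 < n) (hu : IsObstacleSolution b φ u)
    (hne : {x | 0 < φ x}.Nonempty) (x : Euc n) : 0 < u x := by
  obtain ⟨M, hM⟩ := exists_bound_of_tendsto_cocompact hu.continuous hu.vanishing
  obtain ⟨z, hz⟩ := hne
  refine lt_of_lt_of_le ?_ (hu.driftExt_le hn (p := (x, 1)) zero_le_one)
  have hcont : Continuous (fun y : Euc n => poissonDensity y * u (x - (1 : ℝ) • b - (1 : ℝ) • y)) :=
    continuous_poissonDensity.mul (hu.continuous.comp (by fun_prop))
  have hint := integrable_poissonDensity_mul hu.continuous hM (x - (1 : ℝ) • b, 1)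
  refine integral_pos_of_integrable_nonneg_nonzero (x := x - b - z) hcont hint
    (fun y => mul_nonneg (poissonDensity_pos y).le (hu.nonneg hn _)) ?_
  have h1 : x - (1 : ℝ) • b - (1 : ℝ) • (x - b - z) = z := by
    simp only [one_smul]
    abel
  simp only
  rw [h1]
  exact (mul_pos (poissonDensity_pos _) (lt_of_lt_of_le hz (hu.above z))).ne'

lemma IsObstacleSolution.contact_subset (hn : 0 < n) (hu : IsObstacleSolution b φ u)
    (hne : {x | 0 < φ x}.Nonempty) : {x | u x = φ x} ⊆ {x | 0 < φ x} := fun x hx => by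
  have := hu.pos hn hne x
  rwa [show u x = φ x from hx] at this

lemma IsObstacleSolution.isCompact_contact (hn : 0 < n) (hu : IsObstacleSolution b φ u)
    (hφ : Continuous φ) (hne : {x | 0 < φ x}.Nonempty)
    (hcpt : IsCompact (closure {x | 0 < φ x})) : IsCompact {x | u x = φ x} :=
  hcpt.of_isClosed_subset (isClosed_eq hu.continuous hφ)
    ((hu.contact_subset hn hne).trans subset_closure)

/-- On the contact set the solution decreases at most linearly along the semigroup. -/
lemma IsObstacleSolution.exists_contact_bound (hn : 0 < n) (hu : IsObstacleSolution b φ u)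
    (hφ : IsC11 φ) (hK : IsCompact {x | u x = φ x}) :
    ∃ A, 0 ≤ A ∧ ∀ x ∈ {x | u x = φ x}, ∀ s ∈ Icc (0 : ℝ) 1,
      u x - driftExt b u (x, s) ≤ A * s := by
  obtain ⟨M, hM⟩ := exists_bound_of_tendsto_cocompact hu.continuous hu.vanishing
  have hM0 : 0 ≤ M := (abs_nonneg _).trans (hM 0)
  obtain ⟨hφ1, Λ, hΛ⟩ := hφ
  have hΛ0 : (0 : ℝ) ≤ Λ := Λ.2
  obtain ⟨G, hG⟩ := hK.exists_bound_of_continuousOn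
    (hφ1.continuous_fderiv (by norm_num)).continuousOn
  have hc0 := halfLapConst_pos n
  -- `C₁` pays for recentring the second difference from `x` to `x - s b`: a gradient term, and a
  -- quadratic term reduced to first order by `s² ≤ s`. In `C₂`, `2Λ` handles `|w| ≤ 1` and `M`
  -- handles `|w| ≥ 1`.
  set C₁ : ℝ := max G 0 * ‖b‖ + 2 * Λ * ‖b‖ ^ 2
  have hC₁ : 0 ≤ C₁ := by positivity
  set C₂ : ℝ := 2 * Λ + M
  set I := ∫ z : Euc n, halfLapConst n * (C₂ * (min 1 (‖z‖ ^ 2) / ‖z‖ ^ (n + 1)))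
  have hI0 : 0 ≤ I := integral_nonneg fun z => by positivity
  refine ⟨C₁ + I, by positivity, fun x hx s hs => ?_⟩
  rcases hs.1.eq_or_lt with h0 | h0
  · rw [← h0, driftExt_zero_right]
    simp
  have hxφ : u x = φ x := hx
  set η : Euc n → ℝ := fun w => C₂ * min 1 (‖w‖ ^ 2) with hη
  have hηc : Continuous η := by fun_prop
  have hηM : ∀ w, |η w| ≤ C₂ := fun w => by
    rw [abs_of_nonneg (by positivity)]
    have : C₂ * min 1 (‖w‖ ^ 2) ≤ C₂ * 1 := by gcongr; exact min_le_left _ _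
    linarith
  -- At a contact point `u x = φ x` and `u ≥ φ` elsewhere, so for `|w| ≤ 1` the `C^{1,1}` Taylor
  -- bound for `φ` suffices. For `|w| ≥ 1` only `0 ≤ u ≤ M` is used.
  have hpt : ∀ w : Euc n, u x - (u (x - s • b + w) + u (x - s • b - w)) / 2 ≤ C₁ * s + η w := by
    intro w
    have hbd : u x - (u (x - s • b + w) + u (x - s • b - w)) / 2 ≤ M := by
      have h1 := hu.nonneg hn (x - s • b + w)
      have h2 := hu.nonneg hn (x - s • b - w)
      have h3 := le_of_abs_le (hM x)
      linarith
    rcases le_total 1 (‖w‖ ^ 2) with h | h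
    · simp only [hη, min_eq_left h, C₂]
      have : 0 ≤ C₁ * s := mul_nonneg hC₁ h0.le
      linarith
    · have htay : ∀ h : Euc n, |φ (x + h) - φ x - fderiv ℝ φ x h| ≤ Λ * ‖h‖ ^ 2 := fun h =>
        taylor_le_of_fderiv_lipschitz (fun y _ => hφ1.differentiable (by norm_num) y)
          (fun y _ => by
            have := hΛ.dist_le_mul y x
            rwa [dist_eq_norm, dist_eq_norm] at this) hΛ0
      have t1 := neg_le_of_abs_le (htay (-(s • b) + w))
      have t2 := neg_le_of_abs_le (htay (-(s • b) - w))
      have hnorm : ∀ a c : Euc n, ‖a + c‖ ^ 2 ≤ 2 * ‖a‖ ^ 2 + 2 * ‖c‖ ^ 2 := by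
        intro a c
        have h1 := norm_add_le a c
        have h2 := norm_nonneg (a + c)
        nlinarith [sq_nonneg (‖a‖ - ‖c‖)]
      have hsb : ‖-(s • b)‖ ^ 2 ≤ s * ‖b‖ ^ 2 := by
        rw [norm_neg, norm_smul, mul_pow, Real.norm_of_nonneg h0.le]
        gcongr
        nlinarith [hs.2]
      have n1 := hnorm (-(s • b)) w
      have n2 := hnorm (-(s • b)) (-w)
      rw [norm_neg w, ← sub_eq_add_neg] at n2
      have p1 : Λ * ‖-(s • b) + w‖ ^ 2 ≤ Λ * (2 * (s * ‖b‖ ^ 2) + 2 * ‖w‖ ^ 2) := by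
        gcongr; linarith
      have p2 : Λ * ‖-(s • b) - w‖ ^ 2 ≤ Λ * (2 * (s * ‖b‖ ^ 2) + 2 * ‖w‖ ^ 2) := by
        gcongr; linarith
      have hlin : fderiv ℝ φ x b ≤ max G 0 * ‖b‖ := by
        have h1 := (fderiv ℝ φ x).le_of_opNorm_le ((hG x hx).trans (le_max_left G 0)) b
        rw [Real.norm_eq_abs] at h1
        exact le_of_abs_le h1
      have hlin' := mul_le_mul_of_nonneg_left hlin h0.le
      have a1 := hu.above (x - s • b + w)
      have a2 := hu.above (x - s • b - w)
      rw [← add_assoc, ← sub_eq_add_neg] at t1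
      rw [add_sub_assoc' , ← sub_eq_add_neg] at t2
      simp only [map_add, map_sub, map_neg, map_smul, smul_eq_mul] at t1 t2
      simp only [hη, min_eq_right h, C₁, C₂]
      have hMw : 0 ≤ M * ‖w‖ ^ 2 := by positivity
      rw [hxφ]
      nlinarith
  have e1 : u x - driftExt b u (x, s) =
      ∫ y : Euc n, poissonDensity y *
        (u x - (u (x - s • b + s • y) + u (x - s • b - s • y)) / 2) := by
    have hi1 : Integrable (fun y : Euc n => poissonDensity y * u x) :=
      (integrable_poissonDensity n).mul_const _
    have hi2 : Integrable (fun y : Euc n =>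
        poissonDensity y * ((u (x - s • b + s • y) + u (x - s • b - s • y)) / 2)) := by
      have ha := integrable_poissonDensity_mul hu.continuous hM (x - s • b, s)
      have hb := integrable_poissonDensity_mul hu.continuous hM (x - s • b, -s)
      refine ((hb.add ha).div_const 2).congr (Eventually.of_forall fun y => ?_)
      simp
      ring
    have e2 : u x = ∫ y : Euc n, poissonDensity y * u x := by
      rw [integral_mul_const, integral_poissonDensity, one_mul]
    rw [driftExt, poissonExt_eq_symm hu.continuous hM]
    nth_rewrite 1 [e2]
    simp only
    rw [← integral_sub hi1 hi2]
    congr 1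
    funext y
    ring
  have hiL : Integrable (fun y : Euc n => poissonDensity y *
      (u x - (u (x - s • b + s • y) + u (x - s • b - s • y)) / 2)) := by
    refine ((integrable_poissonDensity n).mul_const (2 * M)).mono' ?_
      (Eventually.of_forall fun y => ?_)
    · refine (continuous_poissonDensity.mul (continuous_const.sub ?_)).aestronglyMeasurable
      exact ((hu.continuous.comp (by fun_prop)).add (hu.continuous.comp (by fun_prop))).div_const 2
    · rw [norm_mul, Real.norm_of_nonneg (poissonDensity_pos y).le]
      refine mul_le_mul_of_nonneg_left ?_ (poissonDensity_pos y).le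
      have h1 := abs_le.1 (hM x)
      have h2 := abs_le.1 (hM (x - s • b + s • y))
      have h3 := abs_le.1 (hM (x - s • b - s • y))
      rw [Real.norm_eq_abs, abs_le]
      constructor <;> linarith [h1.1, h1.2, h2.1, h2.2, h3.1, h3.2]
  have hη0 : Integrable (fun y : Euc n => poissonDensity y * η (s • y)) := by
    have := integrable_poissonDensity_mul hηc hηM (0, -s)
    simpa using this
  have hiR : Integrable (fun y : Euc n => poissonDensity y * (C₁ * s + η (s • y))) := by
    simp_rw [mul_add]
    exact ((integrable_poissonDensity n).mul_const _).add hη0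
  have e3 : ∫ y : Euc n, poissonDensity y * (C₁ * s + η (s • y)) =
      C₁ * s + ∫ z : Euc n, halfSpaceKernel (z, s) * η z := by
    simp_rw [mul_add]
    rw [integral_add ((integrable_poissonDensity n).mul_const _) hη0, integral_mul_const,
      integral_poissonDensity, one_mul, integral_comp_smul_poissonDensity h0]
  -- The kernel at height `s` is at most a constant times `s |z|^{-(n+1)}`, which `η` makes
  -- integrable with total of order `s`.
  have e4 : ∫ z : Euc n, halfSpaceKernel (z, s) * η z ≤ s * I := by
    simp only [I]
    rw [← integral_const_mul]
    refine integral_mono_of_nonneg (Eventually.of_forall fun z => ?_)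
      ((((integrable_min_one_sq_div hn).const_mul C₂).const_mul _).const_mul s)
      (Eventually.of_forall fun z => ?_)
    · simp only [halfSpaceKernel, hη, Pi.zero_apply]
      positivity
    · simp only [halfSpaceKernel, hη]
      by_cases hz : z = 0
      · simp [hz]
      · have hz0 : 0 < ‖z‖ := norm_pos_iff.2 hz
        have e5 : (‖z‖ ^ 2 + s ^ 2) ^ (-(((n : ℝ) + 1) / 2)) ≤ (‖z‖ ^ (n + 1))⁻¹ := by
          rw [← rpow_half_eq_norm_pow z hz]
          refine Real.rpow_le_rpow_of_nonpos (by positivity) (by nlinarith) ?_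
          have : 0 ≤ ((n : ℝ) + 1) / 2 := by positivity
          linarith
        calc halfLapConst n * s * (‖z‖ ^ 2 + s ^ 2) ^ (-(((n : ℝ) + 1) / 2)) *
              (C₂ * min 1 (‖z‖ ^ 2))
            ≤ halfLapConst n * s * (‖z‖ ^ (n + 1))⁻¹ * (C₂ * min 1 (‖z‖ ^ 2)) := by gcongr
          _ = _ := by ring
  have e6 := integral_mono hiL hiR fun y =>
    mul_le_mul_of_nonneg_left (hpt (s • y)) (poissonDensity_pos y).le
  rw [e1]
  rw [e3] at e6
  linarith

/-- The defect `u - T_s u` is of order `s` near the contact set and of order `s²` elsewhere. -/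
lemma IsObstacleSolution.exists_defect_bound (hn : 0 < n) (hu : IsObstacleSolution b φ u)
    (hφ : IsC11 φ) (hK : IsCompact {x | u x = φ x}) {d : ℝ} (hd : 0 < d) :
    ∃ C, 0 ≤ C ∧ ∀ x ∉ thickening d {x | u x = φ x}, ∀ s ∈ Icc (0 : ℝ) 1,
      u x - driftExt b u (x, s) ≤ C * s ^ 2 := by
  obtain ⟨A, hA0, hA⟩ := hu.exists_contact_bound (b := b) hn hφ hK
  obtain ⟨χ, hχ, hχs, hχ01, hχ1, hχ0⟩ := exists_cutoff hK hd
  obtain ⟨L, hL0, hL⟩ := exists_bound_halfLaplacian_add_fderiv hn b hχ hχs hχ01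
  refine ⟨A * L + 1, by positivity, fun x hx s hs => ?_⟩
  -- The cutoff equals `1` on the contact set, where the linear term is needed, and vanishes off the
  -- thickening, where only `C s²` remains. The choice `C = A L + 1` meets `A L < 2 C`.
  have h := hu.subsolution.le_driftExt_add hn hu.continuous hu.vanishing (A := A)
    (C := A * L + 1) (S := 1) hχ (Mχ := 1)
    (fun y => abs_le.2 ⟨by linarith [(hχ01 y).1], (hχ01 y).2⟩) (fun y => (hχ01 y).1) hL hA0
    (by positivity) (by nlinarith [mul_nonneg hA0 hL0]) (fun y hy σ hσ => by
      have hyK : y ∈ {x | u x = φ x} := le_antisymm (not_lt.1 hy) (hu.above y)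
      rw [hχ1 y hyK, mul_one]
      exact hA y hyK σ hσ) (p := (x, s)) hs
  simp only [hχ0 x hx, mul_zero, zero_add] at h
  exact h

end Obstacle

/-! ### Positivity of `(Δ + ∂²_{bb}) U` away from the contact set. -/

section Elliptic

variable {n : ℕ} {b : Euc n} {φ u : Euc n → ℝ}

/-- The difference quotient `(u - T_s u) / s` along the semigroup. -/
noncomputable def driftQuotient (b : Euc n) (u : Euc n → ℝ) (s : ℝ) (y : Euc n) : ℝ :=
  s⁻¹ * (u y - driftExt b u (y, s))

lemma continuous_driftQuotient {M : ℝ} (hu : Continuous u) (hM : ∀ x, |u x| ≤ M) (s : ℝ) :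
    Continuous (driftQuotient b u s) := by
  have := continuous_driftExt (b := b) hu hM
  unfold driftQuotient
  fun_prop

lemma abs_driftQuotient_le {M : ℝ} (hu : Continuous u) (hM : ∀ x, |u x| ≤ M) (s : ℝ) (y : Euc n) :
    |driftQuotient b u s y| ≤ |s⁻¹| * (2 * M) := by
  unfold driftQuotient
  rw [abs_mul]
  gcongr
  have h1 := abs_le.1 (hM y)
  have h2 : |driftExt b u (y, s)| ≤ M := abs_poissonExt_le hu hM _
  have h3 := abs_le.1 h2
  rw [abs_le]
  constructor <;> linarith [h1.1, h1.2, h3.1, h3.2]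

/-- Extension commutes with translations and composes with itself as a semigroup, so extending `T_s
u` shifts `U` by `s(-b, 1)`. As `s → 0` the right-hand side tends to `-(∂_t - ∂_b)U` at interior
points. -/
lemma poissonExt_driftQuotient (hu : Continuous u) (h0 : Tendsto u (cocompact (Euc n)) (𝓝 0))
    {s : ℝ} (hs : 0 ≤ s) {q : Euc n × ℝ} (hq : 0 ≤ q.2) :
    poissonExt (driftQuotient b u s) q =
      s⁻¹ * (poissonExt u q - poissonExt u (q + s • (-b, 1))) := by
  obtain ⟨M, hM⟩ := exists_bound_of_tendsto_cocompact hu h0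
  have hc : Continuous (fun y => driftExt b u (y, s)) :=
    (continuous_driftExt hu hM).comp (by fun_prop)
  have h1 : poissonExt (fun y => driftExt b u (y, s)) q = poissonExt u (q + s • (-b, 1)) := by
    have h2 := poissonExt_comp_sub (f := fun x => poissonExt u (x, s)) (s • b) q
    rw [poissonExt_semigroup hu h0 hs (q := (q.1 - s • b, q.2)) hq] at h2
    refine h2.trans ?_
    congr 1
    ext1 <;> simp [sub_eq_add_neg]
  unfold driftQuotient
  rw [poissonExt_const_mul, poissonExt_sub hu hM hc (fun y => abs_poissonExt_le hu hM _), h1]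

lemma fderiv_poissonExt_driftQuotient (hu : Continuous u)
    (h0 : Tendsto u (cocompact (Euc n)) (𝓝 0)) {s : ℝ} (hs : 0 ≤ s) {q : Euc n × ℝ} (hq : 0 < q.2)
    (w : Euc n × ℝ) :
    fderiv ℝ (poissonExt (driftQuotient b u s)) q w =
      s⁻¹ * (fderiv ℝ (poissonExt u) q w - fderiv ℝ (poissonExt u) (q + s • (-b, 1)) w) := by
  obtain ⟨M, hM⟩ := exists_bound_of_tendsto_cocompact hu h0
  have h1 : poissonExt (driftQuotient b u s) =ᶠ[𝓝 q] fun p =>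
      s⁻¹ * (poissonExt u p - poissonExt u (p + s • (-b, 1))) := by
    filter_upwards [eventually_snd_pos hq] with p hp
    exact poissonExt_driftQuotient hu h0 hs (le_of_lt hp)
  have hq' : 0 < (q + s • (-b, (1 : ℝ))).2 := by
    simpa using add_pos_of_pos_of_nonneg hq hs
  have h2 := hasFDerivAt_poissonExt' hu hM hq
  have h3 : HasFDerivAt (fun p => poissonExt u (p + s • (-b, 1)))
      (fderiv ℝ (poissonExt u) (q + s • (-b, 1))) q := by
    have := HasFDerivAt.comp (f := fun p : Euc n × ℝ => p + s • (-b, (1 : ℝ))) q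
      (hasFDerivAt_poissonExt' hu hM hq') ((hasFDerivAt_id q).add_const _)
    rwa [ContinuousLinearMap.comp_id] at this
  rw [h1.fderiv_eq, ((h2.fun_sub h3).const_mul s⁻¹).fderiv]
  simp

lemma integral_halfSpaceKernel_sub {q : Euc n × ℝ} (hq : 0 < q.2) :
    ∫ y : Euc n, halfSpaceKernel (q - (y, 0)) = 1 := by
  have h1 := poissonExt_eq_kernelInt (f := fun _ => (1 : ℝ)) hq
  simpa [poissonExt, kernelInt, integral_poissonDensity] using h1.symm

/-- Mean value theorem along `s ↦ (-s b, s)`: `U` starts at `u 0 > 0` and tends to `0`. This is the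
evidence that the limiting measure is nonzero. -/
lemma IsObstacleSolution.exists_fderiv_neg (hn : 0 < n) (hu : IsObstacleSolution b φ u)
    (hne : {x | 0 < φ x}.Nonempty) :
    ∃ q : Euc n × ℝ, 0 < q.2 ∧ fderiv ℝ (poissonExt u) q (-b, 1) < 0 := by
  obtain ⟨M, hM⟩ := exists_bound_of_tendsto_cocompact hu.continuous hu.vanishing
  have hpos := hu.pos hn hne 0
  have hlim := tendsto_poissonExt_atTop hn hu.continuous hu.vanishing 0 b
  obtain ⟨S, hS, hS0⟩ := ((hlim.eventually_lt_const hpos).and (eventually_gt_atTop 0)).exists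
  have hcont : ContinuousOn (fun σ : ℝ => driftExt b u (0, σ)) (Icc 0 S) :=
    ((continuous_driftExt hu.continuous hM).comp (by fun_prop)).continuousOn
  obtain ⟨s, hs, hslope⟩ := exists_hasDerivAt_eq_slope (fun σ : ℝ => driftExt b u (0, σ)) _ hS0
    hcont (fun s hs => hasDerivAt_driftExt (b := b) hu.continuous hM 0 hs.1)
  refine ⟨(0 - s • b, s), hs.1, ?_⟩
  rw [hslope, driftExt_zero_right]
  refine div_neg_of_neg_of_pos ?_ (by linarith)
  have : driftExt b u (0, S) < u 0 := hS
  linarith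

/-- Strict positivity of `(Δ + ∂²_{bb}) U` close to the boundary, away from the contact set. -/
lemma IsObstacleSolution.exists_elliptic_lower_bound (hn : 0 < n) (hu : IsObstacleSolution b φ u)
    (hφ : IsC11 φ) (hne : {x | 0 < φ x}.Nonempty) (hK : IsCompact {x | u x = φ x}) (R₀ : ℝ) :
    ∃ c > 0, ∀ d : ℝ, 0 < d → d ≤ 1 → ∃ t₀ > 0, ∀ t : ℝ, 0 < t → t < t₀ →
      ∀ x : Euc n, ‖x‖ ≤ R₀ → (∀ y ∈ thickening d {x | u x = φ x}, d ≤ ‖x - y‖) →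
      c ≤ ∑ i, fderiv ℝ (fderiv ℝ (poissonExt u)) (x, t) (EuclideanSpace.basisFun (Fin n) ℝ i, 0)
        (EuclideanSpace.basisFun (Fin n) ℝ i, 0) +
        fderiv ℝ (fderiv ℝ (poissonExt u)) (x, t) (b, 0) (b, 0) := by
  obtain ⟨M, hM⟩ := exists_bound_of_tendsto_cocompact hu.continuous hu.vanishing
  have hc := hu.continuous
  obtain ⟨q, hq0, hq⟩ := hu.exists_fderiv_neg (b := b) hn hne
  set W := -fderiv ℝ (poissonExt u) q (-b, 1) with hW
  have hW0 : 0 < W := by linarith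
  obtain ⟨P, hP0, hP⟩ : ∃ P, 0 < P ∧ ∀ y : Euc n, halfSpaceKernel (q - (y, 0)) ≤ P := by
    obtain ⟨ε, hε, C, hC⟩ := poissonDecay_halfSpaceKernel q hq0
    refine ⟨|C| + 1, by positivity, fun y => (le_abs_self _).trans ?_⟩
    refine ((hC q (mem_ball_self hε)).2 y).trans ?_
    have h1 : (1 + ‖y‖) ^ (-((n : ℝ) + 1)) ≤ 1 :=
      Real.rpow_le_one_of_one_le_of_nonpos (by linarith [norm_nonneg y])
        (by have : (0 : ℝ) ≤ n := Nat.cast_nonneg n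
            linarith)
    calc C * (1 + ‖y‖) ^ (-((n : ℝ) + 1)) ≤ |C| * 1 := by
          gcongr
          exact le_abs_self C
      _ ≤ |C| + 1 := by linarith
  obtain ⟨RK, hRK⟩ := hK.isBounded.subset_closedBall (0 : Euc n)
  set R : ℝ := |R₀| + |RK| + 1 with hR
  have hR0 : 0 < R := by positivity
  set κ := halfLapConst n / 2 * (R ^ 2 + 1) ^ (-(((n : ℝ) + 1) / 2))
  have hκ : 0 < κ := by
    have := halfLapConst_pos n
    positivity
  -- The constant is independent of `d`: `W` and `P` come from the fixed point `q`, and `κ` from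
  -- `R`, which bounds the distances to every thickening with `d ≤ 1`. Only `t₀` depends on `d`.
  refine ⟨κ * (W / (4 * P)), by positivity, fun d hd hd1 => ?_⟩
  obtain ⟨t₀, ht₀, hker⟩ := exists_le_fderiv_halfSpaceKernel b hd hR0
  refine ⟨t₀, ht₀, fun t ht htt x hx hxd => ?_⟩
  obtain ⟨C, hC0, hC⟩ := hu.exists_defect_bound (b := b) hn hφ hK hd
  set N := thickening d {x | u x = φ x}
  have hNm : MeasurableSet N := isOpen_thickening.measurableSet
  have hNb : Bornology.IsBounded N := hK.isBounded.thickening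
  have hNR : ∀ y ∈ N, ‖x - y‖ ≤ R := by
    intro y hy
    obtain ⟨z, hz, hyz⟩ := mem_thickening_iff.1 hy
    have h1 : ‖z‖ ≤ RK := by simpa using hRK hz
    have h2 : ‖y‖ ≤ ‖y - z‖ + ‖z‖ := by simpa using norm_add_le (y - z) z
    rw [dist_eq_norm] at hyz
    have h3 := norm_sub_le x y
    linarith [le_abs_self R₀, le_abs_self RK]
  have hg0 : ∀ s : ℝ, 0 < s → ∀ y, 0 ≤ driftQuotient b u s y := fun s hs y =>
    mul_nonneg (inv_nonneg.2 hs.le) (sub_nonneg.2 (hu.driftExt_le hn (p := (y, s)) hs.le))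
  have hgC : ∀ s : ℝ, 0 < s → s ≤ 1 → ∀ y ∉ N, driftQuotient b u s y ≤ C * s := by
    intro s hs hs1 y hy
    have h1 := hC y hy s ⟨hs.le, hs1⟩
    unfold driftQuotient
    rw [inv_mul_le_iff₀ hs]
    linarith
  have hgN : ∀ s, Integrable (N.indicator (driftQuotient b u s)) := by
    intro s
    rw [integrable_indicator_iff hNm]
    refine IntegrableOn.mono_set ?_ subset_closure
    exact (continuous_driftQuotient hc hM s).continuousOn.integrableOn_compact
      hNb.isCompact_closure
  -- At `q` the extended quotient tends to `W`, so it eventually exceeds `W/2`. It is at most `P`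
  -- times the mass over `N` plus `C s`, and `C s < W/4` leaves mass at least `W/(4P)`.
  have hmass : ∀ᶠ s : ℝ in 𝓝[>] 0,
      W / (4 * P) ≤ ∫ y : Euc n, N.indicator (driftQuotient b u s) y := by
    have hlim : Tendsto (fun s : ℝ => poissonExt (driftQuotient b u s) q) (𝓝[>] 0) (𝓝 W) := by
      have h3 : HasFDerivAt (poissonExt u) (fderiv ℝ (poissonExt u) q)
          (q + (0 : ℝ) • (-b, (1 : ℝ))) := by
        simpa using hasFDerivAt_poissonExt' hc hM hq0
      have h4 := (h3.comp_hasDerivAt 0 (hasDerivAt_line q (-b, (1 : ℝ)) 0)).tendsto_slope_zero_right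
      refine h4.neg.congr' ?_
      filter_upwards [self_mem_nhdsWithin] with s hs
      rw [poissonExt_driftQuotient hc hu.vanishing (le_of_lt hs) hq0.le]
      simp only [Function.comp, zero_add, zero_smul, add_zero, smul_eq_mul]
      ring
    have hlim2 : Tendsto (fun s : ℝ => C * s) (𝓝[>] 0) (𝓝 0) := by
      have : Tendsto (fun s : ℝ => C * s) (𝓝 0) (𝓝 (C * 0)) := (continuous_const_mul C).tendsto 0
      rw [mul_zero] at this
      exact this.mono_left nhdsWithin_le_nhds
    have hs1 : ∀ᶠ s : ℝ in 𝓝[>] 0, s ≤ 1 :=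
      nhdsWithin_le_nhds (Iic_mem_nhds one_pos)
    filter_upwards [hlim.eventually_const_lt (half_lt_self hW0),
      hlim2.eventually_lt_const (show (0 : ℝ) < W / 4 by positivity), hs1, self_mem_nhdsWithin]
      with s h1 h2 h3 h4
    have hs0 : (0 : ℝ) < s := h4
    have e1 : poissonExt (driftQuotient b u s) q ≤
        P * (∫ y : Euc n, N.indicator (driftQuotient b u s) y) + C * s * 1 := by
      rw [poissonExt_eq_kernelInt hq0, ← integral_halfSpaceKernel_sub hq0, ← integral_const_mul,
        ← integral_const_mul, kernelInt]
      have hkint : Integrable (fun y : Euc n => halfSpaceKernel (q - (y, 0))) := by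
        have := integrable_kernel (f := fun _ => (1 : ℝ)) (M := 1) poissonDecay_halfSpaceKernel
          (fun p hp => (differentiableAt_halfSpaceKernel hp).continuousAt) continuous_const
          (by simp) hq0
        simpa using this
      rw [← integral_add ((hgN s).const_mul P) (hkint.const_mul _)]
      refine integral_mono (integrable_kernel poissonDecay_halfSpaceKernel
          (fun p hp => (differentiableAt_halfSpaceKernel hp).continuousAt)
          (continuous_driftQuotient hc hM s) (abs_driftQuotient_le hc hM s) hq0)
          (((hgN s).const_mul P).add (hkint.const_mul _)) fun y => ?_
      have hk0 : 0 ≤ halfSpaceKernel (q - (y, 0)) := by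
        have := halfLapConst_pos n
        unfold halfSpaceKernel
        simp only [Prod.snd_sub, sub_zero]
        positivity
      have hCs : 0 ≤ C * s := by positivity
      by_cases hy : y ∈ N
      · rw [indicator_of_mem hy, smul_eq_mul]
        have := mul_le_mul_of_nonneg_left (hP y) (hg0 s hs0 y)
        have := mul_nonneg hCs hk0
        linarith
      · rw [indicator_of_notMem hy, smul_eq_mul, mul_zero, zero_add]
        exact mul_le_mul_of_nonneg_right (hgC s hs0 h3 y hy) hk0
    rw [div_le_iff₀ (by positivity)]
    linarith
  have hxt : ContDiffAt ℝ 2 (poissonExt u) (x, t) := contDiffAt_poissonExt hc hM ht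
  set D2 := fderiv ℝ (fderiv ℝ (poissonExt u)) (x, t) with hD2
  set J := ∫ y : Euc n, ‖fderiv ℝ (halfSpaceKernel (n := n)) ((x, t) - (y, 0)) (b, 1)‖
  have hkint : Integrable
      (fun y : Euc n => fderiv ℝ (halfSpaceKernel (n := n)) ((x, t) - (y, 0)) (b, 1)) := by
    have := integrable_kernel (f := fun _ => (1 : ℝ)) (M := 1) poissonDecay_fderiv_halfSpaceKernel
      (fun p hp => (contDiffAt_fderiv_halfSpaceKernel hp (k := 0)).continuousAt) continuous_const
      (by simp) (q := (x, t)) ht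
    simp only [one_smul] at this
    exact this.apply_continuousLinearMap (b, 1)
  -- Over `N` the kernel derivative is at least `κ` and the quotient is nonnegative. Off `N` its
  -- sign is unknown, but the quotient is at most `C s`, so the loss is at most `C s J`.
  have hlow : ∀ᶠ s : ℝ in 𝓝[>] 0, κ * (W / (4 * P)) - C * s * J ≤
      fderiv ℝ (poissonExt (driftQuotient b u s)) (x, t) (b, 1) := by
    have hs1 : ∀ᶠ s : ℝ in 𝓝[>] 0, s ≤ 1 :=
      nhdsWithin_le_nhds (Iic_mem_nhds one_pos)
    filter_upwards [hmass, hs1, self_mem_nhdsWithin] with s h1 h2 h3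
    have hs0 : (0 : ℝ) < s := h3
    have hgc := continuous_driftQuotient (b := b) hc hM s
    have hgM := abs_driftQuotient_le (b := b) hc hM s
    rw [fderiv_poissonExt_apply hgc hgM ht]
    have hfint : Integrable (fun y : Euc n => driftQuotient b u s y *
        fderiv ℝ (halfSpaceKernel (n := n)) ((x, t) - (y, 0)) (b, 1)) :=
      (integrable_kernel poissonDecay_fderiv_halfSpaceKernel
        (fun p hp => (contDiffAt_fderiv_halfSpaceKernel hp (k := 0)).continuousAt) hgc hgM
        (q := (x, t)) ht).apply_continuousLinearMap (b, 1)
    have e1 : κ * (∫ y : Euc n, N.indicator (driftQuotient b u s) y) - C * s * J ≤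
        ∫ y : Euc n, driftQuotient b u s y *
          fderiv ℝ (halfSpaceKernel (n := n)) ((x, t) - (y, 0)) (b, 1) := by
      rw [← integral_const_mul, ← integral_const_mul,
        ← integral_sub ((hgN s).const_mul κ) (hkint.norm.const_mul _)]
      refine integral_mono (((hgN s).const_mul κ).sub (hkint.norm.const_mul _)) hfint fun y => ?_
      have hCs : 0 ≤ C * s := by positivity
      simp only
      set Dy := fderiv ℝ (halfSpaceKernel (n := n)) ((x, t) - (y, 0)) (b, 1) with hDy
      have hn0 := norm_nonneg Dy
      by_cases hy : y ∈ N
      · rw [indicator_of_mem hy]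
        have h5 : κ ≤ Dy := by
          have := hker t ht htt (x - y) (hxd y hy) (hNR y hy)
          simpa [hDy] using this
        have h6 := mul_le_mul_of_nonneg_left h5 (hg0 s hs0 y)
        have h7 := mul_nonneg hCs hn0
        linarith
      · rw [indicator_of_notMem hy, mul_zero, zero_sub]
        have h5 := mul_le_mul_of_nonneg_right (hgC s hs0 h2 y hy) hn0
        have h6 : -‖Dy‖ ≤ Dy := neg_abs_le Dy
        have h7 := mul_le_mul_of_nonneg_left h6 (hg0 s hs0 y)
        linarith
    have e2 := mul_le_mul_of_nonneg_left h1 hκ.le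
    linarith
  have hlim : Tendsto (fun s : ℝ => fderiv ℝ (poissonExt (driftQuotient b u s)) (x, t) (b, 1))
      (𝓝[>] 0) (𝓝 (-D2 (-b, 1) (b, 1))) := by
    have h4 := (hxt.hasDerivAt_fderiv_line (-b, 1) (b, 1)).tendsto_slope_zero_right
    refine h4.neg.congr' ?_
    filter_upwards [self_mem_nhdsWithin] with s hs
    rw [fderiv_poissonExt_driftQuotient hc hu.vanishing (le_of_lt hs) ht]
    simp
    ring
  have hlim2 : Tendsto (fun s : ℝ => κ * (W / (4 * P)) - C * s * J) (𝓝[>] 0)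
      (𝓝 (κ * (W / (4 * P)))) := by
    have : Continuous (fun s : ℝ => κ * (W / (4 * P)) - C * s * J) := by fun_prop
    have := this.tendsto 0
    simp only [mul_zero, zero_mul, sub_zero] at this
    exact this.mono_left nhdsWithin_le_nhds
  have hfin := le_of_tendsto_of_tendsto hlim2 hlim hlow
  -- Symmetry cancels the mixed terms in `-D2 (-b, 1) (b, 1)`, leaving `∂_bb U - ∂_tt U`;
  -- harmonicity replaces `-∂_tt U` by the horizontal Laplacian.
  have hsymm : D2 (b, 0) (0, 1) = D2 (0, 1) (b, 0) :=
    (hxt.isSymmSndFDerivAt (by simp)).eq _ _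
  have hharm := poissonExt_harmonic hc hM (q := (x, t)) ht
  rw [← hD2] at hharm
  have e1 : ((-b, 1) : Euc n × ℝ) = (0, 1) - (b, 0) := by ext1 <;> simp
  have e2 : ((b, 1) : Euc n × ℝ) = (0, 1) + (b, 0) := by ext1 <;> simp
  rw [e1, e2] at hfin
  simp only [map_sub, map_add, sub_apply] at hfin
  linarith

end Elliptic

/-! ### The obstacle inequality in the viscosity sense. -/

section Touching

variable {n : ℕ} {b : Euc n} {φ : Euc n → ℝ}

/-- Second order Taylor expansion with Peano remainder. -/
lemma ContDiffAt.eventually_taylor_two {V : Type*} [NormedAddCommGroup V] [NormedSpace ℝ V]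
    {ψ : V → ℝ} {y : V} (hψ : ContDiffAt ℝ 2 ψ y) {ε : ℝ} (hε : 0 < ε) :
    ∀ᶠ x in 𝓝 y, |ψ x - ψ y - fderiv ℝ ψ y (x - y) -
      1 / 2 * fderiv ℝ (fderiv ℝ ψ) y (x - y) (x - y)| ≤ ε * ‖x - y‖ ^ 2 := by
  set B := fderiv ℝ (fderiv ℝ ψ) y with hB
  have hsymm : ∀ v w, B v w = B w v := fun v w => (hψ.isSymmSndFDerivAt (by simp)).eq v w
  let r : V → ℝ := fun x => ψ x - fderiv ℝ ψ y (x - y) - 1 / 2 * B (x - y) (x - y)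
  have hr : ∀ x, DifferentiableAt ℝ ψ x →
      HasFDerivAt r (fderiv ℝ ψ x - fderiv ℝ ψ y - B (x - y)) x := by
    intro x hx
    have h1 : HasFDerivAt (fun x : V => x - y) (ContinuousLinearMap.id ℝ V) x :=
      (hasFDerivAt_id x).sub_const y
    have h2 := (fderiv ℝ ψ y).hasFDerivAt.comp x h1
    have h3 : HasFDerivAt (fun x => B (x - y)) (B.comp (ContinuousLinearMap.id ℝ V)) x :=
      B.hasFDerivAt.comp x h1
    have h4 := (h3.clm_apply h1).const_mul (1 / 2)
    refine ((hx.hasFDerivAt.sub h2).sub h4).congr_fderiv ?_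
    ext v
    simp
    rw [hsymm v x, hsymm v y]
    ring
  have hd := hψ.differentiableAt_fderiv_two.hasFDerivAt.isLittleO.def hε
  obtain ⟨ρ, hρ, hball⟩ := Metric.eventually_nhds_iff_ball.1
    (hd.and hψ.eventually_differentiableAt_two)
  filter_upwards [ball_mem_nhds y hρ] with x hx
  have hx' : ‖x - y‖ < ρ := mem_ball_iff_norm.1 hx
  have hmem : ∀ w, ‖w - y‖ ≤ ‖x - y‖ → w ∈ ball y ρ := fun w hw =>
    mem_ball_iff_norm.2 (hw.trans_lt hx')
  have hry := (hr y (hball y (mem_ball_self hρ)).2).fderiv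
  -- The remainder `r` has zero derivative at `y`, and its derivative nearby is at most `ε |w - y|`,
  -- so the first-order bound gives the second-order expansion.
  have h := taylor_le_of_fderiv_lipschitz (H := r) (x := y) (z := x - y) (K := ε)
    (fun w hw => (hr w (hball w (hmem w hw)).2).differentiableAt)
    (fun w hw => by
      rw [hry, (hr w (hball w (hmem w hw)).2).fderiv]
      simpa using (hball w (hmem w hw)).1) hε.le
  rw [hry] at h
  simp [r] at h
  rw [show ψ x - ψ y - fderiv ℝ ψ y (x - y) - 1 / 2 * B (x - y) (x - y) =
    ψ x - (fderiv ℝ ψ y) (x - y) - 2⁻¹ * B (x - y) (x - y) - ψ y by ring]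
  simpa using h

/-- A `C^{1,1}` function that satisfies the differential inequality almost everywhere cannot be
touched strictly from below by a quadratic polynomial violating it. -/
lemma quadratic_touching_ae (hφ : IsC11 φ) (hsup : IsSuperharmonicAlong b φ {x | 0 < φ x})
    {y : Euc n} (hy : 0 < φ y) {Q : Euc n →L[ℝ] Euc n →L[ℝ] ℝ} (hQ : ∀ v w, Q v w = Q w v)
    {l : Euc n →L[ℝ] ℝ} {ε : ℝ} (hε : 0 < ε)
    (htouch : ∀ᶠ x in 𝓝 y,
      φ y + l (x - y) + 1 / 2 * Q (x - y) (x - y) + ε * ‖x - y‖ ^ 2 ≤ φ x) :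
    ∑ i, Q (EuclideanSpace.basisFun (Fin n) ℝ i) (EuclideanSpace.basisFun (Fin n) ℝ i) + Q b b
      ≤ 0 := by
  by_contra! hS
  set S := ∑ i, Q (EuclideanSpace.basisFun (Fin n) ℝ i) (EuclideanSpace.basisFun (Fin n) ℝ i) +
    Q b b with hSdef
  obtain ⟨hφ1, Λ, hΛ⟩ := hφ
  have hφd : Differentiable ℝ φ := hφ1.differentiable (by norm_num)
  obtain ⟨ρ, hρ, hball⟩ := Metric.eventually_nhds_iff_ball.1
    (htouch.and ((isOpen_lt continuous_const hφ1.continuous).mem_nhds hy))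
  let f : Euc n → ℝ := fun x => φ x - φ y - l (x - y) - 1 / 2 * Q (x - y) (x - y)
  have hf : ∀ x, HasFDerivAt f (fderiv ℝ φ x - l - Q (x - y)) x := by
    intro x
    have h1 : HasFDerivAt (fun x : Euc n => x - y) (ContinuousLinearMap.id ℝ (Euc n)) x :=
      (hasFDerivAt_id x).sub_const y
    have h2 := l.hasFDerivAt.comp x h1
    have h3 : HasFDerivAt (fun x => Q (x - y)) (Q.comp (ContinuousLinearMap.id ℝ (Euc n))) x :=
      Q.hasFDerivAt.comp x h1
    have h4 := (h3.clm_apply h1).const_mul (1 / 2)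
    refine ((((hφd x).hasFDerivAt.sub_const (φ y)).sub h2).sub h4).congr_fderiv ?_
    ext v
    simp
    rw [hQ v x, hQ v y]
    ring
  have hfC : ContDiff ℝ 1 f := by
    have h1 : ContDiff ℝ 1 (fun x : Euc n => x - y) := by fun_prop
    have h2 : ContDiff ℝ 1 (fun x => l (x - y)) := l.contDiff.comp h1
    have h3 : ContDiff ℝ 1 (fun x => Q (x - y) (x - y)) := (Q.contDiff.comp h1).clm_apply h1
    exact ((hφ1.sub contDiff_const).sub h2).sub (contDiff_const.mul h3)
  have hfε : ∀ x ∈ ball y ρ, ε * ‖x - y‖ ^ 2 ≤ f x := by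
    intro x hx
    have h1 : φ y + l (x - y) + 1 / 2 * Q (x - y) (x - y) + ε * ‖x - y‖ ^ 2 ≤ φ x :=
      (hball x hx).1
    simp only [f]
    linarith
  -- On the annulus `ρ/2 ≤ |x - y| < ρ` one has `f ≥ m`, while `f y = 0`. Hence the transition
  -- factor in `g` vanishes where the bump `β` varies inside the ball, and `g` acts as a localised
  -- function of `f` alone.
  set m := ε * (ρ / 2) ^ 2 with hm
  have hm0 : 0 < m := by positivity
  let β : ContDiffBump y := ⟨ρ / 2, ρ, by positivity, by linarith⟩
  let g : Euc n → ℝ := fun x => β x * Real.smoothTransition (m - f x)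
  have hσd : Differentiable ℝ Real.smoothTransition :=
    (Real.smoothTransition.contDiff (n := 1)).differentiable (by norm_num)
  have hgC : ContDiff ℝ 1 g := by
    have h1 : ContDiff ℝ 1 (fun x => Real.smoothTransition (m - f x)) :=
      (Real.smoothTransition.contDiff (n := 1)).comp (contDiff_const.sub hfC)
    exact (β.contDiff (n := 1)).mul h1
  have hgs : HasCompactSupport g := β.hasCompactSupport.mul_right
  have hg0 : ∀ x, 0 ≤ g x := fun x => mul_nonneg β.nonneg (Real.smoothTransition.nonneg _)
  have hgball : ∀ x ∉ ball y ρ, g x = 0 := fun x hx => by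
    have : β x = 0 := β.zero_of_le_dist (not_lt.1 hx)
    simp only [g, this, zero_mul]
  obtain ⟨Kg, hKg⟩ := ContDiff.lipschitzWith_of_hasCompactSupport hgs hgC (by norm_num)
  have hcut : ∀ x v, fderiv ℝ β x v * Real.smoothTransition (m - f x) = 0 := by
    intro x v
    rcases lt_or_ge (dist x y) (ρ / 2) with h | h
    · have : (β : Euc n → ℝ) =ᶠ[𝓝 x] fun _ => 1 := β.eventuallyEq_one_of_mem_ball h
      rw [this.fderiv_eq]
      simp
    rcases lt_or_ge (dist x y) ρ with h' | h'
    · have h1 := hfε x h'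
      rw [← dist_eq_norm] at h1
      have h2 : m ≤ ε * dist x y ^ 2 := by
        rw [hm]
        gcongr
      rw [Real.smoothTransition.zero_of_nonpos (by linarith), mul_zero]
    · have hmin : IsLocalMin (β : Euc n → ℝ) x := by
        refine Eventually.of_forall fun z => ?_
        rw [β.zero_of_le_dist h']
        exact β.nonneg
      rw [hmin.fderiv_eq_zero]
      simp
  let F : Euc n → Euc n → ℝ := fun v x => (fderiv ℝ φ x - l - Q (x - y)) v
  have hFL : ∀ v, ∃ C, LipschitzWith C (F v) := by
    intro v
    have hQL : LipschitzWith (‖Q‖₊ * (1 + 0)) (fun x => Q (x - y)) :=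
      Q.lipschitz.comp (LipschitzWith.id.sub (LipschitzWith.const y))
    have h1 := (hΛ.sub (LipschitzWith.const l)).sub hQL
    exact ⟨_, ((ContinuousLinearMap.apply ℝ ℝ v).lipschitz).comp h1⟩
  -- Here `F v = ∂_v f` is Lipschitz, so integration by parts is legitimate. It gives `∫ ∂_vv f · g
  -- = ∫ β σ'(m - f) (∂_v f)² ≥ 0`, since `g` decreases in `f`.
  have hibp : ∀ v, 0 ≤ ∫ x, lineDeriv ℝ (F v) x v * g x := by
    intro v
    obtain ⟨C, hC⟩ := hFL v
    rw [hC.integral_lineDeriv_mul_eq hKg hgs v]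
    refine integral_nonneg fun x => ?_
    have hder : HasFDerivAt g (β x • (deriv Real.smoothTransition (m - f x) •
        -(fderiv ℝ φ x - l - Q (x - y))) + Real.smoothTransition (m - f x) • fderiv ℝ β x) x := by
      have h1 : HasFDerivAt (fun x => m - f x) (-(fderiv ℝ φ x - l - Q (x - y))) x :=
        (hf x).const_sub m
      have h2 := (hσd (m - f x)).hasDerivAt.comp_hasFDerivAt x h1
      have h3 : HasFDerivAt (β : Euc n → ℝ) (fderiv ℝ β x) x :=
        ((β.contDiff (n := 1)).differentiable (by norm_num) x).hasFDerivAt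
      exact h3.mul h2
    have hld : lineDeriv ℝ g x (-v) = β x * deriv Real.smoothTransition (m - f x) * F v x := by
      rw [(hder.hasLineDerivAt (-v)).lineDeriv]
      have := hcut x v
      simp only [add_apply, smul_apply, neg_apply, map_neg, smul_eq_mul, F]
      linarith
    rw [hld]
    have hσ' : 0 ≤ deriv Real.smoothTransition (m - f x) := Real.smoothTransition.monotone.deriv_nonneg
    have : 0 ≤ β x := β.nonneg
    simp only [Pi.zero_apply]
    rw [mul_assoc]
    have := mul_self_nonneg (F v x)
    positivity
  have hint : ∀ v, Integrable (fun x => lineDeriv ℝ (F v) x v * g x) := by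
    intro v
    obtain ⟨C, hC⟩ := hFL v
    refine Integrable.bdd_mul (c := C * ‖v‖) (hgC.continuous.integrable_of_hasCompactSupport hgs)
      (measurable_lineDeriv hC.continuous).aestronglyMeasurable (Eventually.of_forall fun x => ?_)
    exact norm_lineDeriv_le_of_lipschitz ℝ hC
  have hgint : Integrable g := hgC.continuous.integrable_of_hasCompactSupport hgs
  have hgpos : 0 < ∫ x, g x := by
    refine integral_pos_of_integrable_nonneg_nonzero (x := y) hgC.continuous hgint hg0 ?_
    have h1 : β y = 1 := β.one_of_mem_closedBall (mem_closedBall_self β.rIn_pos.le)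
    have h2 : f y = 0 := by simp [f]
    simp only [g, h1, h2, one_mul, sub_zero]
    exact (Real.smoothTransition.pos_of_pos hm0).ne'
  -- The almost everywhere hypothesis gives `(Δ + ∂_bb) f ≤ -S` where `g` lives. Integrating against
  -- `g` and using `hibp` yields `0 ≤ -S ∫ g`, impossible for `S > 0`.
  have hae : ∀ᵐ x : Euc n, (∑ i, lineDeriv ℝ (F (EuclideanSpace.basisFun (Fin n) ℝ i)) x
      (EuclideanSpace.basisFun (Fin n) ℝ i) * g x) + lineDeriv ℝ (F b) x b * g x ≤ -S * g x := by
    filter_upwards [hsup, hΛ.ae_differentiableAt (μ := volume)] with x hx hdx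
    have hline : ∀ v, lineDeriv ℝ (F v) x v = fderiv ℝ (fderiv ℝ φ) x v v - Q v v := by
      intro v
      have h1 : HasFDerivAt (fun x : Euc n => x - y) (ContinuousLinearMap.id ℝ (Euc n)) x :=
        (hasFDerivAt_id x).sub_const y
      have h3 : HasFDerivAt (fun x => Q (x - y)) (Q.comp (ContinuousLinearMap.id ℝ (Euc n))) x :=
        Q.hasFDerivAt.comp x h1
      have h4 := (hdx.hasFDerivAt.sub_const l).sub h3
      have h5 := h4.clm_apply (hasFDerivAt_const v x)
      refine (h5.hasLineDerivAt v).lineDeriv.trans ?_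
      simp
    by_cases hxb : x ∈ ball y ρ
    · have hpos : 0 < φ x := (hball x hxb).2
      have h1 := hx hpos
      rw [InnerProductSpace.laplacian_eq_iteratedFDeriv_orthonormalBasis φ
        (EuclideanSpace.basisFun (Fin n) ℝ)] at h1
      simp only [iteratedFDeriv_two_apply, Matrix.cons_val_zero, Matrix.cons_val_one] at h1
      rw [← Finset.sum_mul, ← add_mul]
      refine mul_le_mul_of_nonneg_right ?_ (hg0 x)
      simp only [hline, Finset.sum_sub_distrib]
      linarith
    · simp [hgball x hxb]
  have hfin := integral_mono_ae ((integrable_finsetSum _ fun i _ => hint _).add (hint b))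
    (hgint.const_mul (-S)) hae
  rw [integral_add' (integrable_finsetSum _ fun i _ => hint _) (hint b),
    integral_finsetSum _ fun i _ => hint _, integral_const_mul] at hfin
  have h1 := Finset.sum_nonneg fun i (_ : i ∈ Finset.univ) =>
    hibp (EuclideanSpace.basisFun (Fin n) ℝ i)
  have h2 := hibp b
  nlinarith

/-- The obstacle satisfies the differential inequality in the viscosity sense. -/
lemma obstacle_touching (hφ : IsC11 φ)
    (hconc : IsConcaveIn φ {x | 0 < φ x} ∨ IsSuperharmonicAlong b φ {x | 0 < φ x})
    {y : Euc n} (hy : 0 < φ y) {ψ : Euc n → ℝ} (hψ : ContDiffAt ℝ 2 ψ y)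
    (hmin : ∀ᶠ x in 𝓝 y, ψ x - ψ y ≤ φ x - φ y) :
    ∑ i, fderiv ℝ (fderiv ℝ ψ) y (EuclideanSpace.basisFun (Fin n) ℝ i)
      (EuclideanSpace.basisFun (Fin n) ℝ i) + fderiv ℝ (fderiv ℝ ψ) y b b ≤ 0 := by
  set B := fderiv ℝ (fderiv ℝ ψ) y with hB
  have hsymm : ∀ v w, B v w = B w v := fun v w => (hψ.isSymmSndFDerivAt (by simp)).eq v w
  have hlow : ∀ ε : ℝ, 0 < ε → ∀ᶠ x in 𝓝 y, φ y + fderiv ℝ ψ y (x - y) +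
      1 / 2 * B (x - y) (x - y) - ε * ‖x - y‖ ^ 2 ≤ φ x := by
    intro ε hε
    filter_upwards [hψ.eventually_taylor_two hε, hmin] with x h1 h2
    have := neg_le_of_abs_le h1
    linarith
  rcases hconc with hconc | hconc
  -- In the concave case each second derivative of `ψ` is nonpositive: apply midpoint concavity to
  -- `y ± s v` in a small ball inside `{φ > 0}`.
  · have hB0 : ∀ v, B v v ≤ 0 := by
      intro v
      refine le_of_forall_pos_le_add fun δ hδ => ?_
      set ε := δ / (2 * (‖v‖ ^ 2 + 1))
      have hε : 0 < ε := by positivity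
      have hεδ : 2 * ε * ‖v‖ ^ 2 ≤ δ := by
        have : 2 * ε * (‖v‖ ^ 2 + 1) = δ := by simp only [ε]; field_simp
        nlinarith
      obtain ⟨ρ, hρ, hball⟩ := Metric.eventually_nhds_iff_ball.1 ((hlow ε hε).and
        ((isOpen_lt continuous_const hφ.1.continuous).mem_nhds hy))
      have hcon := hconc (ball y ρ) (fun x hx => (hball x hx).2) (convex_ball y ρ)
      set s := ρ / (2 * (‖v‖ + 1))
      have hs : 0 < s := by positivity
      have hsv : ‖s • v‖ < ρ := by
        rw [norm_smul, Real.norm_of_nonneg hs.le]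
        have : s * (2 * (‖v‖ + 1)) = ρ := by simp only [s]; field_simp
        nlinarith [norm_nonneg v, mul_nonneg hs.le (norm_nonneg v)]
      have hp : y + s • v ∈ ball y ρ := by simpa [mem_ball_iff_norm] using hsv
      have hq : y - s • v ∈ ball y ρ := by simpa [mem_ball_iff_norm] using hsv
      have h1 := (hball _ hp).1
      have h2 := (hball _ hq).1
      have h3 := hcon.2 hp hq (by norm_num : (0 : ℝ) ≤ 1 / 2)
        (by norm_num : (0 : ℝ) ≤ 1 / 2) (by norm_num)
      have h4 : (1 / 2 : ℝ) • (y + s • v) + (1 / 2 : ℝ) • (y - s • v) = y := by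
        rw [← smul_add, add_add_sub_cancel, ← two_smul ℝ y, smul_smul]
        norm_num
      rw [h4] at h3
      simp only [add_sub_cancel_left, sub_sub_cancel_left, map_neg, neg_apply,
        map_smul, smul_apply, smul_eq_mul, norm_neg, norm_smul, mul_pow,
        Real.norm_eq_abs, sq_abs] at h1 h2 h3
      have h5 : s ^ 2 * B v v ≤ s ^ 2 * (2 * ε * ‖v‖ ^ 2) := by linarith
      have h6 := le_of_mul_le_mul_left h5 (by positivity)
      linarith
    have h1 : ∑ i, B (EuclideanSpace.basisFun (Fin n) ℝ i)
        (EuclideanSpace.basisFun (Fin n) ℝ i) ≤ 0 := Finset.sum_nonpos fun i _ => hB0 _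
    linarith [hB0 b]
  · refine le_of_forall_pos_le_add fun δ hδ => ?_
    set ε := δ / (4 * (n + ‖b‖ ^ 2 + 1))
    have hε : 0 < ε := by positivity
    have hεδ : 4 * ε * (n + ‖b‖ ^ 2) ≤ δ := by
      have : 4 * ε * (n + ‖b‖ ^ 2 + 1) = δ := by simp only [ε]; field_simp
      nlinarith
    let I : Euc n →L[ℝ] Euc n →L[ℝ] ℝ := innerSL ℝ
    have hI : ∀ v w, I v w = inner ℝ v w := fun _ _ => rfl
    -- Lowering the Hessian by `4ε` lowers the polynomial by `2ε|x - y|²`: one `ε` absorbs the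
    -- Taylor error, the other makes the touching strict. The operator changes by `4ε(n + |b|²) ≤
    -- δ`.
    let Q : Euc n →L[ℝ] Euc n →L[ℝ] ℝ := B - (4 * ε) • I
    have hQv : ∀ v, Q v v = B v v - 4 * ε * ‖v‖ ^ 2 := by
      intro v
      simp [Q, hI]
    have h := quadratic_touching_ae (b := b) hφ hconc hy (Q := Q) (l := fderiv ℝ ψ y) (ε := ε)
      (fun v w => by
        simp only [Q, sub_apply, smul_apply, hI]
        rw [hsymm v w, real_inner_comm]) hε (by
        filter_upwards [hlow ε hε] with x hx
        rw [hQv]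
        linarith)
    simp only [hQv, Finset.sum_sub_distrib, OrthonormalBasis.norm_eq_one] at h
    simp only [one_pow, mul_one, Finset.sum_const, Finset.card_univ, Fintype.card_fin,
      nsmul_eq_mul] at h
    linarith

end Touching

/-! ### Quadratic growth and the conclusion. -/

section Nondegeneracy

variable {n : ℕ} {b : Euc n} {φ u : Euc n → ℝ}

lemma contDiff_norm_sub_sq (x₁ : Euc n) : ContDiff ℝ 2 (fun x : Euc n => ‖x - x₁‖ ^ 2) :=
  (contDiff_id.sub contDiff_const).norm_sq ℝ

lemma fderiv_fderiv_norm_sub_sq (x₁ x v : Euc n) :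
    fderiv ℝ (fderiv ℝ (fun x : Euc n => ‖x - x₁‖ ^ 2)) x v v = 2 * ‖v‖ ^ 2 := by
  have h1 := (contDiff_norm_sub_sq x₁).contDiffAt (x := x) |>.hasDerivAt_fderiv_line v v
  refine h1.unique ?_
  have h2 : ∀ z : Euc n, fderiv ℝ (fun x : Euc n => ‖x - x₁‖ ^ 2) z v = 2 * inner ℝ (z - x₁) v := by
    intro z
    have h3 : HasFDerivAt (fun x : Euc n => x - x₁) (ContinuousLinearMap.id ℝ (Euc n)) z :=
      (hasFDerivAt_id z).sub_const x₁
    rw [(h3.norm_sq).fderiv]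
    simp [inner_sub_left]
  simp only [h2]
  have h4 : HasDerivAt (fun s : ℝ => 2 * (inner ℝ (x - x₁) v + s * ‖v‖ ^ 2)) (2 * ‖v‖ ^ 2) 0 := by
    simpa using (((hasDerivAt_id (0 : ℝ)).mul_const (‖v‖ ^ 2)).const_add
      (inner ℝ (x - x₁) v)).const_mul 2
  convert! h4 using 1
  funext s
  rw [add_sub_right_comm, inner_add_left, inner_smul_left, real_inner_self_eq_norm_sq]
  simp

lemma fderiv_fderiv_slice {H : Euc n × ℝ → ℝ} {t : ℝ} {x : Euc n}
    (h : ContDiffAt ℝ 2 H (x, t)) (v : Euc n) :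
    fderiv ℝ (fderiv ℝ (fun y => H (y, t))) x v v = fderiv ℝ (fderiv ℝ H) (x, t) (v, 0) (v, 0) := by
  have h1 := (contDiffAt_slice h).hasDerivAt_fderiv_line v v
  refine h1.unique ?_
  refine (h.hasDerivAt_fderiv_line (v, 0) (v, 0)).congr_of_eventuallyEq ?_
  have h2 : Tendsto (fun s : ℝ => (x, t) + s • (v, (0 : ℝ))) (𝓝 0) (𝓝 (x, t)) := by
    have := (hasDerivAt_line (x, t) (v, (0 : ℝ)) 0).continuousAt.tendsto
    simpa using this
  filter_upwards [h2.eventually h.eventually_differentiableAt_two] with s hs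
  have e1 : (x, t) + s • (v, (0 : ℝ)) = (x + s • v, t) := by ext1 <;> simp
  rw [e1] at hs ⊢
  have h3 : HasFDerivAt (fun y : Euc n => (y, t)) ((ContinuousLinearMap.id ℝ (Euc n)).prod 0)
      (x + s • v) := (hasFDerivAt_id _).prodMk (hasFDerivAt_const t _)
  have h4 := HasFDerivAt.comp (f := fun y : Euc n => (y, t)) (x + s • v) hs.hasFDerivAt h3
  have h5 : fderiv ℝ (fun y => H (y, t)) (x + s • v) = _ := h4.fderiv
  rw [h5]
  simp

/-- Growth of `u - φ` around points where `u > φ`. -/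
lemma IsObstacleSolution.exists_growth (hn : 0 < n) (hu : IsObstacleSolution b φ u)
    (hφ : IsC11 φ)
    (hconc : IsConcaveIn φ {x | 0 < φ x} ∨ IsSuperharmonicAlong b φ {x | 0 < φ x})
    (hne : {x | 0 < φ x}.Nonempty) (hK : IsCompact {x | u x = φ x}) (R₀ : ℝ) :
    ∃ κ > 0, ∀ x₁ : Euc n, φ x₁ < u x₁ → ∀ r : ℝ, 0 < r →
      closedBall x₁ r ⊆ {x | 0 < φ x} → closedBall x₁ r ⊆ closedBall 0 R₀ →
      ∃ x ∈ closedBall x₁ r, κ * r ^ 2 ≤ u x - φ x := by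
  obtain ⟨M, hM⟩ := exists_bound_of_tendsto_cocompact hu.continuous hu.vanishing
  have hUc := continuous_poissonExt hu.continuous hM
  have hφc : Continuous φ := hφ.1.continuous
  obtain ⟨c, hc, hell⟩ := hu.exists_elliptic_lower_bound (b := b) hn hφ hne hK R₀
  -- Chosen so that `(Δ + ∂_bb)(κ|x - x₁|²) = 2κ(n + |b|²) < c`.
  set κ := c / (4 * (n + ‖b‖ ^ 2 + 1)) with hκdef
  have hκ : 0 < κ := by positivity
  refine ⟨κ, hκ, fun x₁ hx₁ r hr hball hballR => ?_⟩
  by_contra! hcon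
  set δ := (u x₁ - φ x₁) / 2 with hδ
  have hδ0 : 0 < δ := by
    rw [hδ]
    linarith
  -- Cutting at the level `δ` keeps `D` at positive distance from the contact set, so one height `t`
  -- serves all of `D` in the elliptic bound.
  set D : Set (Euc n) := closedBall x₁ r ∩ {x | δ ≤ u x - φ x} with hD
  have hDc : IsCompact D := (isCompact_closedBall x₁ r).inter_right
    (isClosed_le continuous_const (hu.continuous.sub hφc))
  have hx₁D : x₁ ∈ D := ⟨mem_closedBall_self hr.le, show δ ≤ u x₁ - φ x₁ by linarith⟩
  have hdisj : Disjoint D {x | u x = φ x} := by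
    rw [Set.disjoint_left]
    intro x hx hxK
    have h1 : δ ≤ u x - φ x := hx.2
    have h2 : u x = φ x := hxK
    linarith
  obtain ⟨d', hd', hthick⟩ := hdisj.exists_thickenings hDc hK.isClosed
  set d := min d' 1
  have hd : 0 < d := lt_min hd' one_pos
  obtain ⟨t₀, ht₀, hlow⟩ := hell d hd (min_le_right _ _)
  have hunif : ∀ᶠ t : ℝ in 𝓝[>] 0, ∀ x ∈ D, |poissonExt u (x, t) - u x| < δ / 2 := by
    have h1 : Continuous (fun q : ℝ × Euc n => |poissonExt u (q.2, q.1) - u q.2|) := by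
      have := hu.continuous
      fun_prop
    have h2 : ∀ᶠ t in 𝓝 (0 : ℝ), ∀ x ∈ D, |poissonExt u (x, t) - u x| < δ / 2 := by
      refine hDc.eventually_forall_of_forall_eventually fun x _ => ?_
      refine (h1.tendsto ((0 : ℝ), x)).eventually_lt_const ?_
      rw [poissonExt_zero_right]
      simpa using half_pos hδ0
    exact nhdsWithin_le_nhds h2
  have htt : ∀ᶠ t : ℝ in 𝓝[>] 0, t < t₀ := nhdsWithin_le_nhds (Iio_mem_nhds ht₀)
  obtain ⟨t, hclose, htt₀, ht⟩ := (hunif.and (htt.and self_mem_nhdsWithin)).exists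
  have ht0 : (0 : ℝ) < t := ht
  let ψ : Euc n → ℝ := fun x => poissonExt u (x, t) + -κ * ‖x - x₁‖ ^ 2
  have hUt : Continuous (fun x => poissonExt u (x, t)) := hUc.comp (by fun_prop)
  have hψc : Continuous ψ := by fun_prop
  obtain ⟨y, hyD, hymax⟩ := hDc.exists_isMaxOn ⟨x₁, hx₁D⟩ (hψc.sub hφc).continuousOn
  have h1 : ψ x₁ - φ x₁ ≤ ψ y - φ y := hymax hx₁D
  have hcy := abs_lt.1 (hclose y hyD)
  have hcx := abs_lt.1 (hclose x₁ hx₁D)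
  -- The gap at `x₁` is `2δ` and replacing `u` by `U(·, t)` costs less than `δ/2` at each of the two
  -- points. Thus `y` is off the level set `u - φ = δ`, and `hcon` keeps it off the sphere, so the
  -- maximum is interior to `D`.
  have hbig : δ + κ * ‖y - x₁‖ ^ 2 < u y - φ y := by
    simp only [ψ, sub_self, norm_zero] at h1
    linarith [hcy.1, hcy.2, hcx.1, hcx.2]
  have hyr : ‖y - x₁‖ < r := by
    by_contra! hge
    have h2 := hcon y hyD.1
    have h3 : κ * r ^ 2 ≤ κ * ‖y - x₁‖ ^ 2 := by gcongr
    linarith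
  have hDnhds : D ∈ 𝓝 y := by
    refine inter_mem (closedBall_mem_nhds_of_mem (mem_ball_iff_norm.2 hyr)) ?_
    have h2 : δ < u y - φ y := by
      have : 0 ≤ κ * ‖y - x₁‖ ^ 2 := by positivity
      linarith
    filter_upwards [(isOpen_lt continuous_const (hu.continuous.sub hφc)).mem_nhds h2] with x hx
    exact le_of_lt hx
  have hUC : ContDiffAt ℝ 2 (poissonExt u) (y, t) := contDiffAt_poissonExt hu.continuous hM ht0
  have hk : ContDiffAt ℝ 2 (fun x : Euc n => -κ * ‖x - x₁‖ ^ 2) y :=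
    (contDiff_const.mul (contDiff_norm_sub_sq x₁)).contDiffAt
  have hψC : ContDiffAt ℝ 2 ψ y := (contDiffAt_slice hUC).add hk
  have htouch := obstacle_touching (b := b) hφ hconc (hball hyD.1) hψC (by
    filter_upwards [hDnhds] with x hx
    have h2 : ψ x - φ x ≤ ψ y - φ y := hymax hx
    linarith)
  have hkD : ∀ v, fderiv ℝ (fderiv ℝ (fun x : Euc n => -κ * ‖x - x₁‖ ^ 2)) y v v =
      -κ * (2 * ‖v‖ ^ 2) := by
    intro v
    have e1 : fderiv ℝ (fun x : Euc n => -κ * ‖x - x₁‖ ^ 2) =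
        fun z => -κ • fderiv ℝ (fun x : Euc n => ‖x - x₁‖ ^ 2) z := by
      funext z
      exact fderiv_const_mul ((contDiff_norm_sub_sq x₁).differentiable (by norm_num) z) _
    rw [e1, fderiv_fun_const_smul (contDiff_norm_sub_sq x₁).contDiffAt.differentiableAt_fderiv_two]
    simp only [smul_apply, fderiv_fderiv_norm_sub_sq, smul_eq_mul]
  have hψD : ∀ v, fderiv ℝ (fderiv ℝ ψ) y v v =
      fderiv ℝ (fderiv ℝ (poissonExt u)) (y, t) (v, 0) (v, 0) - 2 * κ * ‖v‖ ^ 2 := by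
    intro v
    rw [(contDiffAt_slice hUC).fderiv_fderiv_add hk]
    simp only [add_apply]
    rw [hkD, fderiv_fderiv_slice hUC]
    ring
  simp only [hψD, Finset.sum_sub_distrib, OrthonormalBasis.norm_eq_one, one_pow, mul_one,
    Finset.sum_const, Finset.card_univ, Fintype.card_fin, nsmul_eq_mul] at htouch
  have hell' := hlow t ht0 htt₀ y (by simpa using hballR hyD.1) (fun z hz => by
    by_contra! hlt
    refine Set.disjoint_left.1 hthick (show z ∈ thickening d' D from ?_) ?_
    · refine mem_thickening_iff.2 ⟨y, hyD, ?_⟩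
      rw [dist_comm, dist_eq_norm]
      exact hlt.trans_le (min_le_left _ _)
    · exact thickening_mono (min_le_left _ _) _ hz)
  have hκc : 4 * κ * (n + ‖b‖ ^ 2 + 1) = c := by
    rw [hκdef]
    field_simp
  nlinarith [sq_nonneg ‖b‖, (Nat.cast_nonneg n : (0 : ℝ) ≤ n)]

end Nondegeneracy

theorem proposition9p1 {n : ℕ} (b : EuclideanSpace ℝ (Fin n))
    (φ : EuclideanSpace ℝ (Fin n) → ℝ) (hφ : IsC11 φ)
    (hconc : IsConcaveIn φ {x | 0 < φ x} ∨ IsSuperharmonicAlong b φ {x | 0 < φ x})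
    (hne : {x | 0 < φ x}.Nonempty) (hcpt : IsCompact (closure {x | 0 < φ x}))
    (u : EuclideanSpace ℝ (Fin n) → ℝ) (hu : IsObstacleSolution b φ u) :
    ∃ c > 0, ∃ r₀ > 0, ∀ x₀ ∈ frontier {x | u x = φ x}, ∀ r : ℝ, 0 < r → r < r₀ →
      c * r ^ 2 ≤ sSup ((fun y => u y - φ y) '' ball x₀ r) := by
  have hφc : Continuous φ := hφ.1.continuous
  -- In dimension zero the space is discrete, so there are no free boundary points.
  rcases Nat.eq_zero_or_pos n with rfl | hn
  · refine ⟨1, one_pos, 1, one_pos, fun x₀ hx₀ => ?_⟩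
    rw [(isClopen_discrete {x | u x = φ x}).frontier_eq] at hx₀
    exact absurd hx₀ (notMem_empty _)
  have hK := hu.isCompact_contact (b := b) hn hφc hne hcpt
  obtain ⟨ρ, hρ, hthick⟩ := hK.exists_thickening_subset_open
    (isOpen_lt continuous_const hφc) (hu.contact_subset (b := b) hn hne)
  obtain ⟨RK, hRK⟩ := hK.isBounded.subset_closedBall (0 : Euc n)
  obtain ⟨κ, hκ, hgrow⟩ := hu.exists_growth (b := b) hn hφ hconc hne hK (RK + ρ)
  -- The growth lemma is applied in a ball of radius `r/4` about a noncontact point `x₁` within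
  -- `r/4` of `x₀`. That ball lies in `ball x₀ r`, hence in `{φ > 0}` since `r < ρ`.
  refine ⟨κ / 16, by positivity, ρ, hρ, fun x₀ hx₀ r hr hrρ => ?_⟩
  have hx₀K : x₀ ∈ {x | u x = φ x} := hK.isClosed.frontier_subset hx₀
  have hx₀c : x₀ ∈ closure {x | u x = φ x}ᶜ := by
    rw [frontier_eq_closure_inter_closure] at hx₀
    exact hx₀.2
  obtain ⟨x₁, hx₁, hdist⟩ := Metric.mem_closure_iff.1 hx₀c (r / 4) (by positivity)
  have hx₁u : φ x₁ < u x₁ := lt_of_le_of_ne (hu.above x₁) fun h => hx₁ h.symm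
  have hsub : closedBall x₁ (r / 4) ⊆ ball x₀ r := by
    refine closedBall_subset_ball' ?_
    rw [dist_comm]
    linarith
  have hsub' : ball x₀ r ⊆ thickening ρ {x | u x = φ x} := fun x hx =>
    mem_thickening_iff.2 ⟨x₀, hx₀K, lt_trans hx hrρ⟩
  obtain ⟨x, hx, hgx⟩ := hgrow x₁ hx₁u (r / 4) (by positivity)
    ((hsub.trans hsub').trans hthick) (by
      refine (hsub.trans ball_subset_closedBall).trans (closedBall_subset_closedBall' ?_)
      have := hRK hx₀K
      rw [mem_closedBall] at this
      linarith)
  have hbdd : BddAbove ((fun y => u y - φ y) '' ball x₀ r) := by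
    refine BddAbove.mono (image_mono ball_subset_closedBall) ?_
    exact (isCompact_closedBall x₀ r).bddAbove_image (hu.continuous.sub hφc).continuousOn
  refine le_trans ?_ (le_csSup hbdd (mem_image_of_mem _ (hsub hx)))
  refine le_trans (le_of_eq ?_) hgx
  ring
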